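/- For every dimension $D$ there are a preprocessing program and a query program for the real RAM (unit-cost arithmetic and comparisons on real numbers, no square root and no floor function; unit-cost arithmetic on machine words of logarithmic length, which serve as addresses) and a constant $C$, depending only on $D$, such that the following holds for every $n\ge 1$, all points $p_1,\dots,p_n\in\mathbb R^D$ with weights $w(p_1),\dots,w(p_n)>0$, and every parameter $\varepsilon>0$, where $\log^+ x=\max(0,\log x)$. 1. Given the points, the weights and $\varepsilon$, the preprocessing program, with words of $O(\log(n+1/\varepsilon))$ bits, halts after at most $$C\bigl(n\log (n+1)+\varepsilon^{1/2-D}\log^+(1/\varepsilon)\bigr)$$ steps. 2. The data structure that it leaves in memory uses space $O(n)$: it consists of at most $Cn$ words, each holding an integer less than $Cn$, and at most $Cn$ real numbers. 3. For every query point $q\in\mathbb R^D$ the query program, started with $q$ and with access to this data structure only, halts after at most $$C\bigl(\log (n+1)+\varepsilon^{(-D-1)/2}\log^+(1/\varepsilon)\bigr)$$ steps, leaves the data structure unchanged, and returns an $\varepsilon$-approximate weighted farthest neighbour of $q$, that is, a point $r\in\{p_1,\dots,p_n\}$ with $$w(r)\,\|q-r\|\ \ge\ (1-\varepsilon)\,w(p_i)\,\|q-p_i\|\qquad\text{for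 all } i=1,\dots,n.$$ -/

import Mathlib

/-! A real RAM, presented as a small structured programming language with unit-cost instructions.

A machine of size `M` has a memory of `M` words and a memory of `M` reals, both addressed
by `0, …, M - 1`, and every word holds a natural number `< M`.  In addition a program uses finitely
many word registers and finitely many real registers (the ones that occur in its text).
A fault (word overflow, address `≥ M`, division by zero) leaves the program without a
result.  There is no floor function, no square root, and a program contains no real constants:
the only transfer from reals to words is by comparisons. -/

namespace RealRAM

/-- Contents of the registers and of the two memories. -/
structure State where
  wreg : ℕ → ℕ
  rreg : ℕ → ℝ
  wmem : ℕ → ℕ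
  rmem : ℕ → ℝ

/-- Elementary instructions.  The arguments are the numbers of registers (the target comes first),
except for `k` in `wconst`, which is a literal. -/
inductive Instr where
  | wconst (x k : ℕ)
  | wmove (x y : ℕ)
  | wadd (x y z : ℕ)
  | wsub (x y z : ℕ)
  | wmul (x y z : ℕ)
  | wdiv (x y z : ℕ)
  | wload (x y : ℕ)
  | wstore (x y : ℕ)
  | rcast (x y : ℕ)
  | rmove (x y : ℕ)
  | radd (x y z : ℕ)
  | rsub (x y z : ℕ)
  | rmul (x y z : ℕ)
  | rdiv (x y z : ℕ)
  | rload (x y : ℕ)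
  | rstore (x y : ℕ)

/-- Tests: comparison of two word registers, or of two real registers. -/
inductive Test where
  | wlt (x y : ℕ)
  | wle (x y : ℕ)
  | rlt (x y : ℕ)
  | rle (x y : ℕ)

/-- Programs. -/
inductive Prog where
  | skip
  | instr (a : Instr)
  | seq (c d : Prog)
  | ite (b : Test) (c d : Prog)
  | loop (b : Test) (c : Prog)

/-- Write `v` into word register `x`; a fault if `v` does not fit into a word. -/
def State.setW (M : ℕ) (s : State) (x v : ℕ) : Option State :=
  if v < M then some { s with wreg := Function.update s.wreg x v } else none

/-- Write `v` into real register `x`. -/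
noncomputable def State.setR (s : State) (x : ℕ) (v : ℝ) : State :=
  { s with rreg := Function.update s.rreg x v }

/-- Effect of an instruction on a machine of size `M`; `none` is a fault. -/
noncomputable def Instr.eval (M : ℕ) (s : State) : Instr → Option State
  | .wconst x k => s.setW M x k
  | .wmove x y => s.setW M x (s.wreg y)
  | .wadd x y z => s.setW M x (s.wreg y + s.wreg z)
  | .wsub x y z => s.setW M x (s.wreg y - s.wreg z)
  | .wmul x y z => s.setW M x (s.wreg y * s.wreg z)
  | .wdiv x y z => if s.wreg z = 0 then none else s.setW M x (s.wreg y / s.wreg z)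
  | .wload x y => if s.wreg y < M then s.setW M x (s.wmem (s.wreg y)) else none
  | .wstore x y =>
      if s.wreg x < M ∧ s.wreg y < M then
        some { s with wmem := Function.update s.wmem (s.wreg x) (s.wreg y) }
      else none
  | .rcast x y => some (s.setR x (s.wreg y : ℝ))
  | .rmove x y => some (s.setR x (s.rreg y))
  | .radd x y z => some (s.setR x (s.rreg y + s.rreg z))
  | .rsub x y z => some (s.setR x (s.rreg y - s.rreg z))
  | .rmul x y z => some (s.setR x (s.rreg y * s.rreg z))
  | .rdiv x y z =>
      open Classical in if s.rreg z = 0 then none else some (s.setR x (s.rreg y / s.rreg z))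
  | .rload x y => if s.wreg y < M then some (s.setR x (s.rmem (s.wreg y))) else none
  | .rstore x y =>
      if s.wreg x < M then
        some { s with rmem := Function.update s.rmem (s.wreg x) (s.rreg y) }
      else none

/-- Truth of a test in a state. -/
def Test.Holds (s : State) : Test → Prop
  | .wlt x y => s.wreg x < s.wreg y
  | .wle x y => s.wreg x ≤ s.wreg y
  | .rlt x y => s.rreg x < s.rreg y
  | .rle x y => s.rreg x ≤ s.rreg y

/-- `Runs M c s t s'`: started in `s` on a machine of size `M`, the program `c` halts without a
fault in state `s'` after exactly `t` steps.  An instruction is one step, and so is each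
evaluation of a test. -/
inductive Runs (M : ℕ) : Prog → State → ℕ → State → Prop
  | skip (s : State) : Runs M .skip s 0 s
  | instr (a : Instr) (s s' : State) (h : a.eval M s = some s') : Runs M (.instr a) s 1 s'
  | seq (c d : Prog) (s s' s'' : State) (t t' : ℕ)
      (hc : Runs M c s t s') (hd : Runs M d s' t' s'') : Runs M (.seq c d) s (t + t') s''
  | ite_true (b : Test) (c d : Prog) (s s' : State) (t : ℕ) (hb : b.Holds s)
      (hc : Runs M c s t s') : Runs M (.ite b c d) s (t + 1) s'
  | ite_false (b : Test) (c d : Prog) (s s' : State) (t : ℕ) (hb : ¬ b.Holds s)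
      (hd : Runs M d s t s') : Runs M (.ite b c d) s (t + 1) s'
  | loop_true (b : Test) (c : Prog) (s s' s'' : State) (t t' : ℕ) (hb : b.Holds s)
      (hc : Runs M c s t s') (hl : Runs M (.loop b c) s' t' s'') :
      Runs M (.loop b c) s (t + t' + 1) s''
  | loop_false (b : Test) (c : Prog) (s : State) (hb : ¬ b.Holds s) : Runs M (.loop b c) s 1 s

end RealRAM

namespace FarthestNeighbor

open RealRAM

/-- `r` is (the index of) an `ε`-approximate weighted farthest neighbour of `q` among the points
`p i` with weights `w i`. -/
def IsApproxFarthest {D n : ℕ} (p : Fin n → EuclideanSpace ℝ (Fin D)) (w : Fin n → ℝ) (ε : ℝ)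
    (q : EuclideanSpace ℝ (Fin D)) (r : Fin n) : Prop :=
  ∀ i, (1 - ε) * (w i * dist q (p i)) ≤ w r * dist q (p r)

/-- Start of preprocessing: word register `0` holds `n`, real register `0` holds `ε`, and the real
memory holds, for `i = 0, …, n - 1` in turn, the `D` coordinates of `p i` followed by `w i`.
Everything else is `0`. -/
noncomputable def inputState {D n : ℕ} (p : Fin n → EuclideanSpace ℝ (Fin D)) (w : Fin n → ℝ)
    (ε : ℝ) : State where
  wreg x := if x = 0 then n else 0
  rreg x := if x = 0 then ε else 0
  wmem _ := 0
  rmem a :=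
    if hi : a / (D + 1) < n then
      if hj : a % (D + 1) < D then p ⟨a / (D + 1), hi⟩ ⟨a % (D + 1), hj⟩
      else w ⟨a / (D + 1), hi⟩
    else 0

/-- Start of a query: the two memories are those of `s`, the real registers `0, …, D - 1` hold
the coordinates of `q`, and all other registers are `0`.  (A query that runs on a
machine of size `M` has no access to what the memories hold beyond its `M` cells.) -/
noncomputable def queryState {D : ℕ} (s : State) (q : EuclideanSpace ℝ (Fin D)) : State where
  wreg _ := 0
  rreg x := if hx : x < D then q ⟨x, hx⟩ else 0
  wmem := s.wmem
  rmem := s.rmem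

end FarthestNeighbor

/-!
Let `c` be a point of maximal weight `W`, and `R` the largest absolute value of a coordinate of a
vector `w_e (p_e - c)`.  Then the vectors `V e = (w_e (p_e - c) / R, w_e / W)` in
`[-1, 1] ^ (D + 1)` linearise the weighted distances `w_e ‖q - p_e‖`: if `u` is a unit vector, then
`w_e ⟨u, q - p_e⟩` is a linear function `⟨ξ, V e⟩` with `ξ = (-R u, W ⟨u, q - c⟩)`, and every
coordinate of `ξ` is at most twice the farthest distance of `q`.  So it suffices to keep a set `S`
of points that contains, for every `ξ`, a point whose value `⟨ξ, V e⟩` is within `O(ε) ‖ξ‖_∞` of the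
maximum (`exists_selected_far`).

Such a set is found one facet of the cube of directions at a time (`exists_linear_le`).  On the
facet where coordinate `0` of the direction `ζ` is `1` and the others are at most `1` in absolute
value, a point of the hyperplane `x_0 = 2` is used in place of a direction.  If `V t` is maximal in
direction `ζ`, put `a = V t + τ ζ` with `τ = 2 - (V t)_0`; a point that is almost nearest to a net
point next to `a` is almost maximal in direction `ζ`.  As the loss is quadratic in the distance
between `a` and the net point, a net with `K = 2 ^ k` values per axis suffices for `K ^ 2` of order
`D / ε` (`Selects.exists_inner_le`).  Hence `S` has `O(ε ^ (-D / 2))` points, and a query simply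
compares all points of `S` (`query_spec`).

The nearest points for all `K ^ D` net points are found one coordinate at a time.  Stage `σ` keeps a
tree for each net point in the coordinates `1, …, σ` and each cell, of side `2 / K ^ 2`, in the
coordinates `σ + 2, …, D`.  The tree represents the lower envelope, over the `K` net values of
coordinate `σ + 1`, of the parabolas given by the squared distances of the points of the cell in the
coordinates `0, …, σ + 1`.  It is a Li Chao tree: an insertion passes the parabola that loses at the
middle of an interval to the half in which it may still win, so insertions and queries take
`O(k)` steps without any computation of intersection points (`covers_step`, `insert_spec`,
`treeMin_spec`).  The minima of the trees of one stage are inserted into the trees of the next stage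
(`stageBody_spec`); a point may be replaced by another one of its cell there, at a cost of
`20 / K ^ 2` (`sq_sub_le_of_cell_eq`).  Each stage handles at most `K ^ (2 D - 1)` pairs of a tree
and a net value, which gives `O((n + K ^ (2 D - 1)) k)` steps in all (`preprocessTime_le`), and
`exists_preprocess_bound` turns this into the required bound.
-/

namespace RealRAM

/-! ### A calculus of total correctness with running times -/

/-- `HaltsWithin M c s T Q`: started in `s`, the program `c` halts without a fault, after at most
`T` steps, in a state that satisfies `Q`. -/
def HaltsWithin (M : ℕ) (c : Prog) (s : State) (T : ℕ) (Q : State → Prop) : Prop :=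
  ∃ t s', Runs M c s t s' ∧ t ≤ T ∧ Q s'

infixr:60 " ;; " => Prog.seq

/-- A sequence of elementary instructions. -/
def Prog.block : List Instr → Prog
  | [] => .skip
  | a :: l => .instr a ;; Prog.block l

/-- Weakest precondition of an instruction. -/
def Instr.wp (M : ℕ) (s : State) (Q : State → Prop) : Instr → Prop
  | .wconst x k => k < M ∧ Q { s with wreg := Function.update s.wreg x k }
  | .wmove x y => s.wreg y < M ∧ Q { s with wreg := Function.update s.wreg x (s.wreg y) }
  | .wadd x y z => s.wreg y + s.wreg z < M ∧
      Q { s with wreg := Function.update s.wreg x (s.wreg y + s.wreg z) }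
  | .wsub x y z => s.wreg y - s.wreg z < M ∧
      Q { s with wreg := Function.update s.wreg x (s.wreg y - s.wreg z) }
  | .wmul x y z => s.wreg y * s.wreg z < M ∧
      Q { s with wreg := Function.update s.wreg x (s.wreg y * s.wreg z) }
  | .wdiv x y z => s.wreg z ≠ 0 ∧ s.wreg y / s.wreg z < M ∧
      Q { s with wreg := Function.update s.wreg x (s.wreg y / s.wreg z) }
  | .wload x y => s.wreg y < M ∧ s.wmem (s.wreg y) < M ∧
      Q { s with wreg := Function.update s.wreg x (s.wmem (s.wreg y)) }
  | .wstore x y => s.wreg x < M ∧ s.wreg y < M ∧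
      Q { s with wmem := Function.update s.wmem (s.wreg x) (s.wreg y) }
  | .rcast x y => Q { s with rreg := Function.update s.rreg x (s.wreg y : ℝ) }
  | .rmove x y => Q { s with rreg := Function.update s.rreg x (s.rreg y) }
  | .radd x y z => Q { s with rreg := Function.update s.rreg x (s.rreg y + s.rreg z) }
  | .rsub x y z => Q { s with rreg := Function.update s.rreg x (s.rreg y - s.rreg z) }
  | .rmul x y z => Q { s with rreg := Function.update s.rreg x (s.rreg y * s.rreg z) }
  | .rdiv x y z => s.rreg z ≠ 0 ∧
      Q { s with rreg := Function.update s.rreg x (s.rreg y / s.rreg z) }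
  | .rload x y => s.wreg y < M ∧
      Q { s with rreg := Function.update s.rreg x (s.rmem (s.wreg y)) }
  | .rstore x y => s.wreg x < M ∧
      Q { s with rmem := Function.update s.rmem (s.wreg x) (s.rreg y) }

theorem Instr.wp.eval {M : ℕ} {s : State} {Q : State → Prop} {a : Instr} (h : a.wp M s Q) :
    ∃ s', a.eval M s = some s' ∧ Q s' := by
  cases a <;> simp only [Instr.wp] at h <;>
    simp_all [Instr.eval, State.setW, State.setR]

/-- Weakest precondition of a program without loops. -/
def Prog.wp (M : ℕ) : Prog → State → (State → Prop) → Prop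
  | .skip, s, Q => Q s
  | .instr a, s, Q => a.wp M s Q
  | .seq c d, s, Q => c.wp M s (fun s' => d.wp M s' Q)
  | .ite b c d, s, Q => (b.Holds s → c.wp M s Q) ∧ (¬ b.Holds s → d.wp M s Q)
  | .loop _ _, _, _ => False

/-- A bound for the running time of a program without loops. -/
def Prog.cost : Prog → ℕ
  | .skip => 0
  | .instr _ => 1
  | .seq c d => c.cost + d.cost
  | .ite _ c d => max c.cost d.cost + 1
  | .loop _ _ => 0

theorem HaltsWithin.of_wp {M : ℕ} {c : Prog} {s : State} {Q : State → Prop} {T : ℕ}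
    (h : c.wp M s Q) (hT : c.cost ≤ T) : HaltsWithin M c s T Q := by
  suffices H : HaltsWithin M c s c.cost Q by
    obtain ⟨t, s', h1, h2, h3⟩ := H
    exact ⟨t, s', h1, h2.trans hT, h3⟩
  clear hT T
  induction c generalizing s Q with
  | skip => exact ⟨0, s, .skip s, le_rfl, h⟩
  | instr a =>
    obtain ⟨s', h1, h2⟩ := Instr.wp.eval h
    exact ⟨1, s', .instr a s s' h1, le_rfl, h2⟩
  | seq c d ihc ihd =>
    obtain ⟨t, s1, h1, h2, h3⟩ := ihc h
    obtain ⟨t', s2, h1', h2', h3'⟩ := ihd h3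
    exact ⟨t + t', s2, .seq _ _ _ _ _ _ _ h1 h1', add_le_add h2 h2', h3'⟩
  | ite b c d ihc ihd =>
    by_cases hb : b.Holds s
    · obtain ⟨t, s1, h1, h2, h3⟩ := ihc (h.1 hb)
      exact ⟨t + 1, s1, .ite_true _ _ _ _ _ _ hb h1,
        Nat.succ_le_succ (h2.trans (le_max_left _ _)), h3⟩
    · obtain ⟨t, s1, h1, h2, h3⟩ := ihd (h.2 hb)
      exact ⟨t + 1, s1, .ite_false _ _ _ _ _ _ hb h1,
        Nat.succ_le_succ (h2.trans (le_max_right _ _)), h3⟩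
  | loop b c => exact h.elim

theorem HaltsWithin.of_wp_imp {M : ℕ} {c : Prog} {s : State} {Q : State → Prop} {T : ℕ}
    (h : ∀ Q' : State → Prop, (∀ s', Q s' → Q' s') → c.wp M s Q') (hT : c.cost ≤ T) :
    HaltsWithin M c s T Q :=
  .of_wp (h Q fun _ => id) hT

/-- Does the instruction write into word register `x`? -/
def Instr.writesW (x : ℕ) : Instr → Bool
  | .wconst y _ | .wmove y _ | .wadd y _ _ | .wsub y _ _ | .wmul y _ _ | .wdiv y _ _
  | .wload y _ => y == x
  | _ => false

/-- Does the instruction write into real register `x`? -/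
def Instr.writesR (x : ℕ) : Instr → Bool
  | .rcast y _ | .rmove y _ | .radd y _ _ | .rsub y _ _ | .rmul y _ _ | .rdiv y _ _
  | .rload y _ => y == x
  | _ => false

/-- Does the instruction write into the word memory? -/
def Instr.storesW : Instr → Bool
  | .wstore _ _ => true
  | _ => false

/-- Does the instruction write into the real memory? -/
def Instr.storesR : Instr → Bool
  | .rstore _ _ => true
  | _ => false

/-- Does some instruction of the program have property `P`? -/
def Prog.any (P : Instr → Bool) : Prog → Bool
  | .skip => false
  | .instr a => P a
  | .seq c d => c.any P || d.any P
  | .ite _ c d => c.any P || d.any P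
  | .loop _ c => c.any P

/-- `s'` differs from `s` at most in what the text of `c` allows `c` to change. -/
structure Frame (c : Prog) (s s' : State) : Prop where
  w : ∀ x, c.any (Instr.writesW x) = false → s'.wreg x = s.wreg x
  r : ∀ x, c.any (Instr.writesR x) = false → s'.rreg x = s.rreg x
  wm : c.any Instr.storesW = false → s'.wmem = s.wmem
  rm : c.any Instr.storesR = false → s'.rmem = s.rmem

theorem Frame.refl (c : Prog) (s : State) : Frame c s s :=
  ⟨fun _ _ => rfl, fun _ _ => rfl, fun _ => rfl, fun _ => rfl⟩

theorem Frame.trans {c : Prog} {s s' s'' : State} (h : Frame c s s') (h' : Frame c s' s'') :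
    Frame c s s'' :=
  ⟨fun x hx => (h'.w x hx).trans (h.w x hx), fun x hx => (h'.r x hx).trans (h.r x hx),
    fun hx => (h'.wm hx).trans (h.wm hx), fun hx => (h'.rm hx).trans (h.rm hx)⟩

theorem Frame.mono {c d : Prog} {s s' : State} (h : Frame c s s')
    (hcd : ∀ P, d.any P = false → c.any P = false) : Frame d s s' :=
  ⟨fun x hx => h.w x (hcd _ hx), fun x hx => h.r x (hcd _ hx), fun hx => h.wm (hcd _ hx),
    fun hx => h.rm (hcd _ hx)⟩

theorem Instr.frame {M : ℕ} {a : Instr} {s s' : State} (h : a.eval M s = some s') :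
    Frame (.instr a) s s' := by
  have key : ∀ {x y v : ℕ}, (y == x) = false → Function.update s.wreg y v x = s.wreg x := by
    intro x y v hxy
    exact Function.update_of_ne (by rintro rfl; simp at hxy) _ _
  have key' : ∀ {x y : ℕ} {v : ℝ}, (y == x) = false →
      Function.update s.rreg y v x = s.rreg x := by
    intro x y v hxy
    exact Function.update_of_ne (by rintro rfl; simp at hxy) _ _
  cases a <;> simp only [Instr.eval, State.setW, State.setR] at h <;>
    (try split_ifs at h) <;> cases h <;>
    refine ⟨fun x hx => ?_, fun x hx => ?_, fun hx => ?_, fun hx => ?_⟩ <;>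
    first
    | rfl
    | exact key hx
    | exact key' hx
    | exact absurd hx (by simp [Prog.any, Instr.storesW, Instr.storesR])

theorem Runs.frame {M : ℕ} {c : Prog} {s s' : State} {t : ℕ} (h : Runs M c s t s') :
    Frame c s s' := by
  induction h with
  | skip s => exact Frame.refl _ _
  | instr a s s' h => exact Instr.frame h
  | seq c d s s' s'' t t' _ _ ihc ihd =>
    exact Frame.trans (s' := s') (ihc.mono fun P h => by simp_all [Prog.any])
      (ihd.mono fun P h => by simp_all [Prog.any])
  | ite_true b c d s s' t _ _ ih => exact ih.mono fun P h => by simp_all [Prog.any]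
  | ite_false b c d s s' t _ _ ih => exact ih.mono fun P h => by simp_all [Prog.any]
  | loop_true b c s s' s'' t t' _ _ _ ihc ihl =>
    exact Frame.trans (s' := s') (ihc.mono fun P h => h) ihl
  | loop_false b c s _ => exact Frame.refl _ _

theorem HaltsWithin.mono {M : ℕ} {c : Prog} {s : State} {T T' : ℕ} {Q Q' : State → Prop}
    (h : HaltsWithin M c s T Q) (hT : T ≤ T') (hQ : ∀ s', Frame c s s' → Q s' → Q' s') :
    HaltsWithin M c s T' Q' := by
  obtain ⟨t, s', h1, h2, h3⟩ := h
  exact ⟨t, s', h1, h2.trans hT, hQ _ h1.frame h3⟩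

theorem HaltsWithin.seq {M : ℕ} {c d : Prog} {s : State} {T₁ T₂ T : ℕ} {Q₁ Q : State → Prop}
    (hc : HaltsWithin M c s T₁ Q₁)
    (hd : ∀ s', Frame c s s' → Q₁ s' → HaltsWithin M d s' T₂ Q) (hT : T₁ + T₂ ≤ T) :
    HaltsWithin M (c ;; d) s T Q := by
  obtain ⟨t, s', h1, h2, h3⟩ := hc
  obtain ⟨t', s'', h1', h2', h3'⟩ := hd s' h1.frame h3
  exact ⟨t + t', s'', .seq _ _ _ _ _ _ _ h1 h1', (add_le_add h2 h2').trans hT, h3'⟩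

theorem HaltsWithin.ite {M : ℕ} {b : Test} {c d : Prog} {s : State} {T : ℕ} {Q : State → Prop}
    (hc : b.Holds s → HaltsWithin M c s T Q) (hd : ¬ b.Holds s → HaltsWithin M d s T Q) :
    HaltsWithin M (.ite b c d) s (T + 1) Q := by
  by_cases hb : b.Holds s
  · obtain ⟨t, s', h1, h2, h3⟩ := hc hb
    exact ⟨t + 1, s', .ite_true _ _ _ _ _ _ hb h1, by omega, h3⟩
  · obtain ⟨t, s', h1, h2, h3⟩ := hd hb
    exact ⟨t + 1, s', .ite_false _ _ _ _ _ _ hb h1, by omega, h3⟩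

/-- The rule for a loop whose body is executed exactly `N` times. -/
theorem HaltsWithin.loop {M : ℕ} {b : Test} {c : Prog} {s : State} {T : ℕ} (N : ℕ)
    (I : ℕ → State → Prop) (h0 : I 0 s)
    (hs : ∀ i < N, ∀ s', Frame c s s' → I i s' →
      b.Holds s' ∧ HaltsWithin M c s' T (I (i + 1)))
    (hN : ∀ s', Frame c s s' → I N s' → ¬ b.Holds s') :
    HaltsWithin M (.loop b c) s (N * (T + 1) + 1) (I N) := by
  suffices H : ∀ m i s', i + m = N → Frame c s s' → I i s' →
      HaltsWithin M (.loop b c) s' (m * (T + 1) + 1) (I N) from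
    H N 0 s (zero_add N) (Frame.refl _ _) h0
  intro m
  induction m with
  | zero =>
    rintro i s' rfl hF hI
    exact ⟨1, s', .loop_false _ _ _ (hN s' hF hI), by omega, hI⟩
  | succ m ih =>
    intro i s' hi hF hI
    obtain ⟨hb, t, s1, h1, h2, h3⟩ := hs i (by omega) s' hF hI
    obtain ⟨t', s2, h1', h2', h3'⟩ := ih (i + 1) s1 (by omega) (hF.trans h1.frame) h3
    refine ⟨t + t' + 1, s2, .loop_true _ _ _ _ _ _ _ hb h1 h1', ?_, h3'⟩
    rw [Nat.succ_mul]
    omega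

/-! ### Li Chao trees: lower envelopes of parabolas over a grid -/

/-- The value at abscissa `α a` of the parabola `b + (α a - x t) ^ 2` that is stored in node `v` of
the tree at address `B`: the word memory holds `t`, the real memory holds `b`. -/
def nodeVal (α x : ℕ → ℝ) (wm : ℕ → ℕ) (rm : ℕ → ℝ) (B v a : ℕ) : ℝ :=
  rm (B + v) + (α a - x (wm (B + v))) ^ 2

/-- Some node on the path from the leaf `a` to the root of the tree at address `B` holds a parabola
whose value at `α a` is at most `y`.  The parent of node `v` is `v / 2`, the root is `1`, and the
word `0` marks a node that holds nothing. -/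
def Covers (α x : ℕ → ℝ) (wm : ℕ → ℕ) (rm : ℕ → ℝ) (B a : ℕ) (y : ℝ) : Prop :=
  ∃ j, a / 2 ^ j ≠ 0 ∧ wm (B + a / 2 ^ j) ≠ 0 ∧ nodeVal α x wm rm B (a / 2 ^ j) a ≤ y

theorem Covers.mono {α x : ℕ → ℝ} {wm : ℕ → ℕ} {rm : ℕ → ℝ} {B a : ℕ} {y y' : ℝ}
    (h : Covers α x wm rm B a y) (hy : y ≤ y') : Covers α x wm rm B a y' := by
  obtain ⟨j, h1, h2, h3⟩ := h
  exact ⟨j, h1, h2, h3.trans hy⟩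

/-- Coverage only depends on the `2 ^ (k + 1)` cells of the tree. -/
theorem Covers.congr {α x : ℕ → ℝ} {wm wm' : ℕ → ℕ} {rm rm' : ℕ → ℝ} {B a N : ℕ} {y : ℝ}
    (h : Covers α x wm rm B a y) (ha : a < N)
    (hw : ∀ c, B ≤ c → c < B + N → wm' c = wm c) (hr : ∀ c, B ≤ c → c < B + N → rm' c = rm c) :
    Covers α x wm' rm' B a y := by
  obtain ⟨j, h1, h2, h3⟩ := h
  have hj : a / 2 ^ j ≤ a := Nat.div_le_self _ _
  have hB : B + a / 2 ^ j < B + N := Nat.add_lt_add_left (hj.trans_lt ha) B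
  have e1 := hw (B + a / 2 ^ j) (Nat.le_add_right _ _) hB
  have e2 := hr (B + a / 2 ^ j) (Nat.le_add_right _ _) hB
  refine ⟨j, h1, by rwa [e1], ?_⟩
  rwa [nodeVal, e1, e2]

/-- A node occurs on the path from a leaf to the root only at the height of its level. -/
theorem path_level {k l i j v a : ℕ} (hl : l + i = k) (hv₁ : 2 ^ l ≤ v) (hv₂ : v < 2 ^ (l + 1))
    (ha₁ : 2 ^ k ≤ a) (ha₂ : a < 2 ^ (k + 1)) (hj : a / 2 ^ j = v) : j = i := by
  have h1 : v * 2 ^ j ≤ a := by rw [← hj]; exact Nat.div_mul_le_self _ _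
  have h2 : a < (v + 1) * 2 ^ j := by
    rw [← hj, mul_comm]; exact Nat.lt_mul_div_succ a (by positivity)
  have h3 : 2 ^ (l + j) < 2 ^ (k + 1) := by
    rw [pow_add]; exact (Nat.mul_le_mul_right _ hv₁).trans_lt (h1.trans_lt ha₂)
  have h4 : 2 ^ k < 2 ^ (l + 1 + j) := by
    rw [pow_add _ (l + 1)]
    exact (ha₁.trans_lt h2).trans_le (Nat.mul_le_mul_right _ hv₂)
  have h5 := (Nat.pow_lt_pow_iff_right (by norm_num : 1 < 2)).1 h3
  have h6 := (Nat.pow_lt_pow_iff_right (by norm_num : 1 < 2)).1 h4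
  omega

/-- One step of an insertion.  At node `v`, which governs the leaves `a` with `a / 2 ^ i = v`, the
parabola `(tT, bT)` is kept and `(tL, bL)` is passed on.  The one that is kept is the lower one at
the middle leaf; the difference of the two is monotone, so the other one can only win in one
half. -/
theorem covers_step {α x : ℕ → ℝ} (hα : Monotone α) {wm : ℕ → ℕ} {rm : ℕ → ℝ} {B v i : ℕ}
    {k l : ℕ} (hl : l + i = k) (hv₁ : 2 ^ l ≤ v) (hv₂ : v < 2 ^ (l + 1))
    {t tT tL : ℕ} {b bT bL : ℝ} (hT : tT ≠ 0)
    (hnew : ∀ a y, b + (α a - x t) ^ 2 ≤ y →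
      bT + (α a - x tT) ^ 2 ≤ y ∨ bL + (α a - x tL) ^ 2 ≤ y)
    (hold : wm (B + v) ≠ 0 → ∀ a y, nodeVal α x wm rm B v a ≤ y →
      bT + (α a - x tT) ^ 2 ≤ y ∨ bL + (α a - x tL) ^ 2 ≤ y)
    (hmid : bT + (α (v * 2 ^ i + 2 ^ i / 2) - x tT) ^ 2 ≤
      bL + (α (v * 2 ^ i + 2 ^ i / 2) - x tL) ^ 2)
    {v' : ℕ} (hv' : v' = if x tL ≤ x tT then v + v else v + v + 1) {a : ℕ}
    (ha₁ : 2 ^ k ≤ a) (ha₂ : a < 2 ^ (k + 1)) {y : ℝ}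
    (h : Covers α x wm rm B a y ∨ a / 2 ^ i = v ∧ b + (α a - x t) ^ 2 ≤ y) :
    Covers α x (Function.update wm (B + v) tT) (Function.update rm (B + v) bT) B a y ∨
      2 ^ i / 2 ≠ 0 ∧ a / (2 ^ i / 2) = v' ∧ bL + (α a - x tL) ^ 2 ≤ y := by
  have hv : v ≠ 0 := by have := Nat.one_le_two_pow (n := l); omega
  have keyT : ∀ j, a / 2 ^ j = v → bT + (α a - x tT) ^ 2 ≤ y →
      Covers α x (Function.update wm (B + v) tT) (Function.update rm (B + v) bT) B a y := by
    intro j hj hy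
    refine ⟨j, by rwa [hj], ?_, ?_⟩ <;> simpa [hj, nodeVal]
  have key : ∀ j, a / 2 ^ j = v →
      bT + (α a - x tT) ^ 2 ≤ y ∨ bL + (α a - x tL) ^ 2 ≤ y → a / 2 ^ i = v →
      Covers α x (Function.update wm (B + v) tT) (Function.update rm (B + v) bT) B a y ∨
      2 ^ i / 2 ≠ 0 ∧ a / (2 ^ i / 2) = v' ∧ bL + (α a - x tL) ^ 2 ≤ y := by
    intro j hj hy hi
    rcases hy with hy | hy
    · exact .inl (keyT j hj hy)
    set mid := v * 2 ^ i + 2 ^ i / 2 with hmiddef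
    have hlo : v * 2 ^ i ≤ a := by rw [← hi]; exact Nat.div_mul_le_self _ _
    have hhi : a < v * 2 ^ i + 2 ^ i := by
      rw [← hi, mul_comm]; exact Nat.lt_mul_div_succ a (by positivity)
    have hside : (x tL ≤ x tT ∧ mid ≤ a ∨ x tT < x tL ∧ a ≤ mid) →
        bT + (α a - x tT) ^ 2 ≤ y := by
      rintro (⟨h1, h2⟩ | ⟨h1, h2⟩)
      · nlinarith [hα h2, mul_nonneg (sub_nonneg.2 h1) (sub_nonneg.2 (hα h2))]
      · nlinarith [hα h2, mul_nonneg (sub_nonneg.2 h1.le) (sub_nonneg.2 (hα h2))]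
    by_cases hx : x tL ≤ x tT
    · rcases le_or_gt mid a with hm | hm
      · exact .inl (keyT j hj (hside (.inl ⟨hx, hm⟩)))
      · right
        rw [if_pos hx] at hv'
        obtain _ | i := i
        · simp at hmiddef; omega
        have e : 2 ^ (i + 1) / 2 = 2 ^ i := by rw [pow_succ]; simp
        rw [e] at hmiddef ⊢
        refine ⟨by positivity, ?_, hy⟩
        rw [pow_succ] at hlo hmiddef
        have h1 : v' * 2 ^ i ≤ a := by rw [hv']; nlinarith
        have h2 : a < (v' + 1) * 2 ^ i := by rw [hv']; nlinarith
        exact Nat.div_eq_of_lt_le h1 h2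
    · rw [not_le] at hx
      rcases le_or_gt a mid with hm | hm
      · exact .inl (keyT j hj (hside (.inr ⟨hx, hm⟩)))
      · right
        rw [if_neg (not_le.2 hx)] at hv'
        obtain _ | i := i
        · simp at hmiddef hhi; omega
        have e : 2 ^ (i + 1) / 2 = 2 ^ i := by rw [pow_succ]; simp
        rw [e] at hmiddef ⊢
        refine ⟨by positivity, ?_, hy⟩
        rw [pow_succ] at hhi hmiddef
        have h1 : v' * 2 ^ i ≤ a := by rw [hv']; nlinarith
        have h2 : a < (v' + 1) * 2 ^ i := by rw [hv']; nlinarith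
        exact Nat.div_eq_of_lt_le h1 h2
  rcases h with ⟨j, h1, h2, h3⟩ | ⟨h1, h2⟩
  · by_cases hj : a / 2 ^ j = v
    · by_cases hi : a / 2 ^ i = v
      · exact key j hj (hold (by rwa [hj] at h2) a y (by rwa [hj] at h3)) hi
      · exact absurd (by rwa [path_level hl hv₁ hv₂ ha₁ ha₂ hj] at hj) hi
    · left
      have : B + a / 2 ^ j ≠ B + v := by omega
      refine ⟨j, h1, ?_, ?_⟩
      · rwa [Function.update_of_ne this]
      · rwa [nodeVal, Function.update_of_ne this, Function.update_of_ne this]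
  · exact key i h1 (hnew a y h2) h1

open Instr Prog

/-! ### Li Chao trees on the machine -/

/-- The contents of the registers that keep the same value throughout the main part of
preprocessing: `n`, `1`, `D + 1`, `2`, `K = 2 ^ k`, `K ^ 2`, `D`, `2 * K` in word registers, and
`0`, `2`, `8 / K`, `12`, `K ^ 2 / 2`, `1` in real registers.

Of the other word registers, `6` holds the first unused address, `7` the number of selected points,
`8`, `9` and `19` the addresses of the table of coordinates, of the current forest and of the next
one, `10` the address of the heaviest point, `11` and `12` the current facet and the number of
facets, `13` to `16` the state of the stage loop.  Registers from `20` on are for temporary use. -/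
structure Consts (n D k : ℕ) (s : State) : Prop where
  w0 : s.wreg 0 = n
  w1 : s.wreg 1 = 1
  w2 : s.wreg 2 = D + 1
  w3 : s.wreg 3 = 2
  w4 : s.wreg 4 = 2 ^ k
  w5 : s.wreg 5 = 2 ^ k * 2 ^ k
  w17 : s.wreg 17 = D
  w18 : s.wreg 18 = 2 * 2 ^ k
  r3 : s.rreg 3 = 0
  r4 : s.rreg 4 = 2
  r5 : s.rreg 5 = 8 / 2 ^ k
  r6 : s.rreg 6 = 12
  r7 : s.rreg 7 = 2 ^ k * 2 ^ k / 2
  r8 : s.rreg 8 = 1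

/-- Does the program leave the registers of `Consts` alone? -/
def Prog.keepsConsts (c : Prog) : Bool :=
  !([0, 1, 2, 3, 4, 5, 17, 18].any fun x => c.any (Instr.writesW x)) &&
    !([3, 4, 5, 6, 7, 8].any fun x => c.any (Instr.writesR x))

theorem Consts.of_frame {n D k : ℕ} {c : Prog} {s s' : State} (h : Consts n D k s)
    (F : Frame c s s') (hc : c.keepsConsts = true) : Consts n D k s' := by
  simp only [Prog.keepsConsts, List.any_cons, List.any_nil, Bool.or_false, Bool.and_eq_true,
    Bool.not_eq_true', Bool.or_eq_false_iff] at hc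
  obtain ⟨⟨c0, c1, c2, c3, c4, c5, c17, c18⟩, d3, d4, d5, d6, d7, d8⟩ := hc
  exact ⟨(F.w _ c0).trans h.w0, (F.w _ c1).trans h.w1, (F.w _ c2).trans h.w2,
    (F.w _ c3).trans h.w3, (F.w _ c4).trans h.w4, (F.w _ c5).trans h.w5,
    (F.w _ c17).trans h.w17, (F.w _ c18).trans h.w18, (F.r _ d3).trans h.r3,
    (F.r _ d4).trans h.r4, (F.r _ d5).trans h.r5, (F.r _ d6).trans h.r6,
    (F.r _ d7).trans h.r7, (F.r _ d8).trans h.r8⟩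

/-- The abscissa of leaf `a`; the leaves `2 ^ k, …, 2 ^ (k + 1) - 1` sample `[-4, 4]` with step
`8 / 2 ^ k`. -/
noncomputable def abscissa (k a : ℕ) : ℝ := a * (8 / 2 ^ k) - 12

theorem abscissa_mono (k : ℕ) : Monotone (abscissa k) := by
  intro a b hab
  have : (a : ℝ) ≤ b := by exact_mod_cast hab
  unfold abscissa
  gcongr

/-- The two memories of `s` and `s'` agree outside the addresses `lo ≤ c < hi`. -/
def AgreeOutside (lo hi : ℕ) (s s' : State) : Prop :=
  ∀ c, c < lo ∨ hi ≤ c → s'.wmem c = s.wmem c ∧ s'.rmem c = s.rmem c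

theorem AgreeOutside.refl (lo hi : ℕ) (s : State) : AgreeOutside lo hi s s :=
  fun _ _ => ⟨rfl, rfl⟩

theorem AgreeOutside.trans {lo hi : ℕ} {s s' s'' : State} (h : AgreeOutside lo hi s s')
    (h' : AgreeOutside lo hi s' s'') : AgreeOutside lo hi s s'' :=
  fun c hc => ⟨(h' c hc).1.trans (h c hc).1, (h' c hc).2.trans (h c hc).2⟩

theorem AgreeOutside.mono {lo hi lo' hi' : ℕ} {s s' : State} (h : AgreeOutside lo hi s s')
    (h1 : lo' ≤ lo) (h2 : hi ≤ hi') : AgreeOutside lo' hi' s s' :=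
  fun c hc => h c (by omega)

/-- Put the parabola that is being inserted into the current node if that node is empty. -/
def insertIfEmpty : Prog :=
  block [wadd 25 20 23, wload 26 25] ;;
  .ite (.wlt 26 1) (block [wstore 25 21, rstore 25 20, wmove 26 21]) .skip

/-- Compare two parabolas at the middle leaf of the current node and keep the lower one there. -/
def insertCompare : Prog :=
  block [wdiv 27 24 3, wmul 28 23 24, wadd 28 28 27, rcast 22 28, rmul 22 22 5, rsub 22 22 6,
    rload 23 25, wmul 28 26 2, wadd 28 22 28, rload 24 28,
    rsub 25 22 21, rmul 25 25 25, radd 25 20 25,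
    rsub 26 22 24, rmul 26 26 26, radd 26 23 26] ;;
  .ite (.rlt 25 26)
    (block [wstore 25 21, rstore 25 20, wmove 21 26, rmove 20 23, rmove 27 21, rmove 21 24,
      rmove 24 27]) .skip

/-- Go to the child in which the higher parabola can win. -/
def insertDescend : Prog :=
  block [wadd 23 23 23] ;;
  .ite (.rle 21 24) .skip (block [wadd 23 23 1]) ;;
  block [wmove 24 27]

/-- One level of an insertion. -/
def insertBody : Prog := insertIfEmpty ;; insertCompare ;; insertDescend

/-- Insert the parabola with word `wreg 21` and real `rreg 20` into the tree at address `wreg 20`;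
the abscissa of its vertex is at `wreg 22 + wreg 21 * (D + 1)` in the real memory. -/
def insertParabola : Prog :=
  block [wconst 23 1, wmove 24 4, wmul 25 21 2, wadd 25 22 25, rload 21 25] ;;
  .loop (.wle 1 24) insertBody

/-- Every node of the tree at address `B` that is not empty holds an admissible parabola. -/
def TreeGood (N B : ℕ) (G : ℕ → ℝ → Prop) (s : State) : Prop :=
  ∀ v, 1 ≤ v → v < N → s.wmem (B + v) ≠ 0 → G (s.wmem (B + v)) (s.rmem (B + v))

/-- The vertices of the parabolas `1, …, n` have the abscissas `x t`, found in the real memory at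
`XB + t * d`, below the address `B`. -/
def Column (n d XB B : ℕ) (x : ℕ → ℝ) (s : State) : Prop :=
  ∀ t, 1 ≤ t → t ≤ n → XB + t * d < B ∧ s.rmem (XB + t * d) = x t

theorem insertIfEmpty_spec {M n D k B N : ℕ} {G : ℕ → ℝ → Prop} {s : State}
    (hG : ∀ t b, G t b → 1 ≤ t ∧ t ≤ n) (hnM : n < M)
    (hC : Consts n D k s) (hB : s.wreg 20 = B) (hBM : B + N ≤ M)
    (hv₁ : 1 ≤ s.wreg 23) (hv₂ : s.wreg 23 < N)
    (ht : G (s.wreg 21) (s.rreg 20)) (hgood : TreeGood N B G s) :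
    HaltsWithin M insertIfEmpty s 6 fun s' =>
      s'.wreg 25 = B + s.wreg 23 ∧ s'.wreg 26 = s'.wmem (B + s.wreg 23) ∧
      s'.wreg 21 = s.wreg 21 ∧ s'.rreg 20 = s.rreg 20 ∧
      (s.wmem (B + s.wreg 23) ≠ 0 ∧ s'.wmem = s.wmem ∧ s'.rmem = s.rmem ∨
        s.wmem (B + s.wreg 23) = 0 ∧
        s'.wmem = Function.update s.wmem (B + s.wreg 23) (s.wreg 21) ∧
        s'.rmem = Function.update s.rmem (B + s.wreg 23) (s.rreg 20)) := by
  have h1 := hG _ _ ht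
  have h2 : s.wmem (B + s.wreg 23) < M := by
    by_cases h0 : s.wmem (B + s.wreg 23) = 0
    · omega
    · have := hG _ _ (hgood _ hv₁ hv₂ h0); omega
  refine .of_wp_imp (fun Q hQ => ?_) le_rfl
  simp [insertIfEmpty, Prog.wp, Instr.wp, block, Test.Holds, hB, hC.w1]
  refine ⟨by omega, h2, fun h0 => ⟨by omega, by omega, by omega, by omega, hQ _ ?_⟩,
    fun h0 => hQ _ ?_⟩
  · simp [h0]
  · simp [h0]

theorem insertCompare_spec {M n D k B N XB : ℕ} {x : ℕ → ℝ} {s : State}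
    (hnM : n < M)
    (hC : Consts n D k s) (hBM : B + N ≤ M) (hXB : s.wreg 22 = XB)
    (hcol : Column n (D + 1) XB B x s)
    (h25 : s.wreg 25 < M)
    (hmid : s.wreg 23 * s.wreg 24 + s.wreg 24 / 2 < N)
    (h26 : 1 ≤ s.wreg 26 ∧ s.wreg 26 ≤ n) (h21 : 1 ≤ s.wreg 21 ∧ s.wreg 21 ≤ n)
    (hmem : s.wmem (s.wreg 25) = s.wreg 26) (hx : s.rreg 21 = x (s.wreg 21)) :
    HaltsWithin M insertCompare s 24 fun s' =>
      ∃ tT bT tL bL, ((tT = s.wreg 26 ∧ bT = s.rmem (s.wreg 25) ∧ tL = s.wreg 21 ∧ bL = s.rreg 20) ∨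
        (tT = s.wreg 21 ∧ bT = s.rreg 20 ∧ tL = s.wreg 26 ∧ bL = s.rmem (s.wreg 25))) ∧
      bT + (abscissa k (s.wreg 23 * s.wreg 24 + s.wreg 24 / 2) - x tT) ^ 2 ≤
        bL + (abscissa k (s.wreg 23 * s.wreg 24 + s.wreg 24 / 2) - x tL) ^ 2 ∧
      s'.wreg 21 = tL ∧ s'.rreg 20 = bL ∧ s'.rreg 21 = x tL ∧ s'.rreg 24 = x tT ∧
      s'.wreg 27 = s.wreg 24 / 2 ∧
      s'.wmem = Function.update s.wmem (s.wreg 25) tT ∧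
      s'.rmem = Function.update s.rmem (s.wreg 25) bT := by
  have h1 := hcol _ h26.1 h26.2
  have h2 := hcol _ h21.1 h21.2
  have h3 : s.wreg 26 * (D + 1) < M := by omega
  refine .of_wp_imp (fun Q hQ => ?_) le_rfl
  have e : s.wreg 25 < M ∧ s.wreg 23 * s.wreg 24 < M ∧ s.wreg 24 / 2 < M ∧
    s.wreg 23 * s.wreg 24 + s.wreg 24 / 2 < M ∧ XB + s.wreg 26 * (D + 1) < M := by
    refine ⟨h25, ?_, ?_, ?_, ?_⟩ <;> omega
  simp [insertCompare, Prog.wp, Instr.wp, block, Test.Holds, hC.w3, hC.w2, hC.r5, hC.r6, hXB, h1.2,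
    hx, e, h3]
  have hval : ∀ y z, s.rreg 20 + (y - x (s.wreg 21)) * (y - x (s.wreg 21)) < z ↔
    s.rreg 20 + (y - x (s.wreg 21)) ^ 2 < z := fun y z => by rw [sq]
  have heq : ((s.wreg 23 : ℝ) * s.wreg 24 + (s.wreg 24 / 2 : ℕ)) * (8 / 2 ^ k) - 12 =
    abscissa k (s.wreg 23 * s.wreg 24 + s.wreg 24 / 2) := by
      unfold abscissa; push_cast; rfl
  rw [heq]
  simp only [← sq]
  refine ⟨fun hlt => ?_, fun hle => ?_⟩
  · refine ⟨by omega, by omega, hQ _ ?_⟩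
    refine ⟨s.wreg 21, s.rreg 20, s.wreg 26, s.rmem (s.wreg 25), ?_⟩
    exact ⟨.inr ⟨rfl, rfl, rfl, rfl⟩, hlt.le, rfl, rfl, rfl, rfl, rfl, rfl, rfl⟩
  · refine hQ _ ⟨s.wreg 26, s.rmem (s.wreg 25), s.wreg 21, s.rreg 20, ?_⟩
    refine ⟨.inl ⟨rfl, rfl, rfl, rfl⟩, hle, rfl, rfl, hx, rfl, rfl, ?_, ?_⟩ <;> simp [← hmem]

theorem insertDescend_spec {M n D k : ℕ} {s : State} (hC : Consts n D k s)
    (h23 : s.wreg 23 + s.wreg 23 + 1 < M) (h27 : s.wreg 27 < M) :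
    HaltsWithin M insertDescend s 4 fun s' =>
      (s'.wreg 23 = if s.rreg 21 ≤ s.rreg 24 then s.wreg 23 + s.wreg 23
        else s.wreg 23 + s.wreg 23 + 1) ∧ s'.wreg 24 = s.wreg 27 := by
  refine .of_wp_imp (fun Q hQ => ?_) le_rfl
  simp [insertDescend, Prog.wp, Instr.wp, block, Test.Holds, hC.w1, h23, h27]
  refine ⟨by omega, fun h => hQ _ ?_, fun h => hQ _ ?_⟩
  · simp [h]
  · simp [h]

theorem Column.of_agree {n d XB B hi : ℕ} {x : ℕ → ℝ} {s s' : State} (h : Column n d XB B x s)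
    (hA : AgreeOutside B hi s s') : Column n d XB B x s' :=
  fun t h1 h2 => ⟨(h t h1 h2).1, (hA _ (.inl (h t h1 h2).1)).2.trans (h t h1 h2).2⟩

/-- In the loop of an insertion, the parabola in `wreg 21` and `rreg 20` is still to be inserted
below node `wreg 23`, which governs `wreg 24` leaves. -/
theorem insertBody_spec {M n D k i l B XB : ℕ} {x : ℕ → ℝ} {G : ℕ → ℝ → Prop} {s : State}
    (hG : ∀ t b, G t b → 1 ≤ t ∧ t ≤ n) (hnM : n < M) (hC : Consts n D k s)
    (hB : s.wreg 20 = B) (hBM : B + 2 * 2 ^ k < M) (hKM : 4 * 2 ^ k ≤ M) (hXB : s.wreg 22 = XB)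
    (hcol : Column n (D + 1) XB B x s) (hl : l + i = k) (h24 : s.wreg 24 = 2 ^ i)
    (hv₁ : 2 ^ l ≤ s.wreg 23) (hv₂ : s.wreg 23 < 2 ^ (l + 1))
    (ht : G (s.wreg 21) (s.rreg 20)) (hx : s.rreg 21 = x (s.wreg 21))
    (hgood : TreeGood (2 * 2 ^ k) B G s) :
    HaltsWithin M insertBody s 34 fun s' =>
      s'.wreg 24 = 2 ^ i / 2 ∧ 2 ^ (l + 1) ≤ s'.wreg 23 ∧ s'.wreg 23 < 2 ^ (l + 2) ∧
      G (s'.wreg 21) (s'.rreg 20) ∧ s'.rreg 21 = x (s'.wreg 21) ∧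
      TreeGood (2 * 2 ^ k) B G s' ∧ AgreeOutside B (B + 2 * 2 ^ k) s s' ∧
      ∀ a y, 2 ^ k ≤ a → a < 2 ^ (k + 1) →
        (Covers (abscissa k) x s.wmem s.rmem B a y ∨ a / s.wreg 24 = s.wreg 23 ∧
          s.rreg 20 + (abscissa k a - x (s.wreg 21)) ^ 2 ≤ y) →
        (Covers (abscissa k) x s'.wmem s'.rmem B a y ∨ s'.wreg 24 ≠ 0 ∧
          a / s'.wreg 24 = s'.wreg 23 ∧
          s'.rreg 20 + (abscissa k a - x (s'.wreg 21)) ^ 2 ≤ y) := by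
  have hpos : 1 ≤ 2 ^ l := Nat.one_le_two_pow
  have hmidlt : s.wreg 23 * 2 ^ i + 2 ^ i / 2 < 2 * 2 ^ k := by
    have h1 : (s.wreg 23 + 1) * 2 ^ i ≤ 2 ^ (l + 1) * 2 ^ i := Nat.mul_le_mul_right _ hv₂
    have h2 : 2 ^ (l + 1) * 2 ^ i = 2 * 2 ^ k := by rw [← hl]; ring
    have h3 : 2 ^ i / 2 < 2 ^ i := Nat.div_lt_self (by positivity) (by norm_num)
    rw [add_mul, h2, one_mul] at h1
    omega
  have hpow : 2 ^ (l + 1) ≤ 2 * 2 ^ k := by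
    rw [← hl, ← pow_succ']; exact Nat.pow_le_pow_right (by norm_num) (by omega)
  set v := s.wreg 23 with hv
  have htn := hG _ _ ht
  refine (insertIfEmpty_spec hG hnM hC hB (N := 2 * 2 ^ k) hBM.le (by omega) (by omega) ht
    hgood).seq (fun s1 F1 ⟨a1, a2, a3, a4, a5⟩ => ?_) (T₂ := 28) (by norm_num)
  rw [← hv] at a1 a2 a5
  have hA1 : AgreeOutside B (B + 2 * 2 ^ k) s s1 := by
    intro c hc
    rcases a5 with ⟨_, b1, b2⟩ | ⟨_, b1, b2⟩
    · rw [b1, b2]; exact ⟨rfl, rfl⟩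
    · have : c ≠ B + v := by omega
      rw [b1, b2, Function.update_of_ne this, Function.update_of_ne this]; exact ⟨rfl, rfl⟩
  have e20 : s1.wreg 20 = B := (F1.w 20 rfl).trans hB
  have e22 : s1.wreg 22 = XB := (F1.w 22 rfl).trans hXB
  have e23 : s1.wreg 23 = v := F1.w 23 rfl
  have e24 : s1.wreg 24 = 2 ^ i := (F1.w 24 rfl).trans h24
  have e21 : s1.rreg 21 = x (s1.wreg 21) := by rw [a3, ← hx]; exact F1.r 21 rfl
  have hC1 := hC.of_frame F1 rfl
  have h26 : G (s1.wreg 26) (s1.rmem (B + v)) := by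
    rw [a2]
    rcases a5 with ⟨b0, b1, b2⟩ | ⟨_, b1, b2⟩
    · rw [b1, b2]; exact hgood v (by omega) (by omega) b0
    · rw [b1, b2, Function.update_self, Function.update_self]; exact ht
  have h26n := hG _ _ h26
  refine (insertCompare_spec hnM hC1 (B := B) (N := 2 * 2 ^ k) hBM.le e22
    (hcol.of_agree hA1) (by omega) (by rw [e23, e24]; exact hmidlt) h26n
    (by rw [a3]; exact htn) (by rw [a2, a1]) e21).seq (fun s2 F2 h2 => ?_) (T₂ := 4) (by norm_num)
  obtain ⟨tT, bT, tL, bL, hor, hmid, c1, c2, c3, c4, c5, c6, c7⟩ := h2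
  rw [a1] at hor c6 c7
  rw [e23, e24] at hmid
  have f23 : s2.wreg 23 = v := (F2.w 23 rfl).trans e23
  have hGT : G tT bT ∧ G tL bL := by
    rcases hor with ⟨rfl, rfl, rfl, rfl⟩ | ⟨rfl, rfl, rfl, rfl⟩
    · exact ⟨h26, by rw [a3, a4]; exact ht⟩
    · exact ⟨by rw [a3, a4]; exact ht, h26⟩
  have hlk : 2 ^ l ≤ 2 ^ k := Nat.pow_le_pow_right (by norm_num) (by omega)
  have hv2l : v < 2 * 2 ^ l := by rw [← pow_succ']; exact hv₂
  refine (insertDescend_spec (hC1.of_frame F2 rfl) (by omega) ?_).mono le_rfl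
    (fun s3 F3 ⟨d1, d2⟩ => ?_)
  · rw [c5, e24]
    have := Nat.div_le_self (2 ^ i) 2
    have : 2 ^ i ≤ 2 ^ k := Nat.pow_le_pow_right (by norm_num) (by omega)
    omega
  rw [c3, c4, f23] at d1
  have g21 : s3.wreg 21 = tL := (F3.w 21 rfl).trans c1
  have gr20 : s3.rreg 20 = bL := (F3.r 20 rfl).trans c2
  have gr21 : s3.rreg 21 = x tL := (F3.r 21 rfl).trans c3
  have hwm : s3.wmem = Function.update s.wmem (B + v) tT := by
    rw [F3.wm rfl, c6]
    rcases a5 with ⟨_, b1, _⟩ | ⟨_, b1, _⟩ <;> rw [b1]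
    rw [Function.update_idem]
  have hrm : s3.rmem = Function.update s.rmem (B + v) bT := by
    rw [F3.rm rfl, c7]
    rcases a5 with ⟨_, _, b1⟩ | ⟨_, _, b1⟩ <;> rw [b1]
    rw [Function.update_idem]
  have h24' : s3.wreg 24 = 2 ^ i / 2 := by rw [d2, c5, e24]
  refine ⟨h24', ?_, ?_, ?_, ?_, ?_, ?_, ?_⟩
  · rw [d1, pow_succ]; split_ifs <;> omega
  · rw [d1, pow_succ, pow_succ]; split_ifs <;> omega
  · rw [g21, gr20]; exact hGT.2
  · rw [g21, gr21]
  · intro u hu1 hu2 hu3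
    rw [hwm, hrm] at *
    by_cases huv : u = v
    · subst huv; simpa using hGT.1
    · have : B + u ≠ B + v := by omega
      rw [Function.update_of_ne this] at hu3 ⊢
      rw [Function.update_of_ne this]
      exact hgood u hu1 hu2 hu3
  · intro c hc
    have : c ≠ B + v := by omega
    rw [hwm, hrm, Function.update_of_ne this, Function.update_of_ne this]; exact ⟨rfl, rfl⟩
  · intro a y ha1 ha2 h
    rw [h24', hwm, hrm, gr20, g21]
    refine covers_step (abscissa_mono k) hl hv₁ hv₂ (t := s.wreg 21) (b := s.rreg 20)
      (by have := hG _ _ hGT.1; omega) ?_ ?_ hmid d1 ha1 ha2 (by rw [← h24]; exact h)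
    · intro a y h
      rw [a3, a4] at hor
      rcases hor with ⟨-, -, rfl, rfl⟩ | ⟨rfl, rfl, -, -⟩
      · exact .inr h
      · exact .inl h
    · intro h0 a y h
      rw [a3, a4, a2] at hor
      rcases a5 with ⟨_, b1, b2⟩ | ⟨b0, _, _⟩
      · rw [b1, b2] at hor
        rcases hor with ⟨rfl, rfl, -, -⟩ | ⟨-, -, rfl, rfl⟩
        · exact .inl h
        · exact .inr h
      · exact absurd b0 h0

/-- After an insertion the new parabola is covered at every leaf, and so is what was covered
before. -/
theorem insert_spec {M n D k B XB : ℕ} {x : ℕ → ℝ} {G : ℕ → ℝ → Prop} {s : State}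
    (hG : ∀ t b, G t b → 1 ≤ t ∧ t ≤ n) (hnM : n < M) (hC : Consts n D k s)
    (hB : s.wreg 20 = B) (hBM : B + 2 * 2 ^ k < M) (hKM : 4 * 2 ^ k ≤ M) (hXB : s.wreg 22 = XB)
    (hcol : Column n (D + 1) XB B x s) (ht : G (s.wreg 21) (s.rreg 20))
    (hgood : TreeGood (2 * 2 ^ k) B G s) :
    HaltsWithin M insertParabola s ((k + 1) * 35 + 6) fun s' =>
      TreeGood (2 * 2 ^ k) B G s' ∧ AgreeOutside B (B + 2 * 2 ^ k) s s' ∧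
      ∀ a y, 2 ^ k ≤ a → a < 2 ^ (k + 1) →
        (Covers (abscissa k) x s.wmem s.rmem B a y ∨
          s.rreg 20 + (abscissa k a - x (s.wreg 21)) ^ 2 ≤ y) →
        Covers (abscissa k) x s'.wmem s'.rmem B a y := by
  have hkpos : 1 ≤ 2 ^ k := Nat.one_le_two_pow
  have htn := hG _ _ ht
  have hct := hcol _ htn.1 htn.2
  refine HaltsWithin.seq (T₁ := 5) (T₂ := (k + 1) * 35 + 1)
    (Q₁ := fun s' => s'.wreg 23 = 1 ∧ s'.wreg 24 = 2 ^ k ∧ s'.rreg 21 = x (s.wreg 21))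
    (.of_wp_imp (fun Q hQ => ?_) le_rfl) (fun s1 F1 ⟨a1, a2, a3⟩ => ?_) (by omega)
  · have h1 : s.wreg 21 * (D + 1) < M := by omega
    have h2 : XB + s.wreg 21 * (D + 1) < M := by omega
    simp [Prog.wp, Instr.wp, block, hC.w4, hC.w2, hXB, h1, h2, hct.2]
    exact ⟨by omega, by omega, hQ _ (by simp)⟩
  · have e21 : s1.wreg 21 = s.wreg 21 := F1.w 21 rfl
    have er20 : s1.rreg 20 = s.rreg 20 := F1.r 20 rfl
    have ewm := F1.wm rfl
    have erm := F1.rm rfl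
    refine (HaltsWithin.loop (k + 1) (fun i s' =>
      (i ≤ k → s'.wreg 24 = 2 ^ (k - i) ∧ 2 ^ i ≤ s'.wreg 23 ∧ s'.wreg 23 < 2 ^ (i + 1)) ∧
      (i = k + 1 → s'.wreg 24 = 0) ∧
      G (s'.wreg 21) (s'.rreg 20) ∧ s'.rreg 21 = x (s'.wreg 21) ∧
      TreeGood (2 * 2 ^ k) B G s' ∧ AgreeOutside B (B + 2 * 2 ^ k) s s' ∧
      ∀ a y, 2 ^ k ≤ a → a < 2 ^ (k + 1) →
        (Covers (abscissa k) x s.wmem s.rmem B a y ∨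
          s.rreg 20 + (abscissa k a - x (s.wreg 21)) ^ 2 ≤ y) →
        (Covers (abscissa k) x s'.wmem s'.rmem B a y ∨ s'.wreg 24 ≠ 0 ∧
          a / s'.wreg 24 = s'.wreg 23 ∧
          s'.rreg 20 + (abscissa k a - x (s'.wreg 21)) ^ 2 ≤ y)) ?_ ?_ ?_).mono le_rfl ?_
    · simp only [a1, a2, e21, er20, ewm, erm, a3]
      refine ⟨by simp, by simp, ht, trivial, ?_, ?_, ?_⟩
      · intro v; rw [ewm, erm]; exact hgood v
      · intro c _; rw [ewm, erm]; exact ⟨rfl, rfl⟩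
      · intro a y ha1 ha2 h
        refine h.imp_right fun h => ⟨by positivity, ?_, h⟩
        refine Nat.div_eq_of_lt_le (by omega) ?_
        rw [pow_succ] at ha2
        omega
    · intro i hi s' F' ⟨b1, _, b3, b4, b5, b6, b7⟩
      obtain ⟨b1, b1', b1''⟩ := b1 (by omega)
      have hC' := (hC.of_frame F1 rfl).of_frame F' rfl
      refine ⟨?_, (insertBody_spec hG hnM hC' ?_ hBM hKM ?_ (hcol.of_agree b6) (l := i) (i := k - i)
        (by omega) b1 b1' b1'' b3 b4 b5).mono le_rfl ?_⟩
      · simp [Test.Holds, hC'.w1, b1, Nat.one_le_two_pow]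
      · rw [F'.w 20 rfl, F1.w 20 rfl, hB]
      · rw [F'.w 22 rfl, F1.w 22 rfl, hXB]
      · rintro s'' - ⟨c1, c2, c3, c4, c5, c6, c7, c8⟩
        refine ⟨fun hik => ⟨?_, c2, c3⟩, fun hik => ?_, c4, c5, c6, b6.trans c7, ?_⟩
        · rw [c1, show k - i = k - (i + 1) + 1 by omega, pow_succ]; simp
        · rw [c1, show k - i = 0 by omega]; rfl
        · intro a y ha1 ha2 h
          refine c8 a y ha1 ha2 ((b7 a y ha1 ha2 h).imp_right fun h => h.2)
    · rintro s' F' ⟨-, b2, -⟩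
      have hC' := (hC.of_frame F1 rfl).of_frame F' rfl
      simp [Test.Holds, hC'.w1, b2 rfl]
    · rintro s' - ⟨-, b2, -, -, b5, b6, b7⟩
      refine ⟨b5, b6, fun a y ha1 ha2 h => ?_⟩
      rcases b7 a y ha1 ha2 h with h | ⟨h, -⟩
      · exact h
      · exact absurd (b2 rfl) h

/-- Replace the best parabola found so far. -/
def minTake : Prog := block [wmove 31 26, rmove 30 33]

/-- Compare the parabola at the current node with the best one found so far. -/
def minVisit : Prog :=
  block [wadd 25 20 23, wload 26 25] ;;
  .ite (.wle 1 26)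
    (block [rload 32 25, wmul 27 26 2, wadd 27 22 27, rload 33 27, rsub 33 31 33, rmul 33 33 33,
      radd 33 32 33] ;;
      .ite (.wle 1 31) (.ite (.rlt 33 30) minTake .skip) minTake) .skip ;;
  block [wdiv 23 23 3]

/-- Find the lowest parabola over leaf `wreg 30` of the tree at address `wreg 20`: its word goes
to `wreg 31` (`0` if there is none), its value to `rreg 30`. -/
def treeMin : Prog :=
  block [wmove 23 30, wconst 31 0, rcast 31 30, rmul 31 31 5, rsub 31 31 6] ;;
  .loop (.wle 1 23) minVisit

theorem minVisit_spec {M n D k B XB a u : ℕ} {x : ℕ → ℝ} {G : ℕ → ℝ → Prop} {s : State}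
    (hG : ∀ t b, G t b → 1 ≤ t ∧ t ≤ n) (hnM : n < M) (hC : Consts n D k s)
    (hB : s.wreg 20 = B) (hBM : B + 2 * 2 ^ k < M) (hXB : s.wreg 22 = XB)
    (hcol : Column n (D + 1) XB B x s) (hgood : TreeGood (2 * 2 ^ k) B G s)
    (ha : s.rreg 31 = abscissa k a) (hu : s.wreg 23 = u) (hu₁ : 1 ≤ u) (hu₂ : u < 2 * 2 ^ k) :
    HaltsWithin M minVisit s 15 fun s' => s'.wreg 23 = u / 2 ∧
      ((s.wmem (B + u) = 0 ∨
          s.wreg 31 ≠ 0 ∧ s.rreg 30 ≤ nodeVal (abscissa k) x s.wmem s.rmem B u a) ∧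
        s'.wreg 31 = s.wreg 31 ∧ s'.rreg 30 = s.rreg 30 ∨
      s.wmem (B + u) ≠ 0 ∧
        (s.wreg 31 ≠ 0 → nodeVal (abscissa k) x s.wmem s.rmem B u a ≤ s.rreg 30) ∧
        s'.wreg 31 = s.wmem (B + u) ∧
        s'.rreg 30 = nodeVal (abscissa k) x s.wmem s.rmem B u a) := by
  by_cases h0 : s.wmem (B + u) = 0
  · refine .of_wp_imp (fun Q hQ => ?_) (by decide)
    simp [minVisit, Prog.wp, Instr.wp, block, Test.Holds, hC.w1, hC.w3, hB, hu, h0]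
    exact ⟨by omega, by omega, by omega, hQ _ ⟨by simp, .inl ⟨.inl h0, by simp, by simp⟩⟩⟩
  · have h1 := hG _ _ (hgood u hu₁ hu₂ h0)
    have h2 := hcol _ h1.1 h1.2
    have h3 : s.wmem (B + u) * (D + 1) < M := by omega
    have h4 : XB + s.wmem (B + u) * (D + 1) < M := by omega
    have hval : s.rmem (B + u) + (abscissa k a - x (s.wmem (B + u))) *
      (abscissa k a - x (s.wmem (B + u))) = nodeVal (abscissa k) x s.wmem s.rmem B u a := by
      rw [nodeVal, sq]
    refine .of_wp_imp (fun Q hQ => ?_) (by decide)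
    simp [minVisit, minTake, Prog.wp, Instr.wp, block, Test.Holds, hC.w1, hC.w2, hC.w3, hB, hu,
      h1.1, hXB, ha, h2.2, h3, h4, hval]
    refine ⟨by omega, by omega, by omega, fun h5 => ⟨fun h6 => ⟨by omega, by omega, hQ _ ?_⟩,
      fun h6 => ⟨by omega, hQ _ ?_⟩⟩, fun h5 => ⟨by omega, by omega, hQ _ ?_⟩⟩
    · simp [h0, h6.le]
    · exact ⟨by simp, .inl ⟨.inr ⟨by omega, h6⟩, by simp, by simp⟩⟩
    · simp [h0, h5]

/-- A query finds an admissible parabola that is at least as low as everything covered at the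
leaf. -/
theorem treeMin_spec {M n D k B XB a : ℕ} {x : ℕ → ℝ} {G : ℕ → ℝ → Prop} {s : State}
    (hG : ∀ t b, G t b → 1 ≤ t ∧ t ≤ n) (hnM : n < M) (hC : Consts n D k s)
    (hB : s.wreg 20 = B) (hBM : B + 2 * 2 ^ k < M) (hXB : s.wreg 22 = XB)
    (hcol : Column n (D + 1) XB B x s) (hgood : TreeGood (2 * 2 ^ k) B G s)
    (ha : s.wreg 30 = a) (ha₁ : 2 ^ k ≤ a) (ha₂ : a < 2 ^ (k + 1)) :
    HaltsWithin M treeMin s ((k + 1) * 16 + 6) fun s' =>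
      (∀ y, Covers (abscissa k) x s.wmem s.rmem B a y → s'.wreg 31 ≠ 0 ∧ s'.rreg 30 ≤ y) ∧
      (s'.wreg 31 ≠ 0 → ∃ b, G (s'.wreg 31) b ∧
        s'.rreg 30 = b + (abscissa k a - x (s'.wreg 31)) ^ 2) := by
  have ha₂' : a < 2 * 2 ^ k := by rw [← pow_succ']; exact ha₂
  refine HaltsWithin.seq (T₁ := 5) (T₂ := (k + 1) * 16 + 1)
    (Q₁ := fun s' => s'.wreg 23 = a ∧ s'.wreg 31 = 0 ∧ s'.rreg 31 = abscissa k a)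
    (.of_wp_imp (fun Q hQ => ?_) le_rfl) (fun s1 F1 ⟨a1, a2, a3⟩ => ?_) (by omega)
  · simp [Prog.wp, Instr.wp, block, ha, hC.r5, hC.r6]
    exact ⟨by omega, by omega, hQ _ (by simp [abscissa])⟩
  refine (HaltsWithin.loop (k + 1) (fun i s' => s'.wreg 23 = a / 2 ^ i ∧
      (∀ j < i, s.wmem (B + a / 2 ^ j) ≠ 0 → s'.wreg 31 ≠ 0 ∧
        s'.rreg 30 ≤ nodeVal (abscissa k) x s.wmem s.rmem B (a / 2 ^ j) a) ∧
      (s'.wreg 31 ≠ 0 → ∃ b, G (s'.wreg 31) b ∧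
        s'.rreg 30 = b + (abscissa k a - x (s'.wreg 31)) ^ 2)) ?_ ?_ ?_).mono le_rfl ?_
  · simp [a1, a2]
  · rintro i hi s' F' ⟨b1, b2, b3⟩
    have hC' := (hC.of_frame F1 rfl).of_frame F' rfl
    have hwm : s'.wmem = s.wmem := by rw [F'.wm rfl, F1.wm rfl]
    have hrm : s'.rmem = s.rmem := by rw [F'.rm rfl, F1.rm rfl]
    have hpos : 1 ≤ a / 2 ^ i := by
      rw [Nat.one_le_div_iff (by positivity)]
      exact (Nat.pow_le_pow_right (by norm_num) (by omega)).trans ha₁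
    have hle : a / 2 ^ i ≤ a := Nat.div_le_self _ _
    refine ⟨by simpa [Test.Holds, hC'.w1, b1] using hpos,
      (minVisit_spec hG hnM hC' (B := B) (XB := XB) (x := x) (a := a) (u := a / 2 ^ i)
        ?_ hBM ?_ ?_ ?_ ?_ b1 hpos (hle.trans_lt ha₂')).mono le_rfl ?_⟩
    · rw [F'.w 20 rfl, F1.w 20 rfl, hB]
    · rw [F'.w 22 rfl, F1.w 22 rfl, hXB]
    · intro t; rw [hrm]; exact hcol t
    · intro t; rw [hwm, hrm]; exact hgood t
    · rw [F'.r 31 rfl, a3]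
    · rintro s'' - ⟨c1, c2⟩
      rw [hwm, hrm] at c2
      refine ⟨by rw [c1, Nat.div_div_eq_div_mul, pow_succ], ?_, ?_⟩
      · intro j hj hne
        rcases c2 with ⟨d1, d2, d3⟩ | ⟨d1, d2, d3, d4⟩
        · rw [d2, d3]
          rcases Nat.lt_succ_iff_lt_or_eq.1 hj with hj | rfl
          · exact b2 j hj hne
          · exact d1.resolve_left hne
        · rw [d3, d4]
          refine ⟨d1, ?_⟩
          rcases Nat.lt_succ_iff_lt_or_eq.1 hj with hj | rfl
          · have := b2 j hj hne
            exact (d2 this.1).trans this.2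
          · exact le_rfl
      · rcases c2 with ⟨d1, d2, d3⟩ | ⟨d1, d2, d3, d4⟩
        · rw [d2, d3]; exact b3
        · rw [d3, d4]
          exact fun _ => ⟨_, hgood _ hpos (hle.trans_lt ha₂') d1, rfl⟩
  · rintro s' F' ⟨b1, -⟩
    have hC' := (hC.of_frame F1 rfl).of_frame F' rfl
    simp [Test.Holds, hC'.w1, b1, ha₂]
  · rintro s' - ⟨-, b2, b3⟩
    refine ⟨fun y ⟨j, h1, h2, h3⟩ => ?_, b3⟩
    have hj : j < k + 1 := by
      by_contra hj
      refine h1 (Nat.div_eq_of_lt (ha₂.trans_le (Nat.pow_le_pow_right (by norm_num) (by omega))))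
    exact ⟨(b2 j hj h2).1, (b2 j hj h2).2.trans h3⟩

/-! ### Rounding to cells -/

/-- The number of the cell of `x` when `[-1, 1]` is cut into `4 ^ k` cells of equal length. -/
noncomputable def cell (k : ℕ) (x : ℝ) : ℕ :=
  min ⌊(x + 1) * (2 ^ k * 2 ^ k / 2)⌋₊ (2 ^ (2 * k) - 1)

theorem cell_lt (k : ℕ) (x : ℝ) : cell k x < 2 ^ (2 * k) := by
  have := Nat.one_le_two_pow (n := 2 * k)
  unfold cell
  omega

/-- Binary search for the cell of the real number at `wreg 41`; the result goes to `wreg 42`. -/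
def findCell : Prog :=
  block [rload 40 41, radd 40 40 8, rmul 40 40 7, wconst 42 0, wdiv 43 5 3] ;;
  .loop (.wle 1 43)
    (block [wadd 44 42 43, rcast 41 44] ;;
      .ite (.rle 41 40) (block [wmove 42 44]) .skip ;; block [wdiv 43 43 3])

/-- The floor function is not available, but binary search finds the cell in `2 k` rounds. -/
theorem findCell_spec {M n D k : ℕ} {y : ℝ} {s : State} (hC : Consts n D k s)
    (hKM : 2 ^ (2 * k) < M) (h41 : s.wreg 41 < M) (hy : s.rmem (s.wreg 41) = y) (hy₀ : -1 ≤ y) :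
    HaltsWithin M findCell s (2 * k * 6 + 6) fun s' => s'.wreg 42 = cell k y := by
  have hE : 2 ^ k * 2 ^ k = 2 ^ (2 * k) := by rw [← pow_add, two_mul]
  refine HaltsWithin.seq (T₁ := 5) (T₂ := 2 * k * 6 + 1)
    (Q₁ := fun s' => s'.wreg 42 = 0 ∧ s'.wreg 43 = 2 ^ (2 * k) / 2 ∧
      s'.rreg 40 = (y + 1) * (2 ^ k * 2 ^ k / 2))
    (.of_wp_imp (fun Q hQ => ?_) le_rfl) (fun s1 F1 ⟨a1, a2, a3⟩ => ?_) (by omega)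
  · simp [Prog.wp, Instr.wp, block, hC.r7, hC.r8, hC.w5, hC.w3, hy, hE]
    exact ⟨h41, by omega, by omega, hQ _ (by simp)⟩
  refine (HaltsWithin.loop (2 * k) (fun i s' => s'.wreg 43 = 2 ^ (2 * k - i) / 2 ∧
      s'.wreg 42 ≤ cell k y ∧ cell k y < s'.wreg 42 + 2 ^ (2 * k - i) ∧
      s'.wreg 42 + 2 ^ (2 * k - i) ≤ 2 ^ (2 * k)) ?_ ?_ ?_).mono le_rfl ?_
  · simp [a1, a2, cell_lt]
  · rintro i hi s' F' ⟨b1, b2, b3, b4⟩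
    have hC' := (hC.of_frame F1 rfl).of_frame F' rfl
    obtain ⟨m, hm⟩ : ∃ m, 2 * k - i = m + 1 := ⟨2 * k - i - 1, by omega⟩
    have hm' : 2 * k - (i + 1) = m := by omega
    rw [hm, pow_succ] at b1 b3 b4
    rw [Nat.mul_div_cancel _ (by norm_num)] at b1
    have hpos := Nat.one_le_two_pow (n := m)
    have er : s'.rreg 40 = (y + 1) * (2 ^ k * 2 ^ k / 2) := by rw [F'.r 40 rfl, a3]
    have h40 : 0 ≤ s'.rreg 40 := by
      rw [er]; exact mul_nonneg (by linarith) (by positivity)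
    have hcell : ((s'.wreg 42 + 2 ^ m : ℕ) : ℝ) ≤ s'.rreg 40 ↔ s'.wreg 42 + 2 ^ m ≤ cell k y := by
      rw [← Nat.le_floor_iff h40, er, cell, le_min_iff]
      exact ⟨fun h => ⟨h, by omega⟩, fun h => h.1⟩
    refine ⟨by simpa [Test.Holds, hC'.w1, b1] using hpos, .of_wp_imp (fun Q hQ => ?_) le_rfl⟩
    rw [hm'] at hQ
    simp only [Prog.wp, Instr.wp, block, Test.Holds, b1, hC'.w3, Function.update_self,
      Function.update_of_ne, ne_eq, Nat.reduceEqDiff, not_false_eq_true,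
      hcell]
    have hdiv := Nat.div_le_self (2 ^ m) 2
    refine ⟨by omega, fun h => ⟨by omega, by norm_num, by omega, hQ _ ?_⟩,
      fun h => ⟨by norm_num, by omega, hQ _ ?_⟩⟩
    · simp; omega
    · simp; omega
  · rintro s' F' ⟨b1, -⟩
    have hC' := (hC.of_frame F1 rfl).of_frame F' rfl
    simp [Test.Holds, hC'.w1, b1]
  · rintro s' - ⟨-, b2, b3, -⟩
    simp at b3
    omega

/-- The cells of the coordinates `D - r + 1, …, D` of `x`, as the digits to base `4 ^ k` of one
number, in which coordinate `D` is the most significant one. -/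
noncomputable def cellCode (k D : ℕ) (x : ℕ → ℝ) : ℕ → ℕ
  | 0 => 0
  | r + 1 => cellCode k D x r * 2 ^ (2 * k) + cell k (x (D - r))

theorem cellCode_lt (k D : ℕ) (x : ℕ → ℝ) (r : ℕ) : cellCode k D x r < 2 ^ (2 * k * r) := by
  induction r with
  | zero => simp [cellCode]
  | succ r ih =>
    have := cell_lt k (x (D - r))
    rw [cellCode, Nat.mul_succ, pow_add]
    nlinarith

/-- The code of the cells of the coordinates `2, …, D` of point `wreg 21` goes to `wreg 45`. -/
def findCode : Prog :=
  block [wconst 45 0, wmove 46 17] ;;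
  .loop (.wlt 1 46)
    (block [wmul 41 21 2, wadd 41 41 46, wadd 41 41 8] ;; findCell ;;
      block [wmul 45 45 5, wadd 45 45 42, wsub 46 46 1])

theorem findCode_spec {M n D k : ℕ} {x : ℕ → ℝ} {s : State} (hC : Consts n D k s) (hD : 1 ≤ D)
    (hKM : 2 ^ (2 * k) < M) (hM : 2 ^ (2 * k * (D - 1)) < M)
    (hx : ∀ i, 2 ≤ i → i ≤ D → s.wreg 21 * (D + 1) + i + s.wreg 8 < M ∧
      s.rmem (s.wreg 21 * (D + 1) + i + s.wreg 8) = x i ∧ -1 ≤ x i) (hDM : D < M) :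
    HaltsWithin M findCode s ((D - 1) * (2 * k * 6 + 12 + 1) + 3) fun s' =>
      s'.wreg 45 = cellCode k D x (D - 1) := by
  have hE : 2 ^ k * 2 ^ k = 2 ^ (2 * k) := by rw [← pow_add, two_mul]
  refine HaltsWithin.seq (T₁ := 2) (T₂ := (D - 1) * (2 * k * 6 + 12 + 1) + 1)
    (Q₁ := fun s' => s'.wreg 45 = 0 ∧ s'.wreg 46 = D)
    (.of_wp_imp (fun Q hQ => ?_) le_rfl) (fun s1 F1 ⟨a1, a2⟩ => ?_) (by omega)
  · simp [Prog.wp, Instr.wp, block, hC.w17]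
    exact ⟨by omega, by omega, hQ _ (by simp)⟩
  refine (HaltsWithin.loop (D - 1) (fun i s' => s'.wreg 46 = D - i ∧
      s'.wreg 45 = cellCode k D x i) ?_ ?_ ?_).mono le_rfl ?_
  · simp [a1, a2, cellCode]
  · rintro i hi s' F' ⟨b1, b2⟩
    have hC' := (hC.of_frame F1 rfl).of_frame F' rfl
    have e21 : s'.wreg 21 = s.wreg 21 := by rw [F'.w 21 rfl, F1.w 21 rfl]
    have e8 : s'.wreg 8 = s.wreg 8 := by rw [F'.w 8 rfl, F1.w 8 rfl]
    obtain ⟨h1, h2, h3⟩ := hx (D - i) (by omega) (by omega)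
    refine ⟨by simp [Test.Holds, hC'.w1, b1]; omega, ?_⟩
    refine HaltsWithin.seq (T₁ := 3) (T₂ := 2 * k * 6 + 6 + 3)
      (Q₁ := fun s' => s'.wreg 41 = s.wreg 21 * (D + 1) + (D - i) + s.wreg 8)
      (.of_wp_imp (fun Q hQ => ?_) le_rfl) (fun s2 F2 c1 => ?_) (by omega)
    · simp [Prog.wp, Instr.wp, block, hC'.w2, b1, e21, e8]
      exact ⟨by omega, by omega, by omega, hQ _ (by simp)⟩
    have hC2 := hC'.of_frame F2 rfl
    refine (findCell_spec hC2 (y := x (D - i)) hKM ?_ ?_ h3).seq (fun s3 F3 d1 => ?_) le_rfl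
    · omega
    · rw [c1, F2.rm rfl, F'.rm rfl, F1.rm rfl, h2]
    · refine .of_wp_imp (fun Q hQ => ?_) (T := 3) le_rfl
      have e45 : s3.wreg 45 = cellCode k D x i := by rw [F3.w 45 rfl, F2.w 45 rfl, b2]
      have e46 : s3.wreg 46 = D - i := by rw [F3.w 46 rfl, F2.w 46 rfl, b1]
      have hlt : cellCode k D x (i + 1) < M := (cellCode_lt _ _ _ _).trans_le
        ((Nat.pow_le_pow_right (by norm_num) (Nat.mul_le_mul_left _ (by omega))).trans hM.le)
      rw [cellCode] at hlt
      have hC3 := hC2.of_frame F3 rfl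
      simp [Prog.wp, Instr.wp, block, hC3.w5, hC3.w1, e45, e46, d1, hE]
      refine ⟨by omega, hlt, by omega, hQ _ ?_⟩
      simp [cellCode]; omega
  · rintro s' F' ⟨b1, -⟩
    have hC' := (hC.of_frame F1 rfl).of_frame F' rfl
    simp [Test.Holds, hC'.w1, b1]; omega
  · rintro s' - ⟨-, b2⟩
    exact b2

/-! ### Forests of Li Chao trees -/

/-- The address ranges of different trees of a forest are disjoint. -/
theorem tree_disjoint {B N τ τ' c : ℕ} (hne : τ' ≠ τ) (h1 : B + τ' * N ≤ c)
    (h2 : c < B + τ' * N + N) : c < B + τ * N ∨ B + τ * N + N ≤ c := by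
  rcases Nat.lt_or_gt_of_ne hne with h | h
  · left
    have : (τ' + 1) * N ≤ τ * N := Nat.mul_le_mul_right _ h
    rw [Nat.succ_mul] at this
    omega
  · right
    have : (τ + 1) * N ≤ τ' * N := Nat.mul_le_mul_right _ h
    rw [Nat.succ_mul] at this
    omega

theorem TreeGood.of_agree {N B lo hi : ℕ} {G : ℕ → ℝ → Prop} {s s' : State}
    (h : TreeGood N B G s) (hA : AgreeOutside lo hi s s') (hd : B + N ≤ lo ∨ hi ≤ B) :
    TreeGood N B G s' := by
  intro v h1 h2
  have := hA (B + v) (by omega)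
  rw [this.1, this.2]
  exact h v h1 h2

theorem Covers.of_agree {α x : ℕ → ℝ} {B N lo hi a : ℕ} {y : ℝ} {s s' : State}
    (h : Covers α x s.wmem s.rmem B a y) (hA : AgreeOutside lo hi s s') (ha : a < N)
    (hd : B + N ≤ lo ∨ hi ≤ B) : Covers α x s'.wmem s'.rmem B a y :=
  h.congr ha (fun c h1 h2 => (hA c (by omega)).1) (fun c h1 h2 => (hA c (by omega)).2)

/-- Insertion into tree number `τ` of a forest of `NT` trees that starts at address `TB`. -/
theorem forestInsert_spec {M n D k TB NT τ XB : ℕ} {x : ℕ → ℝ} {G : ℕ → ℕ → ℝ → Prop} {s : State}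
    (hG : ∀ τ t b, G τ t b → 1 ≤ t ∧ t ≤ n) (hnM : n < M) (hC : Consts n D k s)
    (hτ : τ < NT) (hB : s.wreg 20 = TB + τ * (2 * 2 ^ k)) (hBM : TB + NT * (2 * 2 ^ k) < M)
    (hKM : 4 * 2 ^ k ≤ M) (hXB : s.wreg 22 = XB) (hcol : Column n (D + 1) XB TB x s)
    (ht : G τ (s.wreg 21) (s.rreg 20))
    (hgood : ∀ τ < NT, TreeGood (2 * 2 ^ k) (TB + τ * (2 * 2 ^ k)) (G τ) s) :
    HaltsWithin M insertParabola s ((k + 1) * 35 + 6) fun s' =>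
      (∀ τ < NT, TreeGood (2 * 2 ^ k) (TB + τ * (2 * 2 ^ k)) (G τ) s') ∧
      AgreeOutside TB (TB + NT * (2 * 2 ^ k)) s s' ∧
      (∀ τ' < NT, ∀ a y, 2 ^ k ≤ a → a < 2 ^ (k + 1) →
        Covers (abscissa k) x s.wmem s.rmem (TB + τ' * (2 * 2 ^ k)) a y →
        Covers (abscissa k) x s'.wmem s'.rmem (TB + τ' * (2 * 2 ^ k)) a y) ∧
      ∀ a, 2 ^ k ≤ a → a < 2 ^ (k + 1) →
        Covers (abscissa k) x s'.wmem s'.rmem (TB + τ * (2 * 2 ^ k)) a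
          (s.rreg 20 + (abscissa k a - x (s.wreg 21)) ^ 2) := by
  have hle : (τ + 1) * (2 * 2 ^ k) ≤ NT * (2 * 2 ^ k) := Nat.mul_le_mul_right _ hτ
  rw [Nat.succ_mul] at hle
  refine (insert_spec (hG τ) hnM hC hB (by omega) hKM hXB
    (fun t h1 h2 => ⟨(hcol t h1 h2).1.trans_le (Nat.le_add_right _ _), (hcol t h1 h2).2⟩)
    ht (hgood τ hτ)).mono le_rfl ?_
  rintro s' - ⟨h1, h2, h3⟩
  refine ⟨fun τ' hτ' => ?_, h2.mono (by omega) (by omega), fun τ' hτ' a y ha1 ha2 h => ?_,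
    fun a ha1 ha2 => h3 a _ ha1 ha2 (.inr le_rfl)⟩
  · by_cases hne : τ' = τ
    · subst hne; exact h1
    · intro v hv1 hv2
      have := h2 (TB + τ' * (2 * 2 ^ k) + v) (tree_disjoint hne (by omega) (by omega))
      rw [this.1, this.2]
      exact hgood τ' hτ' v hv1 hv2
  · by_cases hne : τ' = τ
    · subst hne; exact h3 a y ha1 ha2 (.inl h)
    · exact h.congr (N := 2 * 2 ^ k) (by rw [← pow_succ']; exact ha2)
        (fun c c1 c2 => (h2 c (tree_disjoint hne c1 c2)).1)
        (fun c c1 c2 => (h2 c (tree_disjoint hne c1 c2)).2)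

/-! ### Distances to the points of a net, one coordinate at a time -/

/-- The squared distance, in the coordinates `0, …, σ`, of point `t` to the net point that has
coordinate `0` equal to `2` and whose other coordinates are given by the digits of `A` to base
`2 ^ k`, the least significant digit belonging to coordinate `σ`. -/
noncomputable def netCost (k : ℕ) (X : ℕ → ℕ → ℝ) : ℕ → ℕ → ℕ → ℝ
  | 0, _, t => (2 - X t 0) ^ 2
  | σ + 1, A, t => netCost k X σ (A / 2 ^ k) t +
      (abscissa k (2 ^ k + A % 2 ^ k) - X t (σ + 1)) ^ 2

/-- In stage `σ`, tree number `A + 2 ^ (k * σ) * c` holds parabolas of points whose coordinates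
`σ + 2, …, D` lie in the cells coded by `c`, with the cost in the coordinates `0, …, σ` as
height. -/
def Admissible (n D k : ℕ) (X : ℕ → ℕ → ℝ) (σ τ t : ℕ) (b : ℝ) : Prop :=
  (1 ≤ t ∧ t ≤ n) ∧ cellCode k D (X t) (D - (σ + 1)) = τ / 2 ^ (k * σ) ∧
    b = netCost k X σ (τ % 2 ^ (k * σ)) t

/-- What point `t` is entitled to in the forest of stage `σ` at address `TB`, for the net points
with number `A`: a parabola that is at most `20 σ / 4 ^ k` higher than its own. -/
def Served (D k : ℕ) (X : ℕ → ℕ → ℝ) (TB σ A t : ℕ) (s : State) : Prop :=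
  ∀ a, 2 ^ k ≤ a → a < 2 ^ (k + 1) →
    Covers (abscissa k) (fun t => X t (σ + 1)) s.wmem s.rmem
      (TB + (A + 2 ^ (k * σ) * cellCode k D (X t) (D - (σ + 1))) * (2 * 2 ^ k)) a
      (netCost k X σ A t + (abscissa k a - X t (σ + 1)) ^ 2 + σ * (20 / 2 ^ (2 * k)))

/-- The coordinates of the points are in the real memory, in rows of length `D + 1` of which the
first one starts at `NB + (D + 1)`, below the address `top`. -/
def Table (n D NB top : ℕ) (X : ℕ → ℕ → ℝ) (s : State) : Prop :=
  ∀ t i, 1 ≤ t → t ≤ n → i ≤ D →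
    NB + i + t * (D + 1) < top ∧ s.rmem (NB + i + t * (D + 1)) = X t i

theorem Table.of_agree {n D NB top lo hi : ℕ} {X : ℕ → ℕ → ℝ} {s s' : State}
    (h : Table n D NB top X s) (hA : AgreeOutside lo hi s s') (ht : top ≤ lo) :
    Table n D NB top X s' := by
  intro t i h1 h2 h3
  have := h t i h1 h2 h3
  exact ⟨this.1, by rw [(hA _ (by omega)).2, this.2]⟩

theorem Table.column {n D NB top B i : ℕ} {X : ℕ → ℕ → ℝ} {s : State}
    (h : Table n D NB top X s) (hB : top ≤ B) (hi : i ≤ D) :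
    Column n (D + 1) (NB + i) B (fun t => X t i) s :=
  fun t h1 h2 => ⟨(h t i h1 h2 hi).1.trans_le hB, (h t i h1 h2 hi).2⟩

/-- Points in the same cell have almost the same distance to each point of `[-4, 4]`. -/
theorem sq_sub_le_of_cell_eq {k : ℕ} {x x' y : ℝ} (hx : |x| ≤ 1) (hx' : |x'| ≤ 1) (hy : |y| ≤ 4)
    (h : cell k x = cell k x') : (y - x) ^ 2 ≤ (y - x') ^ 2 + 20 / 2 ^ (2 * k) := by
  have hE : (2 : ℝ) ^ k * 2 ^ k = 2 ^ (2 * k) := by rw [← pow_add, two_mul]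
  rw [abs_le] at *
  have hpos : (0 : ℝ) < 2 ^ (2 * k) := by positivity
  -- every point of a cell is at distance at most one cell from the left end of the cell
  have key : ∀ z : ℝ, -1 ≤ z ∧ z ≤ 1 → (cell k z : ℝ) ≤ (z + 1) * (2 ^ (2 * k) / 2) ∧
      (z + 1) * (2 ^ (2 * k) / 2) ≤ cell k z + 1 := by
    intro z hz
    unfold cell
    rw [hE]
    have h0 : 0 ≤ (z + 1) * (2 ^ (2 * k) / 2) := mul_nonneg (by linarith) (by positivity)
    have h1 := Nat.floor_le h0
    have h2 := Nat.lt_floor_add_one ((z + 1) * ((2 : ℝ) ^ (2 * k) / 2))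
    have h3 := Nat.one_le_two_pow (n := 2 * k)
    have h4 : (z + 1) * (2 ^ (2 * k) / 2) ≤ 2 ^ (2 * k) := by nlinarith
    refine ⟨le_trans (by exact_mod_cast min_le_left _ _) h1, ?_⟩
    rcases min_choice ⌊(z + 1) * ((2 : ℝ) ^ (2 * k) / 2)⌋₊ (2 ^ (2 * k) - 1) with h | h
    · rw [h]; exact h2.le
    · rw [h]; push_cast [Nat.cast_sub h3]; linarith
  obtain ⟨a1, a2⟩ := key x hx
  obtain ⟨b1, b2⟩ := key x' hx'
  rw [h] at a1 a2
  have h1 : x - x' ≤ 2 / 2 ^ (2 * k) := by rw [le_div_iff₀ hpos]; linarith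
  have h2 : x' - x ≤ 2 / 2 ^ (2 * k) := by rw [le_div_iff₀ hpos]; linarith
  have h3 : 20 / (2 : ℝ) ^ (2 * k) = 10 * (2 / 2 ^ (2 * k)) := by ring
  rw [h3]
  have h4 : 0 ≤ 2 / (2 : ℝ) ^ (2 * k) := by positivity
  generalize 2 / (2 : ℝ) ^ (2 * k) = δ at *
  have : (y - x) ^ 2 - (y - x') ^ 2 = (x' - x) * (2 * y - x - x') := by ring
  have h5 : -10 ≤ 2 * y - x - x' ∧ 2 * y - x - x' ≤ 10 := ⟨by linarith, by linarith⟩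
  rcases le_total 0 (x' - x) with h | h
  · nlinarith
  · nlinarith

theorem abs_abscissa_le {k a : ℕ} (h1 : 2 ^ k ≤ a) (h2 : a < 2 ^ (k + 1)) :
    |abscissa k a| ≤ 4 := by
  have h1' : (2 : ℝ) ^ k ≤ a := by exact_mod_cast h1
  have h2' : (a : ℝ) ≤ 2 * 2 ^ k := by rw [← pow_succ']; exact_mod_cast h2.le
  have hpos : (0 : ℝ) < 2 ^ k := by positivity
  have e : (a : ℝ) * (8 / 2 ^ k) = 8 * (a / 2 ^ k) := by ring
  have h3 : 1 ≤ (a : ℝ) / 2 ^ k := by rwa [le_div_iff₀ hpos, one_mul]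
  have h4 : (a : ℝ) / 2 ^ k ≤ 2 := by rwa [div_le_iff₀ hpos]
  rw [abscissa, e, abs_le]
  constructor <;> linarith

/-- Query the tree and the leaf with joint number `wreg 16` in the forest at `wreg 9`. -/
def stageQuery : Prog :=
  block [wdiv 50 16 4, wmul 51 50 4, wsub 51 16 51, wadd 30 4 51, wmul 52 50 18, wadd 20 9 52,
    wadd 22 8 13] ;; treeMin

/-- The registers of the stage loop. -/
structure StageRegs (k NB TB σ J : ℕ) (s : State) : Prop where
  w8 : s.wreg 8 = NB
  w9 : s.wreg 9 = TB
  w13 : s.wreg 13 = σ + 1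
  w14 : s.wreg 14 = 2 ^ (k * (σ + 1))
  w16 : s.wreg 16 = J

/-- The query with joint number `J` serves the net points with number `A` in the coordinates
`1, …, σ + 1`, for the points `t` of one cell in the coordinates `σ + 2, …, D`. -/
theorem stageQuery_spec {M n D k NB top TB σ J NT : ℕ} {X : ℕ → ℕ → ℝ} {s : State}
    (hσ : σ + 1 ≤ D) (hnM : n < M) (hC : Consts n D k s)
    (hR : StageRegs k NB TB σ J s) (hT : Table n D NB top X s) (htop : top ≤ TB)
    (hNB : NB + D < M)
    (hM : TB + NT * (2 * 2 ^ k) < M)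
    (hJ : J < 2 ^ k * NT)
    (hgood : ∀ τ < NT, TreeGood (2 * 2 ^ k) (TB + τ * (2 * 2 ^ k)) (Admissible n D k X σ τ) s) :
    HaltsWithin M stageQuery s ((k + 1) * 16 + 13) fun s' =>
      s'.wreg 22 = NB + (σ + 1) ∧
      (s'.wreg 31 ≠ 0 → (1 ≤ s'.wreg 31 ∧ s'.wreg 31 ≤ n) ∧
        cellCode k D (X (s'.wreg 31)) (D - (σ + 1)) = J / 2 ^ (k * (σ + 1)) ∧
        s'.rreg 30 = netCost k X (σ + 1) (J % 2 ^ (k * (σ + 1))) (s'.wreg 31)) ∧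
      ∀ A t, A + 2 ^ (k * (σ + 1)) * cellCode k D (X t) (D - (σ + 1)) = J →
        A < 2 ^ (k * (σ + 1)) → Served D k X TB σ (A / 2 ^ k) t s →
        s'.wreg 31 ≠ 0 ∧
          s'.rreg 30 ≤ netCost k X (σ + 1) A t + σ * (20 / 2 ^ (2 * k)) := by
  have hK : 0 < 2 ^ k := by positivity
  have hτ : J / 2 ^ k < NT := Nat.div_lt_of_lt_mul hJ
  have hle : (J / 2 ^ k + 1) * (2 * 2 ^ k) ≤ NT * (2 * 2 ^ k) := Nat.mul_le_mul_right _ hτ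
  rw [Nat.succ_mul] at hle
  have hdm : J / 2 ^ k * 2 ^ k + J % 2 ^ k = J := Nat.div_add_mod' J (2 ^ k)
  have hmod : J % 2 ^ k < 2 ^ k := Nat.mod_lt _ hK
  have hsub : J - J / 2 ^ k * 2 ^ k = J % 2 ^ k := by omega
  have hJM : J < M := by nlinarith
  have hdle := Nat.div_le_self J (2 ^ k)
  refine HaltsWithin.seq (T₁ := 7) (T₂ := (k + 1) * 16 + 6)
    (Q₁ := fun s' => s'.wreg 30 = 2 ^ k + J % 2 ^ k ∧
      s'.wreg 20 = TB + J / 2 ^ k * (2 * 2 ^ k) ∧ s'.wreg 22 = NB + (σ + 1))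
    (.of_wp_imp (fun Q hQ => ?_) le_rfl) (fun s1 F1 ⟨a1, a2, a3⟩ => ?_) (by omega)
  · simp [Prog.wp, Instr.wp, block, hC.w4, hC.w18, hR.w16, hR.w8, hR.w9, hR.w13, hsub]
    refine ⟨?_, ?_, ?_, ?_, ?_, ?_, ?_, hQ _ (by simp)⟩ <;> omega
  have hlow : 2 ^ (k * (σ + 1)) = 2 ^ k * 2 ^ (k * σ) := by
    rw [← pow_add]; congr 1; ring
  refine (treeMin_spec (B := TB + J / 2 ^ k * (2 * 2 ^ k)) (XB := NB + (σ + 1))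
    (x := fun t => X t (σ + 1)) (G := Admissible n D k X σ (J / 2 ^ k)) (fun t b h => h.1) hnM
    (hC.of_frame F1 rfl) a2 (by omega) a3 ?_ ?_ a1 (by omega)
    (by rw [pow_succ]; omega)).mono le_rfl ?_
  · intro t h1 h2
    rw [F1.rm rfl]
    exact hT.column (htop.trans (Nat.le_add_right _ _)) (by omega) t h1 h2
  · intro v
    rw [F1.wm rfl, F1.rm rfl]
    exact hgood _ hτ v
  · rw [F1.wm rfl, F1.rm rfl]
    rintro s' F' ⟨b1, b2⟩
    refine ⟨(F'.w 22 rfl).trans a3, fun h => ?_, fun A t hA hA' hS => ?_⟩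
    · obtain ⟨b, ⟨c1, c2, c3⟩, c4⟩ := b2 h
      have e1 : J % 2 ^ (k * (σ + 1)) / 2 ^ k = J / 2 ^ k % 2 ^ (k * σ) := by
        rw [hlow, Nat.mod_mul_right_div_self]
      have e2 : J % 2 ^ (k * (σ + 1)) % 2 ^ k = J % 2 ^ k := by
        rw [hlow, Nat.mod_mul_right_mod]
      refine ⟨c1, ?_, ?_⟩
      · rw [c2, hlow, Nat.div_div_eq_div_mul]
      · rw [c4, netCost, e1, e2, c3]
    · have hd : J / 2 ^ k = A / 2 ^ k + 2 ^ (k * σ) * cellCode k D (X t) (D - (σ + 1)) := by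
        rw [← hA, hlow, mul_assoc, Nat.add_mul_div_left _ _ hK]
      have hm : J % 2 ^ k = A % 2 ^ k := by
        rw [← hA, hlow, mul_assoc, Nat.add_mul_mod_self_left]
      have := hS (2 ^ k + J % 2 ^ k) (by omega) (by rw [pow_succ]; omega)
      rw [← hd] at this
      obtain ⟨c1, c2⟩ := b1 _ this
      refine ⟨c1, c2.trans ?_⟩
      rw [netCost, hm]

/-- Insert the parabola found by `stageQuery` into the next forest, which starts at `wreg 19`. -/
def stageInsert : Prog :=
  block [wdiv 50 16 14, wmul 51 50 14, wsub 51 16 51, wdiv 50 50 5, wmul 50 14 50, wadd 50 51 50,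
    wmul 50 50 18, wadd 20 19 50, wadd 22 22 1, wmove 21 31, rmove 20 30] ;; insertParabola

/-- Move one entry of a forest to the next forest. -/
def stageBody : Prog :=
  stageQuery ;; .ite (.wle 1 31) stageInsert .skip ;; block [wadd 16 16 1]

/-- The number of trees in the forest of stage `σ`. -/
def numTrees (k D σ : ℕ) : ℕ := 2 ^ (k * σ) * 2 ^ (2 * k * (D - (σ + 1)))

theorem numTrees_succ {k D σ : ℕ} (h : σ + 1 < D) :
    numTrees k D σ = 2 ^ k * numTrees k D (σ + 1) := by
  obtain ⟨r, rfl⟩ := Nat.exists_eq_add_of_lt h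
  unfold numTrees
  rw [show σ + 1 + r + 1 - (σ + 1) = r + 1 by omega,
    show σ + 1 + r + 1 - (σ + 1 + 1) = r by omega, ← pow_add, ← pow_add, ← pow_add]
  congr 1
  ring

theorem numTrees_pos (k D σ : ℕ) : 0 < numTrees k D σ := by unfold numTrees; positivity

/-- The points that have joint number `J` in stage `σ` become served in the next forest, by the
parabola of a point `e` from the same cell. -/
theorem stageBody_spec {M n D k NB top TB NTB σ J : ℕ} {X : ℕ → ℕ → ℝ} {s : State}
    (hσ : σ + 1 < D) (hnM : n < M) (hC : Consts n D k s)
    (hX : ∀ t i, 1 ≤ t → t ≤ n → i ≤ D → |X t i| ≤ 1)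
    (hR : StageRegs k NB TB σ J s) (hT : Table n D NB top X s) (htop : top ≤ TB)
    (hNB : NB + D < M) (h19 : s.wreg 19 = NTB)
    (hNTB : TB + numTrees k D σ * (2 * 2 ^ k) ≤ NTB) (hKM : 4 * 2 ^ k ≤ M)
    (hM : NTB + numTrees k D (σ + 1) * (2 * 2 ^ k) < M)
    (hJ : J < 2 ^ k * numTrees k D σ)
    (hgood : ∀ τ < numTrees k D σ,
      TreeGood (2 * 2 ^ k) (TB + τ * (2 * 2 ^ k)) (Admissible n D k X σ τ) s)
    (hgood' : ∀ τ < numTrees k D (σ + 1),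
      TreeGood (2 * 2 ^ k) (NTB + τ * (2 * 2 ^ k)) (Admissible n D k X (σ + 1) τ) s) :
    HaltsWithin M stageBody s ((k + 1) * 51 + 32) fun s' =>
      s'.wreg 16 = J + 1 ∧
      (∀ τ < numTrees k D (σ + 1),
        TreeGood (2 * 2 ^ k) (NTB + τ * (2 * 2 ^ k)) (Admissible n D k X (σ + 1) τ) s') ∧
      AgreeOutside NTB (NTB + numTrees k D (σ + 1) * (2 * 2 ^ k)) s s' ∧
      (∀ A t, A < 2 ^ (k * (σ + 1)) → Served D k X NTB (σ + 1) A t s →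
        Served D k X NTB (σ + 1) A t s') ∧
      ∀ A t, 1 ≤ t → t ≤ n → A < 2 ^ (k * (σ + 1)) →
        A + 2 ^ (k * (σ + 1)) * cellCode k D (X t) (D - (σ + 1)) = J →
        Served D k X TB σ (A / 2 ^ k) t s → Served D k X NTB (σ + 1) A t s' := by
  obtain ⟨r, hr⟩ : ∃ r, D = σ + 1 + r + 1 := ⟨D - (σ + 2), by omega⟩
  have hr1 : D - (σ + 1) = r + 1 := by omega
  have hr2 : D - (σ + 1 + 1) = r := by omega
  have hr3 : D - r = σ + 1 + 1 := by omega
  have hE : 2 ^ k * 2 ^ k = 2 ^ (2 * k) := by rw [← pow_add, two_mul]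
  have hKpos : 0 < 2 ^ k := by positivity
  have hKS : 0 < 2 ^ (k * (σ + 1)) := by positivity
  have hlt : ∀ A c, A < 2 ^ (k * (σ + 1)) → c < 2 ^ (2 * k * r) →
      A + 2 ^ (k * (σ + 1)) * c < numTrees k D (σ + 1) := by
    intro A c hA hc
    rw [numTrees, hr2]
    nlinarith
  have h16 : s.wreg 16 = J := hR.w16
  have hsize : numTrees k D σ * (2 * 2 ^ k) = 2 * (2 ^ k * numTrees k D σ) := by ring
  refine (stageQuery_spec hσ.le hnM hC hR hT htop hNB (by omega) hJ hgood).seq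
    (fun s1 F1 ⟨a1, a2, a3⟩ => ?_) (T₂ := (k + 1) * 35 + 19) (by omega)
  have hC1 := hC.of_frame F1 rfl
  have ewm := F1.wm rfl
  have erm := F1.rm rfl
  have e16 : s1.wreg 16 = J := (F1.w 16 rfl).trans h16
  -- the case distinction on whether the query has found anything is made once and for all
  refine HaltsWithin.seq (T₁ := (k + 1) * 35 + 17 + 1) (T₂ := 1)
    (Q₁ := fun s' => (∀ τ < numTrees k D (σ + 1),
        TreeGood (2 * 2 ^ k) (NTB + τ * (2 * 2 ^ k)) (Admissible n D k X (σ + 1) τ) s') ∧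
      AgreeOutside NTB (NTB + numTrees k D (σ + 1) * (2 * 2 ^ k)) s s' ∧
      (∀ A t, A < 2 ^ (k * (σ + 1)) → Served D k X NTB (σ + 1) A t s →
        Served D k X NTB (σ + 1) A t s') ∧
      ∀ A t, 1 ≤ t → t ≤ n → A < 2 ^ (k * (σ + 1)) →
        A + 2 ^ (k * (σ + 1)) * cellCode k D (X t) (D - (σ + 1)) = J →
        Served D k X TB σ (A / 2 ^ k) t s → Served D k X NTB (σ + 1) A t s')
    (.ite (fun hb => ?_) (fun hb => ?_)) (fun s2 F2 hs2 => ?_) (by omega)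
  · simp only [Test.Holds, hC1.w1] at hb
    obtain ⟨b1, b2, b3⟩ := a2 (by omega)
    set e := s1.wreg 31 with he
    set G := J / 2 ^ (k * (σ + 1)) with hGdef
    set A' := J % 2 ^ (k * (σ + 1)) with hA'
    have hA'lt : A' < 2 ^ (k * (σ + 1)) := Nat.mod_lt _ hKS
    have hJdm : G * 2 ^ (k * (σ + 1)) + A' = J := Nat.div_add_mod' _ _
    have hcode : cellCode k D (X e) (r + 1) =
      cellCode k D (X e) r * 2 ^ (2 * k) + cell k (X e (σ + 1 + 1)) := by rw [cellCode, hr3]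
    rw [hr1] at b2
    have hGE : G / 2 ^ (2 * k) = cellCode k D (X e) r := by
      rw [← b2, hcode, mul_comm, Nat.mul_add_div (by positivity), Nat.div_eq_of_lt (cell_lt _ _),
        add_zero]
    have hG' := cellCode_lt k D (X e) r
    set τ' := A' + 2 ^ (k * (σ + 1)) * cellCode k D (X e) r with hτ'
    have hτlt : τ' < numTrees k D (σ + 1) := hlt _ _ hA'lt hG'
    have hτM : τ' * (2 * 2 ^ k) + 2 * 2 ^ k ≤ numTrees k D (σ + 1) * (2 * 2 ^ k) := by
      rw [← Nat.succ_mul]; exact Nat.mul_le_mul_right _ hτlt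
    have hτle : τ' ≤ τ' * (2 * 2 ^ k) := Nat.le_mul_of_pos_right _ (by positivity)
    have hGle : G ≤ G * 2 ^ (k * (σ + 1)) := Nat.le_mul_of_pos_right _ (by positivity)
    have hG'le : G / 2 ^ (2 * k) ≤ G := Nat.div_le_self _ _
    have hsub : J - G * 2 ^ (k * (σ + 1)) = A' := by omega
    refine HaltsWithin.seq (T₁ := 11) (T₂ := (k + 1) * 35 + 6)
      (Q₁ := fun s' => s'.wreg 20 = NTB + τ' * (2 * 2 ^ k) ∧ s'.wreg 22 = NB + (σ + 1 + 1) ∧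
        s'.wreg 21 = e ∧ s'.rreg 20 = s1.rreg 30)
      (.of_wp_imp (fun Q hQ => ?_) le_rfl) (fun s2 F2 ⟨c1, c2, c3, c4⟩ => ?_) (by omega)
    · have e14 : s1.wreg 14 = 2 ^ (k * (σ + 1)) := (F1.w 14 rfl).trans hR.w14
      have e19 : s1.wreg 19 = NTB := (F1.w 19 rfl).trans h19
      simp only [Prog.wp, Instr.wp, block, Function.update_self, Function.update_of_ne, ne_eq,
        Nat.reduceEqDiff, not_false_eq_true, e16, e14, e19, a1, hC1.w5, hC1.w18, hC1.w1, ← he, hE,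
        ← hGdef, hsub, hGE, ← hτ']
      have hle2 : 2 ^ (k * (σ + 1)) * cellCode k D (X e) r ≤ τ' := Nat.le_add_left _ _
      refine ⟨by omega, by omega, by omega, by omega, by positivity, by omega, by omega, by omega,
        by omega, by omega, by omega, by omega, hQ _ (by simp [add_assoc])⟩
    · have ewm2 : s2.wmem = s.wmem := by rw [F2.wm rfl, ewm]
      have erm2 : s2.rmem = s.rmem := by rw [F2.rm rfl, erm]
      refine (forestInsert_spec (TB := NTB) (NT := numTrees k D (σ + 1)) (τ := τ')
        (XB := NB + (σ + 1 + 1)) (x := fun t => X t (σ + 1 + 1)) (G := Admissible n D k X (σ + 1))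
        (fun _ _ _ h => h.1) hnM (hC1.of_frame F2 rfl) hτlt c1 hM hKM c2 ?_ ?_ ?_).mono le_rfl ?_
      · intro t h1 h2
        rw [erm2]
        exact hT.column (by omega) (by omega) t h1 h2
      · refine ⟨by rw [c3]; exact b1, ?_, ?_⟩
        · rw [c3, hτ', hr2, Nat.add_mul_div_left _ _ hKS, Nat.div_eq_of_lt hA'lt, zero_add]
        · rw [c3, c4, b3, hτ', Nat.add_mul_mod_self_left, Nat.mod_eq_of_lt hA'lt]
      · intro τ hτ v
        rw [ewm2, erm2]
        exact hgood' τ hτ v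
      · rintro s3 - ⟨d1, d2, d3, d4⟩
        rw [ewm2, erm2] at d3
        refine ⟨d1, ?_, ?_, ?_⟩
        · intro c hc
          have := d2 c hc
          rwa [ewm2, erm2] at this
        · intro A t hA hS a ha1 ha2
          exact d3 _ (hlt _ _ hA (by rw [hr2]; exact cellCode_lt _ _ _ _)) a _ ha1 ha2
            (hS a ha1 ha2)
        · intro A t ht1 ht2 hA hAJ hS a ha1 ha2
          obtain ⟨-, f2⟩ := a3 A t hAJ hA hS
          have hAA : A' = A := by
            rw [hA', ← hAJ, Nat.add_mul_mod_self_left, Nat.mod_eq_of_lt hA]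
          have hGG : cellCode k D (X t) (r + 1) = G := by
            rw [hGdef, ← hAJ, Nat.add_mul_div_left _ _ hKS, Nat.div_eq_of_lt hA, zero_add, hr1]
          have hcode' : cellCode k D (X t) (r + 1) =
            cellCode k D (X t) r * 2 ^ (2 * k) + cell k (X t (σ + 1 + 1)) := by rw [cellCode, hr3]
          have hq : cellCode k D (X t) r = cellCode k D (X e) r := by
            rw [← hGE, ← hGG, hcode', mul_comm, Nat.mul_add_div (by positivity),
              Nat.div_eq_of_lt (cell_lt _ _), add_zero]
          have hcell : cell k (X e (σ + 1 + 1)) = cell k (X t (σ + 1 + 1)) := by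
            rw [← hGG, hcode, hcode', hq] at b2
            exact Nat.add_left_cancel b2
          have hη := sq_sub_le_of_cell_eq (hX e (σ + 1 + 1) b1.1 b1.2 (by omega))
            (hX t (σ + 1 + 1) ht1 ht2 (by omega)) (abs_abscissa_le ha1 ha2) hcell
          rw [hr2, hq, ← hAA]
          refine (d4 a ha1 ha2).mono ?_
          rw [c3, c4, hAA]
          push_cast
          linarith
  · simp only [Test.Holds, hC1.w1] at hb
    refine .of_wp ?_ (T := (k + 1) * 35 + 17) (Nat.zero_le _)
    refine ⟨?_, fun c _ => by rw [ewm, erm]; exact ⟨rfl, rfl⟩, ?_, ?_⟩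
    · intro τ hτ v
      rw [ewm, erm]
      exact hgood' τ hτ v
    · intro A t _
      unfold Served
      rw [ewm, erm]
      exact id
    · intro A t _ _ hA hAJ hS
      exact absurd (a3 A t hAJ hA hS).1 (by omega)
  · refine .of_wp_imp (fun Q hQ => ?_) le_rfl
    have hJ2 : J + 1 < M := by have := numTrees_pos k D σ; omega
    have e16' : s2.wreg 16 = J := (F2.w 16 rfl).trans e16
    simp only [Prog.wp, Instr.wp, block, e16', (hC1.of_frame F2 rfl).w1]
    exact ⟨hJ2, hQ _ ⟨by simp, hs2⟩⟩

theorem numTrees_le {k D σ : ℕ} (h : σ < D) : numTrees k D σ ≤ numTrees k D 0 := by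
  induction σ with
  | zero => exact le_rfl
  | succ σ ih =>
    refine le_trans ?_ (ih (by omega))
    rw [numTrees_succ h]
    exact Nat.le_mul_of_pos_left _ (by positivity)

/-- Build the next forest from the current one, in fresh memory. -/
def stage : Prog :=
  block [wmove 19 6, wdiv 55 15 4, wadd 56 55 55, wadd 6 6 56, wconst 16 0] ;;
  .loop (.wlt 16 15) stageBody ;;
  block [wmove 9 19, wmul 14 14 4, wmove 15 55, wadd 13 13 1]

/-- The forest of stage `σ` is complete.  It starts at address `wreg 9`; the cells from address
`wreg 6` on have not been used. -/
structure ForestReady (n D k NB top : ℕ) (X : ℕ → ℕ → ℝ) (σ : ℕ) (s : State) : Prop where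
  w8 : s.wreg 8 = NB
  w13 : s.wreg 13 = σ + 1
  w14 : s.wreg 14 = 2 ^ (k * (σ + 1))
  w15 : s.wreg 15 = 2 ^ k * numTrees k D σ
  top_le : top ≤ s.wreg 9
  le_free : s.wreg 9 + numTrees k D σ * (2 * 2 ^ k) ≤ s.wreg 6
  fresh : ∀ c, s.wreg 6 ≤ c → s.wmem c = 0
  table : Table n D NB top X s
  good : ∀ τ < numTrees k D σ,
    TreeGood (2 * 2 ^ k) (s.wreg 9 + τ * (2 * 2 ^ k)) (Admissible n D k X σ τ) s
  served : ∀ A t, 1 ≤ t → t ≤ n → A < 2 ^ (k * σ) → Served D k X (s.wreg 9) σ A t s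

theorem code_lt_leaves {k D σ A : ℕ} {x : ℕ → ℝ} (hA : A < 2 ^ (k * (σ + 1))) :
    A + 2 ^ (k * (σ + 1)) * cellCode k D x (D - (σ + 1)) < 2 ^ k * numTrees k D σ := by
  have hc := cellCode_lt k D x (D - (σ + 1))
  have h1 : 2 ^ k * numTrees k D σ = 2 ^ (k * (σ + 1)) * 2 ^ (2 * k * (D - (σ + 1))) := by
    rw [numTrees, ← mul_assoc, ← pow_add]
    congr 2
    ring
  rw [h1]
  nlinarith

theorem Served.of_agree {D k TB σ A t lo hi : ℕ} {X : ℕ → ℕ → ℝ} {s s' : State}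
    (h : Served D k X TB σ A t s) (hA : A < 2 ^ (k * σ)) (hag : AgreeOutside lo hi s s')
    (hd : TB + numTrees k D σ * (2 * 2 ^ k) ≤ lo) : Served D k X TB σ A t s' := by
  intro a ha1 ha2
  refine (h a ha1 ha2).of_agree (N := 2 * 2 ^ k) hag (by rw [← pow_succ']; exact ha2) (.inl ?_)
  have hc := cellCode_lt k D (X t) (D - (σ + 1))
  have h1 : A + 2 ^ (k * σ) * cellCode k D (X t) (D - (σ + 1)) + 1 ≤ numTrees k D σ := by
    rw [numTrees]
    nlinarith
  have h2 := Nat.mul_le_mul_right (2 * 2 ^ k) h1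
  rw [Nat.succ_mul] at h2
  omega

theorem stage_spec {M n D k NB top σ : ℕ} {X : ℕ → ℕ → ℝ} {s : State}
    (hσ : σ + 1 < D) (hnM : n < M) (hC : Consts n D k s)
    (hX : ∀ t i, 1 ≤ t → t ≤ n → i ≤ D → |X t i| ≤ 1)
    (hF : ForestReady n D k NB top X σ s) (hNB : NB + D < M) (hKM : 4 * 2 ^ k ≤ M)
    (hKD : 2 ^ (k * D) < M)
    (hM : s.wreg 6 + numTrees k D (σ + 1) * (2 * 2 ^ k) < M) :
    HaltsWithin M stage s (2 ^ k * numTrees k D 0 * ((k + 1) * 51 + 33) + 10) fun s' =>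
      ForestReady n D k NB top X (σ + 1) s' ∧ AgreeOutside (s.wreg 6) (s'.wreg 6) s s' ∧
      s'.wreg 6 = s.wreg 6 + numTrees k D (σ + 1) * (2 * 2 ^ k) := by
  set P := s.wreg 6 with hP
  set TB := s.wreg 9 with hTB
  set S := numTrees k D (σ + 1) * (2 * 2 ^ k) with hS
  have hLS : 2 ^ k * numTrees k D (σ + 1) + 2 ^ k * numTrees k D (σ + 1) = S := by
    rw [hS]; ring
  have hpos := numTrees_pos k D (σ + 1)
  have hKpos : 0 < 2 ^ k := by positivity
  have hsucc := numTrees_succ (k := k) hσ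
  have hle_free := hF.le_free
  have hDM : D < M := by omega
  refine HaltsWithin.seq (T₁ := 5)
    (T₂ := 2 ^ k * numTrees k D 0 * ((k + 1) * 51 + 33) + 5)
    (Q₁ := fun s' => s'.wreg 19 = P ∧ s'.wreg 55 = 2 ^ k * numTrees k D (σ + 1) ∧
      s'.wreg 6 = P + S ∧ s'.wreg 16 = 0)
    (.of_wp_imp (fun Q hQ => ?_) le_rfl) (fun s1 F1 ⟨a1, a2, a3, a4⟩ => ?_) (by omega)
  · have hdiv : s.wreg 15 / 2 ^ k = 2 ^ k * numTrees k D (σ + 1) := by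
      rw [hF.w15, hsucc, Nat.mul_div_cancel_left _ hKpos]
    simp only [Prog.wp, Instr.wp, block, Function.update_self, Function.update_of_ne, ne_eq,
        Nat.reduceEqDiff, not_false_eq_true, hC.w4, hdiv, hLS, ← hP]
    refine ⟨by omega, by positivity, by omega, by omega, by omega, by omega, hQ _ (by simp)⟩
  have hC1 := hC.of_frame F1 rfl
  have ewm1 := F1.wm rfl
  have erm1 := F1.rm rfl
  have hL : 2 ^ k * numTrees k D σ ≤ 2 ^ k * numTrees k D 0 :=
    Nat.mul_le_mul_left _ (numTrees_le (by omega))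
  refine (HaltsWithin.loop (2 ^ k * numTrees k D σ) (T := (k + 1) * 51 + 32) (fun J s' =>
      s'.wreg 16 = J ∧
      (∀ τ < numTrees k D (σ + 1),
        TreeGood (2 * 2 ^ k) (P + τ * (2 * 2 ^ k)) (Admissible n D k X (σ + 1) τ) s') ∧
      AgreeOutside P (P + S) s s' ∧
      ∀ A t, 1 ≤ t → t ≤ n → A < 2 ^ (k * (σ + 1)) →
        A + 2 ^ (k * (σ + 1)) * cellCode k D (X t) (D - (σ + 1)) < J →
        Served D k X P (σ + 1) A t s') ?_ ?_ ?_).seq (T₂ := 4)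
      (fun s2 F2 ⟨b1, b2, b3, b4⟩ => ?_) (by nlinarith)
  · refine ⟨a4, ?_, ?_, by simp⟩
    · intro τ _ v _ _ h
      rw [ewm1] at h
      exact absurd (hF.fresh _ (by omega)) h
    · intro c _
      rw [ewm1, erm1]; exact ⟨rfl, rfl⟩
  · rintro J hJ s' F' ⟨b1, b2, b3, b4⟩
    have hC' := hC1.of_frame F' rfl
    have e15 : s'.wreg 15 = 2 ^ k * numTrees k D σ := by
      rw [F'.w 15 rfl, F1.w 15 rfl, hF.w15]
    have hR : StageRegs k NB TB σ J s' := by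
      refine ⟨?_, ?_, ?_, ?_, b1⟩
      · rw [F'.w 8 rfl, F1.w 8 rfl, hF.w8]
      · rw [F'.w 9 rfl, F1.w 9 rfl]
      · rw [F'.w 13 rfl, F1.w 13 rfl, hF.w13]
      · rw [F'.w 14 rfl, F1.w 14 rfl, hF.w14]
    refine ⟨by simpa [Test.Holds, b1, e15] using hJ, ?_⟩
    have htop' : top ≤ P := hF.top_le.trans ((Nat.le_add_right _ _).trans hle_free)
    refine (stageBody_spec hσ hnM hC' hX hR (hF.table.of_agree b3 htop') hF.top_le hNB
      (NTB := P) (by rw [F'.w 19 rfl, a1]) hle_free hKM hM hJ ?_ b2).mono le_rfl ?_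
    · intro τ hτ
      refine (hF.good τ hτ).of_agree b3 (.inl ?_)
      have := Nat.mul_le_mul_right (2 * 2 ^ k) (Nat.succ_le_of_lt hτ)
      rw [Nat.succ_mul] at this
      omega
    · rintro s'' - ⟨c1, c2, c3, c4, c5⟩
      refine ⟨c1, c2, b3.trans c3, fun A t ht1 ht2 hA hAJ => ?_⟩
      rcases Nat.lt_succ_iff_lt_or_eq.1 hAJ with hlt | heq
      · exact c4 A t hA (b4 A t ht1 ht2 hA hlt)
      · refine c5 A t ht1 ht2 hA heq ?_
        have hA2 : A / 2 ^ k < 2 ^ (k * σ) := by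
          refine Nat.div_lt_of_lt_mul ?_
          rw [← pow_add]
          convert hA using 2
          ring
        exact (hF.served _ t ht1 ht2 hA2).of_agree hA2 b3 hle_free
  · rintro s' F' ⟨b1, -⟩
    have e15 : s'.wreg 15 = 2 ^ k * numTrees k D σ := by
      rw [F'.w 15 rfl, F1.w 15 rfl, hF.w15]
    simp [Test.Holds, b1, e15]
  · have hC2 := hC1.of_frame F2 rfl
    have e19 : s2.wreg 19 = P := by rw [F2.w 19 rfl, a1]
    have e14 : s2.wreg 14 = 2 ^ (k * (σ + 1)) := by rw [F2.w 14 rfl, F1.w 14 rfl, hF.w14]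
    have e55 : s2.wreg 55 = 2 ^ k * numTrees k D (σ + 1) := by rw [F2.w 55 rfl, a2]
    have e13 : s2.wreg 13 = σ + 1 := by rw [F2.w 13 rfl, F1.w 13 rfl, hF.w13]
    have e6 : s2.wreg 6 = P + S := by rw [F2.w 6 rfl, a3]
    have e8 : s2.wreg 8 = NB := by rw [F2.w 8 rfl, F1.w 8 rfl, hF.w8]
    have hpow : 2 ^ (k * (σ + 1)) * 2 ^ k = 2 ^ (k * (σ + 1 + 1)) := by
      rw [← pow_add]; congr 1
    have hpowM : 2 ^ (k * (σ + 1 + 1)) < M :=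
      (Nat.pow_le_pow_right (by norm_num) (Nat.mul_le_mul_left _ (by omega))).trans_lt hKD
    refine .of_wp_imp (fun Q hQ => ?_) le_rfl
    simp only [Prog.wp, Instr.wp, block, Function.update_of_ne, ne_eq,
        Nat.reduceEqDiff, not_false_eq_true, hC2.w4, hC2.w1, e19, e14, e55, e13, hpow]
    refine ⟨by omega, hpowM, by omega, by omega, hQ _ ⟨⟨?_, ?_, ?_, ?_, ?_, ?_, ?_, ?_, ?_, ?_⟩,
      ?_, ?_⟩⟩
    · simpa using e8
    · simp
    · simp
    · simp
    · simpa using hF.top_le.trans ((Nat.le_add_right _ _).trans hle_free)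
    · simp [e6, hS]
    · intro c hc
      have hc : P + S ≤ c := by simpa [e6] using hc
      exact (b3 c (.inr hc)).1.trans (hF.fresh c (by omega))
    · exact hF.table.of_agree b3 (hF.top_le.trans ((Nat.le_add_right _ _).trans hle_free))
    · exact b2
    · intro A t ht1 ht2 hA
      exact b4 A t ht1 ht2 hA (code_lt_leaves hA)
    · exact fun c hc => b3 c (by simpa [e6] using hc)
    · simp [e6]

/-- Build the forests of all stages after the first one. -/
def stages : Prog := .loop (.wlt 13 17) stage

theorem stages_spec {M n D k NB top : ℕ} {X : ℕ → ℕ → ℝ} {s : State}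
    (hD : 1 ≤ D) (hnM : n < M) (hC : Consts n D k s)
    (hX : ∀ t i, 1 ≤ t → t ≤ n → i ≤ D → |X t i| ≤ 1)
    (hF : ForestReady n D k NB top X 0 s) (hNB : NB + D < M) (hKM : 4 * 2 ^ k ≤ M)
    (hKD : 2 ^ (k * D) < M)
    (hM : s.wreg 6 + (D - 1) * (numTrees k D 0 * (2 * 2 ^ k)) < M) :
    HaltsWithin M stages s
      ((D - 1) * (2 ^ k * numTrees k D 0 * ((k + 1) * 51 + 33) + 10 + 1) + 1) fun s' =>
      ForestReady n D k NB top X (D - 1) s' ∧ AgreeOutside (s.wreg 6) (s'.wreg 6) s s' ∧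
      s.wreg 6 ≤ s'.wreg 6 ∧ s'.wreg 6 ≤ s.wreg 6 + (D - 1) * (numTrees k D 0 * (2 * 2 ^ k)) := by
  refine (HaltsWithin.loop (D - 1)
    (T := 2 ^ k * numTrees k D 0 * ((k + 1) * 51 + 33) + 10) (fun σ s' =>
      ForestReady n D k NB top X σ s' ∧ AgreeOutside (s.wreg 6) (s'.wreg 6) s s' ∧
      s.wreg 6 ≤ s'.wreg 6 ∧
      s'.wreg 6 ≤ s.wreg 6 + σ * (numTrees k D 0 * (2 * 2 ^ k))) ?_ ?_ ?_).mono le_rfl ?_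
  · exact ⟨hF, AgreeOutside.refl _ _ _, le_rfl, by omega⟩
  · rintro σ hσ s' F' ⟨b1, b2, b3, b4⟩
    have hC' := hC.of_frame F' rfl
    refine ⟨by simp [Test.Holds, hC'.w17, b1.w13]; omega, ?_⟩
    have h1 : numTrees k D (σ + 1) * (2 * 2 ^ k) ≤ numTrees k D 0 * (2 * 2 ^ k) :=
      Nat.mul_le_mul_right _ (numTrees_le (by omega))
    have h2 : (σ + 1) * (numTrees k D 0 * (2 * 2 ^ k)) ≤
      (D - 1) * (numTrees k D 0 * (2 * 2 ^ k)) := Nat.mul_le_mul_right _ hσ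
    have h3 : (σ + 1) * (numTrees k D 0 * (2 * 2 ^ k)) = σ * (numTrees k D 0 * (2 * 2 ^ k)) +
      numTrees k D 0 * (2 * 2 ^ k) := Nat.succ_mul _ _
    refine (stage_spec (by omega) hnM hC' hX b1 hNB hKM hKD (by omega)).mono le_rfl ?_
    rintro s'' - ⟨c1, c2, c3⟩
    exact ⟨c1, (b2.mono le_rfl (by omega)).trans (c2.mono b3 le_rfl), by omega, by omega⟩
  · rintro s' F' ⟨b1, -⟩
    have hC' := hC.of_frame F' rfl
    simp [Test.Holds, hC'.w17, b1.w13]; omega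
  · rintro s' - ⟨b1, b2, b3, b4⟩
    exact ⟨b1, b2, b3, b4⟩

/-- Insert point `wreg 16` into the first forest. -/
def firstBody : Prog :=
  block [wmove 21 16] ;; findCode ;;
  block [wmul 45 45 18, wadd 20 9 45, wadd 22 8 13, wmul 47 21 2, wadd 47 8 47, rload 20 47,
    rsub 20 4 20, rmul 20 20 20] ;;
  insertParabola ;; block [wadd 16 16 1]

/-- Build the first forest from the table of the points. -/
def firstForest : Prog :=
  block [wmove 9 6, wmul 56 60 18, wadd 6 6 56, wconst 13 1, wmove 14 4, wmul 15 4 60,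
    wconst 16 1] ;;
  .loop (.wle 16 0) firstBody

theorem firstForest_spec {M n D k NB top : ℕ} {X : ℕ → ℕ → ℝ} {s : State}
    (hD : 1 ≤ D) (hnM : n + 1 < M) (hC : Consts n D k s)
    (hX : ∀ t i, 1 ≤ t → t ≤ n → i ≤ D → |X t i| ≤ 1)
    (h8 : s.wreg 8 = NB) (h60 : s.wreg 60 = numTrees k D 0) (htop : top ≤ s.wreg 6)
    (hfresh : ∀ c, s.wreg 6 ≤ c → s.wmem c = 0) (hT : Table n D NB top X s)
    (hNB : NB + D < M) (hKM : 4 * 2 ^ k ≤ M) (hEM : 2 ^ (2 * k) < M)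
    (hM : s.wreg 6 + numTrees k D 0 * (2 * 2 ^ k) < M) :
    HaltsWithin M firstForest s
      (n * ((D - 1) * (2 * k * 6 + 12 + 1) + (k + 1) * 35 + 19 + 1) + 8) fun s' =>
      ForestReady n D k NB top X 0 s' ∧ AgreeOutside (s.wreg 6) (s'.wreg 6) s s' ∧
      s'.wreg 6 = s.wreg 6 + numTrees k D 0 * (2 * 2 ^ k) := by
  set P := s.wreg 6 with hP
  set S := numTrees k D 0 * (2 * 2 ^ k) with hS
  have hnt : numTrees k D 0 = 2 ^ (2 * k * (D - 1)) := by simp [numTrees]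
  have hLS : 2 ^ k * numTrees k D 0 + 2 ^ k * numTrees k D 0 = S := by rw [hS]; ring
  have hKpos : 0 < 2 ^ k := by positivity
  have hNTle : numTrees k D 0 ≤ 2 ^ k * numTrees k D 0 := Nat.le_mul_of_pos_left _ hKpos
  refine HaltsWithin.seq (T₁ := 7)
    (T₂ := n * ((D - 1) * (2 * k * 6 + 12 + 1) + (k + 1) * 35 + 19 + 1) + 1)
    (Q₁ := fun s' => s'.wreg 9 = P ∧ s'.wreg 6 = P + S ∧ s'.wreg 13 = 1 ∧ s'.wreg 14 = 2 ^ k ∧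
      s'.wreg 15 = 2 ^ k * numTrees k D 0 ∧ s'.wreg 16 = 1)
    (.of_wp_imp (fun Q hQ => ?_) le_rfl) (fun s1 F1 ⟨a1, a2, a3, a4, a5, a6⟩ => ?_) (by omega)
  · simp only [Prog.wp, Instr.wp, block, Function.update_self, Function.update_of_ne, ne_eq,
      Nat.reduceEqDiff, not_false_eq_true, hC.w4, hC.w18, h60, ← hS, ← hP]
    refine ⟨by omega, by omega, by omega, by omega, by omega, by omega, by omega,
      hQ _ (by simp)⟩
  have hC1 := hC.of_frame F1 rfl
  have ewm1 := F1.wm rfl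
  have erm1 := F1.rm rfl
  have e81 : s1.wreg 8 = NB := by rw [F1.w 8 rfl, h8]
  refine (HaltsWithin.loop n (T := (D - 1) * (2 * k * 6 + 12 + 1) + (k + 1) * 35 + 19)
      (fun i s' => s'.wreg 16 = i + 1 ∧
      (∀ τ < numTrees k D 0,
        TreeGood (2 * 2 ^ k) (P + τ * (2 * 2 ^ k)) (Admissible n D k X 0 τ) s') ∧
      AgreeOutside P (P + S) s s' ∧
      ∀ A t, 1 ≤ t → t ≤ i → A < 2 ^ (k * 0) → Served D k X P 0 A t s') ?_ ?_ ?_).mono le_rfl ?_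
  · refine ⟨a6, ?_, ?_, by omega⟩
    · intro τ _ v _ _ h
      rw [ewm1] at h
      exact absurd (hfresh _ (by omega)) h
    · intro c _
      rw [ewm1, erm1]; exact ⟨rfl, rfl⟩
  · rintro i hi s' F' ⟨b1, b2, b3, b4⟩
    have hC' := hC1.of_frame F' rfl
    have hT' := hT.of_agree b3 htop
    have e8 : s'.wreg 8 = NB := by rw [F'.w 8 rfl, e81]
    have e9 : s'.wreg 9 = P := by rw [F'.w 9 rfl, a1]
    have e13 : s'.wreg 13 = 1 := by rw [F'.w 13 rfl, a3]
    have h0 := hT' (i + 1) 0 (by omega) (by omega) (by omega)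
    rw [add_zero] at h0
    have hcode := cellCode_lt k D (X (i + 1)) (D - 1)
    have hcodeS : cellCode k D (X (i + 1)) (D - 1) * (2 * 2 ^ k) + 2 * 2 ^ k ≤ S := by
      rw [← hnt] at hcode
      rw [← Nat.succ_mul]
      exact Nat.mul_le_mul_right _ hcode
    refine ⟨by simp [Test.Holds, hC'.w0, b1]; omega, ?_⟩
    refine HaltsWithin.seq (T₁ := 1)
      (T₂ := (D - 1) * (2 * k * 6 + 12 + 1) + 3 + (8 + ((k + 1) * 35 + 6 + 1)))
      (Q₁ := fun s' => s'.wreg 21 = i + 1)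
      (.of_wp_imp (fun Q hQ => ?_) le_rfl) (fun s2 F2 c1 => ?_) (by omega)
    · simp [Prog.wp, Instr.wp, block, b1]
      exact ⟨by omega, hQ _ (by simp)⟩
    have hC2 := hC'.of_frame F2 rfl
    have e82 : s2.wreg 8 = NB := by rw [F2.w 8 rfl, e8]
    have ewm2 : s2.wmem = s'.wmem := F2.wm rfl
    have erm2 : s2.rmem = s'.rmem := F2.rm rfl
    refine (findCode_spec (x := X (i + 1)) hC2 hD hEM (by omega) ?_ (by omega)).seq
      (fun s3 F3 d1 => ?_) le_rfl
    · intro j hj1 hj2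
      have h := hT' (i + 1) j (by omega) (by omega) hj2
      have e : s2.wreg 21 * (D + 1) + j + s2.wreg 8 = NB + j + (i + 1) * (D + 1) := by
        rw [c1, e82]; ring
      rw [e, erm2]
      exact ⟨by omega, h.2, (abs_le.1 (hX (i + 1) j (by omega) (by omega) hj2)).1⟩
    have hC3 := hC2.of_frame F3 rfl
    have e83 : s3.wreg 8 = NB := by rw [F3.w 8 rfl, e82]
    have e93 : s3.wreg 9 = P := by rw [F3.w 9 rfl, F2.w 9 rfl, e9]
    have e133 : s3.wreg 13 = 1 := by rw [F3.w 13 rfl, F2.w 13 rfl, e13]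
    have e213 : s3.wreg 21 = i + 1 := by rw [F3.w 21 rfl, c1]
    have ewm3 : s3.wmem = s'.wmem := by rw [F3.wm rfl, ewm2]
    have erm3 : s3.rmem = s'.rmem := by rw [F3.rm rfl, erm2]
    refine HaltsWithin.seq (T₁ := 8) (T₂ := (k + 1) * 35 + 6 + 1)
      (Q₁ := fun s' => s'.wreg 20 = P + cellCode k D (X (i + 1)) (D - 1) * (2 * 2 ^ k) ∧
        s'.wreg 22 = NB + 1 ∧ s'.wreg 21 = i + 1 ∧ s'.rreg 20 = (2 - X (i + 1) 0) ^ 2)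
      (.of_wp_imp (fun Q hQ => ?_) le_rfl) (fun s4 F4 ⟨f1, f2, f3, f4⟩ => ?_) (by omega)
    · simp only [Prog.wp, Instr.wp, block, Function.update_self, Function.update_of_ne, ne_eq,
        Nat.reduceEqDiff, not_false_eq_true, hC3.w18, hC3.w2, hC3.r4, e83, e93, e133, e213, d1,
        erm3, h0.2]
      refine ⟨by omega, by omega, by omega, by omega, by omega, by omega,
        hQ _ (by simp [e213, sq])⟩
    have hC4 := hC3.of_frame F4 rfl
    have ewm4 : s4.wmem = s'.wmem := by rw [F4.wm rfl, ewm3]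
    have erm4 : s4.rmem = s'.rmem := by rw [F4.rm rfl, erm3]
    refine (forestInsert_spec (TB := P) (NT := numTrees k D 0)
        (τ := cellCode k D (X (i + 1)) (D - 1))
        (XB := NB + 1) (x := fun t => X t 1) (G := Admissible n D k X 0)
        (fun _ _ _ h => h.1) (by omega) hC4 (by rw [hnt]; exact hcode) f1 hM hKM f2 ?_ ?_ ?_).seq
        (T₂ := 1) (fun s5 F5 ⟨g1, g2, g3, g4⟩ => ?_) le_rfl
    · intro t h1 h2
      rw [erm4]
      exact hT'.column htop (by omega) t h1 h2
    · refine ⟨by rw [f3]; omega, ?_, ?_⟩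
      · simp [f3]
      · rw [f4, f3, netCost]
    · intro τ hτ v
      rw [ewm4, erm4]
      exact b2 τ hτ v
    · refine .of_wp_imp (fun Q hQ => ?_) le_rfl
      have e165 : s5.wreg 16 = i + 1 := by
        rw [F5.w 16 rfl, F4.w 16 rfl, F3.w 16 rfl, F2.w 16 rfl, b1]
      rw [ewm4, erm4] at g3
      simp only [Prog.wp, Instr.wp, block, e165, (hC4.of_frame F5 rfl).w1]
      refine ⟨by omega, hQ _ ⟨by simp, g1, ?_, ?_⟩⟩
      · refine b3.trans fun c hc => ?_
        have := g2 c hc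
        rwa [ewm4, erm4] at this
      · intro A t ht1 ht2 hA a ha1 ha2
        have hA0 : A = 0 := by simpa using hA
        subst hA0
        rcases Nat.lt_succ_iff_lt_or_eq.1 (Nat.lt_succ_of_le ht2) with hlt | rfl
        · have hcode' := cellCode_lt k D (X t) (D - 1)
          refine g3 _ ?_ a _ ha1 ha2 (b4 0 t ht1 (by omega) hA a ha1 ha2)
          rw [hnt]; simpa using hcode'
        · have := g4 a ha1 ha2
          rw [f4, f3] at this
          simpa [netCost] using this
  · rintro s' F' ⟨b1, -⟩
    have hC' := hC1.of_frame F' rfl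
    simp [Test.Holds, hC'.w0, b1]
  · rintro s' F' ⟨-, b2, b3, b4⟩
    have e9 : s'.wreg 9 = P := by rw [F'.w 9 rfl, a1]
    have e6 : s'.wreg 6 = P + S := by rw [F'.w 6 rfl, a2]
    refine ⟨⟨?_, ?_, ?_, ?_, ?_, ?_, ?_, hT.of_agree b3 htop, ?_, ?_⟩, ?_, e6⟩
    · rw [F'.w 8 rfl, e81]
    · rw [F'.w 13 rfl, a3]
    · rw [F'.w 14 rfl, a4]; simp
    · rw [F'.w 15 rfl, a5]
    · rw [e9]; exact htop
    · rw [e9, e6]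
    · rw [e6]; exact fun c hc => (b3 c (.inr hc)).1.trans (hfresh c (by omega))
    · rw [e9]; exact b2
    · rw [e9]; exact b4
    · rw [e6]; exact b3

/-! ### The list of the selected points -/

/-- The list of the selected points, at the addresses `1, …, |S|` in the word memory, together
with the marks of the selected points, at the addresses `n + 1, …, 2 n`. -/
structure Listed (n : ℕ) (S : Finset ℕ) (s : State) : Prop where
  w7 : s.wreg 7 = S.card
  subset : S ⊆ Finset.Icc 1 n
  marks : ∀ t, 1 ≤ t → t ≤ n → s.wmem (n + t) = if t ∈ S then 1 else 0
  mem : ∀ i, 1 ≤ i → i ≤ S.card → s.wmem i ∈ S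
  surj : ∀ t ∈ S, ∃ i, 1 ≤ i ∧ i ≤ S.card ∧ s.wmem i = t

theorem Listed.card_le {n : ℕ} {S : Finset ℕ} {s : State} (h : Listed n S s) : S.card ≤ n := by
  simpa using Finset.card_le_card h.subset

theorem Listed.of_agree {n lo hi : ℕ} {S : Finset ℕ} {s s' : State} (h : Listed n S s)
    (h7 : s'.wreg 7 = s.wreg 7) (hA : AgreeOutside lo hi s s') (hlo : 2 * n < lo) :
    Listed n S s' := by
  have hc := h.card_le
  refine ⟨h7.trans h.w7, h.subset, fun t h1 h2 => ?_, fun i h1 h2 => ?_, fun t ht => ?_⟩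
  · rw [(hA _ (by omega)).1, h.marks t h1 h2]
  · rw [(hA _ (by omega)).1]; exact h.mem i h1 h2
  · obtain ⟨i, h1, h2, h3⟩ := h.surj t ht
    exact ⟨i, h1, h2, by rw [(hA _ (by omega)).1, h3]⟩

/-- Append point `wreg 31` to the list, unless its mark shows that it has been selected before. -/
def select : Prog :=
  block [wadd 53 0 31, wload 54 53] ;;
  .ite (.wlt 54 1) (block [wstore 53 1, wadd 7 7 1, wstore 7 31]) .skip

theorem select_spec {M n D k t : ℕ} {S : Finset ℕ} {s : State} (hC : Consts n D k s)
    (hM : 2 * n + 1 < M) (ht : s.wreg 31 = t) (ht₁ : 1 ≤ t) (ht₂ : t ≤ n) (hL : Listed n S s) :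
    HaltsWithin M select s 6 fun s' =>
      Listed n (insert t S) s' ∧ (∀ c, 2 * n < c → s'.wmem c = s.wmem c) := by
  have hc := hL.card_le
  have hmark := hL.marks t ht₁ ht₂
  by_cases hts : t ∈ S
  · rw [if_pos hts] at hmark
    refine .of_wp_imp (fun Q hQ => ?_) le_rfl
    simp [select, Prog.wp, Instr.wp, block, Test.Holds, hC.w0, hC.w1, ht, hmark]
    refine ⟨by omega, by omega, hQ _ ?_⟩
    rw [Finset.insert_eq_of_mem hts]
    exact ⟨⟨hL.w7, hL.subset, hL.marks, hL.mem, hL.surj⟩, fun _ _ => rfl⟩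
  · rw [if_neg hts] at hmark
    have hcard : (insert t S).card = S.card + 1 := Finset.card_insert_of_notMem hts
    have hsub : insert t S ⊆ Finset.Icc 1 n :=
      Finset.insert_subset (Finset.mem_Icc.2 ⟨ht₁, ht₂⟩) hL.subset
    have hcard' : S.card + 1 ≤ n := by
      rw [← hcard]; simpa using Finset.card_le_card hsub
    refine .of_wp_imp (fun Q hQ => ?_) le_rfl
    simp [select, Prog.wp, Instr.wp, block, Test.Holds, hC.w0, hC.w1, ht, hmark, hL.w7]
    refine ⟨by omega, by omega, by omega, by omega, by omega, by omega,
      hQ _ ⟨⟨?_, hsub, ?_, ?_, ?_⟩, ?_⟩⟩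
    · simp [hcard]
    · intro u hu1 hu2
      have h1 : n + u ≠ S.card + 1 := by omega
      simp only [Function.update_of_ne h1]
      by_cases hut : u = t
      · subst hut; simp
      · have h2 : n + u ≠ n + t := by omega
        rw [Function.update_of_ne h2, hL.marks u hu1 hu2]
        simp [hut]
    · intro i hi1 hi2
      rw [hcard] at hi2
      by_cases hi : i = S.card + 1
      · simp [hi]
      · have h2 : i ≠ n + t := by omega
        simp only [Function.update_of_ne hi, Function.update_of_ne h2]
        exact Finset.mem_insert_of_mem (hL.mem i hi1 (by omega))
    · intro u hu
      rw [hcard]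
      rcases Finset.mem_insert.1 hu with rfl | hu
      · exact ⟨S.card + 1, by omega, le_rfl, by simp⟩
      · obtain ⟨i, h1, h2, h3⟩ := hL.surj u hu
        have h4 : i ≠ S.card + 1 := by omega
        have h5 : i ≠ n + t := by omega
        exact ⟨i, h1, by omega, by simp [Function.update_of_ne h4, Function.update_of_ne h5, h3]⟩
    · intro c hc
      have h4 : c ≠ S.card + 1 := by omega
      have h5 : c ≠ n + t := by omega
      simp only [Function.update_of_ne h4, Function.update_of_ne h5]

/-- Select the point found by one query in the last forest. -/
def finalBody : Prog :=
  stageQuery ;; .ite (.wle 1 31) select .skip ;; block [wadd 16 16 1]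

/-- Select, for every point of the net, a point that is almost nearest to it. -/
def finalLoop : Prog := block [wconst 16 0] ;; .loop (.wlt 16 15) finalBody

/-- The points of `S` include, for every point of the net, one that is almost nearest to it. -/
def Selects (n D k : ℕ) (X : ℕ → ℕ → ℝ) (S : Finset ℕ) : Prop :=
  ∀ A < 2 ^ (k * D), ∃ e ∈ S, ∀ t, 1 ≤ t → t ≤ n →
    netCost k X D A e ≤ netCost k X D A t + (D - 1 : ℕ) * (20 / 2 ^ (2 * k))

/-- In stage `D - 1` there are no coordinates left to round, so all points compete for each net
point. -/
theorem finalLoop_spec {M n D k NB top : ℕ} {X : ℕ → ℕ → ℝ} {S : Finset ℕ} {s : State}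
    (hn : 1 ≤ n) (hD : 1 ≤ D) (hnM : 2 * n + 1 < M) (hC : Consts n D k s)
    (hF : ForestReady n D k NB top X (D - 1) s) (hNB : NB + D < M)
    (hM : s.wreg 6 < M) (htop : 2 * n < top) (hL : Listed n S s) :
    HaltsWithin M finalLoop s (2 ^ (k * D) * ((k + 1) * 16 + 21 + 1) + 2) fun s' =>
      ∃ S', S ⊆ S' ∧ S'.card ≤ S.card + 2 ^ (k * D) ∧ Listed n S' s' ∧ Selects n D k X S' ∧
        ∀ c, 2 * n < c → s'.wmem c = s.wmem c := by
  obtain ⟨σ, rfl⟩ : ∃ σ, D = σ + 1 := ⟨D - 1, by omega⟩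
  rw [Nat.add_sub_cancel] at hF
  have hL15 : 2 ^ k * numTrees k (σ + 1) σ = 2 ^ (k * (σ + 1)) := by
    simp only [numTrees, Nat.sub_self, mul_zero, pow_zero, mul_one]
    rw [← pow_add]; congr 1; ring
  have hsize : numTrees k (σ + 1) σ * (2 * 2 ^ k) = 2 * 2 ^ (k * (σ + 1)) := by
    rw [← hL15]; ring
  have hle := hF.le_free
  have hkpos : 0 < 2 ^ (k * (σ + 1)) := by positivity
  refine HaltsWithin.seq (T₁ := 1) (T₂ := 2 ^ (k * (σ + 1)) * ((k + 1) * 16 + 21 + 1) + 1)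
    (Q₁ := fun s' => s'.wreg 16 = 0)
    (.of_wp_imp (fun Q hQ => ?_) le_rfl) (fun s1 F1 a1 => ?_) (by omega)
  · simp only [Prog.wp, Instr.wp, block]
    exact ⟨by omega, hQ _ (by simp)⟩
  have hC1 := hC.of_frame F1 rfl
  have ewm1 := F1.wm rfl
  refine (HaltsWithin.loop (2 ^ (k * (σ + 1))) (T := (k + 1) * 16 + 21)
      (fun J s' => s'.wreg 16 = J ∧ (∀ c, 2 * n < c → s'.wmem c = s.wmem c) ∧
      ∃ S', S ⊆ S' ∧ S'.card ≤ S.card + J ∧ Listed n S' s' ∧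
        ∀ A < J, ∃ e ∈ S', ∀ t, 1 ≤ t → t ≤ n → netCost k X (σ + 1) A e ≤
          netCost k X (σ + 1) A t + σ * (20 / 2 ^ (2 * k))) ?_ ?_ ?_).mono le_rfl ?_
  · refine ⟨a1, fun c _ => by rw [ewm1], S, Finset.Subset.refl _, le_rfl, ?_, by simp⟩
    refine ⟨?_, hL.subset, ?_, ?_, ?_⟩
    · rw [F1.w 7 rfl, hL.w7]
    · rw [ewm1]; exact hL.marks
    · rw [ewm1]; exact hL.mem
    · rw [ewm1]; exact hL.surj
  · rintro J hJ s' F' ⟨b1, b2, S', b3, b4, b5, b6⟩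
    have hC' := hC1.of_frame F' rfl
    have e15 : s'.wreg 15 = 2 ^ (k * (σ + 1)) := by
      rw [F'.w 15 rfl, F1.w 15 rfl, hF.w15, hL15]
    have erm : s'.rmem = s.rmem := by rw [F'.rm rfl, F1.rm rfl]
    have hag : ∀ c, 2 * n < c → s'.wmem c = s.wmem c ∧ s'.rmem c = s.rmem c :=
      fun c hc => ⟨b2 c hc, by rw [erm]⟩
    have htop' := hF.top_le
    have hR : StageRegs k NB (s.wreg 9) σ J s' := by
      refine ⟨?_, ?_, ?_, ?_, b1⟩
      · rw [F'.w 8 rfl, F1.w 8 rfl, hF.w8]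
      · rw [F'.w 9 rfl, F1.w 9 rfl]
      · rw [F'.w 13 rfl, F1.w 13 rfl, hF.w13]
      · rw [F'.w 14 rfl, F1.w 14 rfl, hF.w14]
    refine ⟨by simpa [Test.Holds, b1, e15] using hJ, ?_⟩
    refine (stageQuery_spec (NT := numTrees k (σ + 1) σ) (X := X) (top := top) le_rfl (by omega)
      hC' hR ?_ htop' hNB (by omega) (by rw [hL15]; exact hJ) ?_).seq (T₂ := 8)
      (fun s2 F2 ⟨_, c2, c3⟩ => ?_) (by omega)
    · intro t i h1 h2 h3
      rw [erm]
      exact hF.table t i h1 h2 h3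
    · intro τ hτ v
      rw [(hag _ (by omega)).1, erm]
      exact hF.good τ hτ v
    have hC2 := hC'.of_frame F2 rfl
    have ewm2 : s2.wmem = s'.wmem := F2.wm rfl
    have e162 : s2.wreg 16 = J := by rw [F2.w 16 rfl, b1]
    have hL2 : Listed n S' s2 := by
      refine ⟨?_, b5.subset, ?_, ?_, ?_⟩
      · rw [F2.w 7 rfl, b5.w7]
      · rw [ewm2]; exact b5.marks
      · rw [ewm2]; exact b5.mem
      · rw [ewm2]; exact b5.surj
    have hserved : ∀ t, 1 ≤ t → t ≤ n → s2.wreg 31 ≠ 0 ∧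
        s2.rreg 30 ≤ netCost k X (σ + 1) J t + σ * (20 / 2 ^ (2 * k)) := by
      intro t h1 h2
      refine c3 J t (by simp [cellCode]) hJ ?_
      have hJ2 : J / 2 ^ k < 2 ^ (k * σ) := by
        refine Nat.div_lt_of_lt_mul ?_
        rw [← pow_add]
        convert hJ using 2
        ring
      intro a ha1 ha2
      refine (hF.served _ t h1 h2 hJ2 a ha1 ha2).congr (N := 2 * 2 ^ k)
        (by rw [← pow_succ']; exact ha2) (fun c h1 h2 => ?_) (fun c h1 h2 => by rw [erm])
      exact b2 c (by omega)
    have hne := (hserved 1 le_rfl hn).1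
    obtain ⟨d1, d2, d3⟩ := c2 hne
    rw [Nat.mod_eq_of_lt hJ] at d3
    refine HaltsWithin.seq (T₁ := 6 + 1) (T₂ := 1)
      (Q₁ := fun s3 => Listed n (insert (s2.wreg 31) S') s3 ∧
        (∀ c, 2 * n < c → s3.wmem c = s2.wmem c))
      (.ite (fun hb => ?_) (fun hb => ?_)) (fun s3 F3 hs3 => ?_) le_rfl
    · exact select_spec hC2 hnM rfl d1.1 d1.2 hL2
    · simp only [Test.Holds, hC2.w1] at hb
      omega
    · refine .of_wp_imp (fun Q hQ => ?_) le_rfl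
      have e16 : s3.wreg 16 = J := by rw [F3.w 16 rfl, e162]
      have hLJ : 2 ^ (k * (σ + 1)) < M := by omega
      simp only [Prog.wp, Instr.wp, block, e16, (hC2.of_frame F3 rfl).w1]
      refine ⟨by omega, hQ _ ⟨by simp, fun c hc => ?_, insert (s2.wreg 31) S',
        b3.trans (Finset.subset_insert _ _), ?_, ?_, ?_⟩⟩
      · show s3.wmem c = s.wmem c
        rw [hs3.2 c hc, ewm2, b2 c hc]
      · have := Finset.card_insert_le (s2.wreg 31) S'
        omega
      · exact ⟨hs3.1.w7, hs3.1.subset, hs3.1.marks, hs3.1.mem, hs3.1.surj⟩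
      · intro A hA
        rcases Nat.lt_succ_iff_lt_or_eq.1 hA with hlt | rfl
        · obtain ⟨e, he, h⟩ := b6 A hlt
          exact ⟨e, Finset.mem_insert_of_mem he, h⟩
        · refine ⟨_, Finset.mem_insert_self _ _, fun t h1 h2 => ?_⟩
          rw [← d3]
          exact (hserved t h1 h2).2
  · rintro s' F' ⟨b1, -⟩
    have e15 : s'.wreg 15 = 2 ^ (k * (σ + 1)) := by
      rw [F'.w 15 rfl, F1.w 15 rfl, hF.w15, hL15]
    simp [Test.Holds, b1, e15]
  · rintro s' - ⟨-, b2, S', b3, b4, b5, b6⟩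
    exact ⟨S', b3, b4, b5, b6, b2⟩

/-! ### The facets of the cube of directions -/

/-- Coordinate `j` of point `e`, moved and scaled so that the heaviest point `c` becomes the origin:
`inp e 0, …, inp e (D - 1)` are the coordinates of the point and `inp e D` is its weight. -/
noncomputable def normCoord (D c : ℕ) (inp : ℕ → ℕ → ℝ) (W R : ℝ) (e j : ℕ) : ℝ :=
  if j < D then (inp e j - inp c j) * inp e D / R else inp e D / W

/-- The coordinates for facet `f < 2 (D + 1)` of the cube `[-1, 1] ^ (D + 1)`: coordinate `f`
modulo `D + 1` comes first, and the signs are changed in the second half of the facets. -/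
noncomputable def facetCoord (D c : ℕ) (inp : ℕ → ℕ → ℝ) (W R : ℝ) (f t i : ℕ) : ℝ :=
  normCoord D c inp W R (t - 1) ((i + f) % (D + 1)) * if f < D + 1 then 1 else -1

/-- Write one entry of the table of coordinates. -/
def fillBody : Prog :=
  block [wdiv 64 62 2, wmul 64 64 2, wsub 65 62 64, wadd 65 65 67] ;;
  .ite (.wle 2 65) (block [wsub 65 65 2]) .skip ;;
  block [wadd 66 64 17, rload 50 66] ;;
  .ite (.wlt 65 17)
    (block [wadd 66 64 65, rload 51 66, wadd 66 10 65, rload 52 66, rsub 51 51 52, rmul 51 51 50,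
      rdiv 51 51 2])
    (block [rdiv 51 50 1]) ;;
  block [rmul 51 51 9, wadd 66 8 2, wadd 66 66 62, rstore 66 51, wadd 62 62 1]

/-- The input, in rows of length `d`. -/
def Input (n d : ℕ) (inp : ℕ → ℕ → ℝ) (s : State) : Prop :=
  ∀ e j, e < n → j < d → s.rmem (e * d + j) = inp e j

theorem row_lt {e n d j : ℕ} (he : e < n) (hj : j < d) : e * d + j < n * d := by
  have := Nat.mul_le_mul_right d (Nat.succ_le_of_lt he)
  rw [Nat.succ_mul] at this
  omega

theorem fillBody_spec {M n D k c f NB I : ℕ} {inp : ℕ → ℕ → ℝ} {W R : ℝ} {s : State}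
    (hC : Consts n D k s) (hc : c < n) (h10 : s.wreg 10 = c * (D + 1)) (hW : s.rreg 1 = W)
    (hR : s.rreg 2 = R) (hW0 : W ≠ 0) (hR0 : R ≠ 0)
    (h67 : s.wreg 67 = f % (D + 1)) (h9 : s.rreg 9 = if f < D + 1 then 1 else -1)
    (h8 : s.wreg 8 = NB) (h62 : s.wreg 62 = I) (hI : I < n * (D + 1))
    (hin : Input n (D + 1) inp s) (hnNB : n * (D + 1) ≤ NB) (hM : NB + (n + 1) * (D + 1) < M) :
    HaltsWithin M fillBody s 21 fun s' => s'.wreg 62 = I + 1 ∧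
      s'.rmem = Function.update s.rmem (NB + (D + 1) + I)
        (facetCoord D c inp W R f (I / (D + 1) + 1) (I % (D + 1))) := by
  set e := I / (D + 1) with he
  set i := I % (D + 1) with hi
  have hdm : e * (D + 1) + i = I := Nat.div_add_mod' _ _
  have hen : e < n := Nat.div_lt_of_lt_mul (by rwa [mul_comm] at hI)
  have hid : i < D + 1 := Nat.mod_lt _ (by omega)
  have hrow := fun j (hj : j < D + 1) => row_lt hen hj
  have hrowc := fun j (hj : j < D + 1) => row_lt hc hj
  have hD := hrow D (by omega)
  have hsub : I - e * (D + 1) = i := by omega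
  have hMe : (n + 1) * (D + 1) = n * (D + 1) + (D + 1) := Nat.succ_mul _ _
  have hele : e ≤ I := Nat.div_le_self _ _
  have hfm : f % (D + 1) < D + 1 := Nat.mod_lt _ (by omega)
  have hwrap : (i + f) % (D + 1) =
      if D + 1 ≤ i + f % (D + 1) then i + f % (D + 1) - (D + 1) else i + f % (D + 1) := by
    rw [Nat.add_mod_eq_ite, Nat.mod_eq_of_lt hid]
  have hmlt : (i + f) % (D + 1) < D + 1 := Nat.mod_lt _ (by omega)
  have main : facetCoord D c inp W R f (e + 1) i =
    (if (i + f) % (D + 1) < D then (inp e ((i + f) % (D + 1)) - inp c ((i + f) % (D + 1))) *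
      inp e D / R else inp e D / W) * s.rreg 9 := by
    rw [facetCoord, normCoord, h9]; rfl
  rw [main]
  refine HaltsWithin.seq (T₁ := 4) (T₂ := 17)
    (Q₁ := fun s' => s'.wreg 64 = e * (D + 1) ∧ s'.wreg 65 = i + f % (D + 1))
    (.of_wp_imp (fun Q hQ => ?_) le_rfl) (fun s1 F1 ⟨a1, a2⟩ => ?_) le_rfl
  · simp only [Prog.wp, Instr.wp, block, Function.update_self, Function.update_of_ne, ne_eq,
      Nat.reduceEqDiff, not_false_eq_true, hC.w2, h62, h67, ← he, hsub]
    exact ⟨trivial, by omega, by omega, by omega, by omega, hQ _ (by simp)⟩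
  have hC1 := hC.of_frame F1 rfl
  refine HaltsWithin.seq (T₁ := 2) (T₂ := 15)
    (Q₁ := fun s' => s'.wreg 65 = (i + f) % (D + 1))
    (.of_wp_imp (fun Q hQ => ?_) le_rfl) (fun s2 F2 b1 => ?_) le_rfl
  · simp only [Prog.wp, Instr.wp, block, Test.Holds, hC1.w2, a2]
    refine ⟨fun h => ⟨by omega, hQ _ ?_⟩, fun h => hQ _ ?_⟩
    · simp [hwrap, h]
    · simp only [hwrap, h, if_false, a2]
  have hC2 := hC1.of_frame F2 rfl
  have e64 : s2.wreg 64 = e * (D + 1) := by rw [F2.w 64 rfl, a1]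
  have erm2 : s2.rmem = s.rmem := by rw [F2.rm rfl, F1.rm rfl]
  refine HaltsWithin.seq (T₁ := 2) (T₂ := 13)
    (Q₁ := fun s' => s'.rreg 50 = inp e D)
    (.of_wp_imp (fun Q hQ => ?_) le_rfl) (fun s3 F3 c1 => ?_) le_rfl
  · simp only [Prog.wp, Instr.wp, block, Function.update_self, hC2.w17, e64, erm2,
      hin e D hen (by omega)]
    refine ⟨by omega, by omega, hQ _ (by simp)⟩
  have hC3 := hC2.of_frame F3 rfl
  have e643 : s3.wreg 64 = e * (D + 1) := by rw [F3.w 64 rfl, e64]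
  have e653 : s3.wreg 65 = (i + f) % (D + 1) := by rw [F3.w 65 rfl, b1]
  have e103 : s3.wreg 10 = c * (D + 1) := by rw [F3.w 10 rfl, F2.w 10 rfl, F1.w 10 rfl, h10]
  have r13 : s3.rreg 1 = W := by rw [F3.r 1 rfl, F2.r 1 rfl, F1.r 1 rfl, hW]
  have r23 : s3.rreg 2 = R := by rw [F3.r 2 rfl, F2.r 2 rfl, F1.r 2 rfl, hR]
  have erm3 : s3.rmem = s.rmem := by rw [F3.rm rfl, erm2]
  have h1 := hrow _ hmlt
  have h2 := hrowc _ hmlt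
  refine HaltsWithin.seq (T₁ := 8) (T₂ := 5)
    (Q₁ := fun s' => s'.rreg 51 = if (i + f) % (D + 1) < D then
      (inp e ((i + f) % (D + 1)) - inp c ((i + f) % (D + 1))) * inp e D / R else inp e D / W)
    (.of_wp_imp (fun Q hQ => ?_) le_rfl) (fun s4 F4 d1 => ?_) le_rfl
  · simp only [Prog.wp, Instr.wp, block, Test.Holds, Function.update_self, Function.update_of_ne,
      ne_eq, Nat.reduceEqDiff, not_false_eq_true, hC3.w17, e643, e653, e103, erm3, c1, r13, r23,
      hin e _ hen hmlt, hin c _ hc hmlt]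
    refine ⟨fun h => ⟨by omega, by omega, by omega, by omega, hR0, hQ _ ?_⟩,
      fun h => ⟨hW0, hQ _ ?_⟩⟩
    · simp [h]
    · simp [h]
  have hC4 := hC3.of_frame F4 rfl
  have e84 : s4.wreg 8 = NB := by rw [F4.w 8 rfl, F3.w 8 rfl, F2.w 8 rfl, F1.w 8 rfl, h8]
  have e624 : s4.wreg 62 = I := by rw [F4.w 62 rfl, F3.w 62 rfl, F2.w 62 rfl, F1.w 62 rfl, h62]
  have r94 : s4.rreg 9 = s.rreg 9 := by rw [F4.r 9 rfl, F3.r 9 rfl, F2.r 9 rfl, F1.r 9 rfl]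
  have erm4 : s4.rmem = s.rmem := by rw [F4.rm rfl, erm3]
  refine .of_wp_imp (fun Q hQ => ?_) le_rfl
  simp only [Prog.wp, Instr.wp, block, Function.update_self, Function.update_of_ne,
      ne_eq, Nat.reduceEqDiff, not_false_eq_true, hC4.w2, hC4.w1, e84, e624, r94, erm4, d1]
  exact ⟨by omega, by omega, by omega, by omega, hQ _ ⟨by simp, by simp⟩⟩

/-- Write the table of coordinates for facet `wreg 11`. -/
def fillTable : Prog :=
  block [wmove 8 6, wadd 61 0 1, wmul 61 61 2, wadd 6 6 61, wconst 62 0, wmul 63 0 2] ;;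
  .ite (.wlt 11 2) (block [wmove 67 11, rmove 9 8]) (block [wsub 67 11 2, rsub 9 3 8]) ;;
  .loop (.wlt 62 63) fillBody

theorem fillTable_spec {M n D k c f : ℕ} {inp : ℕ → ℕ → ℝ} {W R : ℝ} {s : State}
    (hC : Consts n D k s) (hc : c < n) (h10 : s.wreg 10 = c * (D + 1)) (hW : s.rreg 1 = W)
    (hR : s.rreg 2 = R) (hW0 : W ≠ 0) (hR0 : R ≠ 0) (hf : f < 2 * (D + 1))
    (h11 : s.wreg 11 = f)
    (hin : Input n (D + 1) inp s) (hnP : n * (D + 1) ≤ s.wreg 6)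
    (hM : s.wreg 6 + (n + 1) * (D + 1) < M) (hfM : 2 * (D + 1) ≤ M) :
    HaltsWithin M fillTable s (n * (D + 1) * 22 + 10) fun s' =>
      s'.wreg 8 = s.wreg 6 ∧ s'.wreg 6 = s.wreg 6 + (n + 1) * (D + 1) ∧
      Table n D (s.wreg 6) (s'.wreg 6) (facetCoord D c inp W R f) s' ∧
      s'.wmem = s.wmem ∧ ∀ a, a < s.wreg 6 → s'.rmem a = s.rmem a := by
  set P := s.wreg 6 with hP
  have hMe : (n + 1) * (D + 1) = n * (D + 1) + (D + 1) := Nat.succ_mul _ _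
  have hnle : n ≤ n * (D + 1) := Nat.le_mul_of_pos_right _ (by omega)
  refine HaltsWithin.seq (T₁ := 6) (T₂ := n * (D + 1) * 22 + 4)
    (Q₁ := fun s' => s'.wreg 8 = P ∧ s'.wreg 6 = P + (n + 1) * (D + 1) ∧ s'.wreg 62 = 0 ∧
      s'.wreg 63 = n * (D + 1))
    (.of_wp_imp (fun Q hQ => ?_) le_rfl) (fun s1 F1 ⟨a1, a2, a3, a4⟩ => ?_) (by omega)
  · simp only [Prog.wp, Instr.wp, block, Function.update_self, Function.update_of_ne, ne_eq,
      Nat.reduceEqDiff, not_false_eq_true, hC.w0, hC.w1, hC.w2, ← hP]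
    exact ⟨by omega, by omega, by omega, by omega, by omega, by omega, hQ _ (by simp)⟩
  have hC1 := hC.of_frame F1 rfl
  have e11 : s1.wreg 11 = f := by rw [F1.w 11 rfl, h11]
  refine HaltsWithin.seq (T₁ := 3) (T₂ := n * (D + 1) * (21 + 1) + 1)
    (Q₁ := fun s' => s'.wreg 67 = f % (D + 1) ∧ s'.rreg 9 = if f < D + 1 then 1 else -1)
    (.of_wp_imp (fun Q hQ => ?_) le_rfl) (fun s2 F2 ⟨b1, b2⟩ => ?_) (by omega)
  · simp only [Prog.wp, Instr.wp, block, Test.Holds, hC1.w2, hC1.r3, hC1.r8, e11]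
    refine ⟨fun h => ⟨by omega, hQ _ ?_⟩, fun h => ⟨by omega, hQ _ ?_⟩⟩
    · simp [h, Nat.mod_eq_of_lt h]
    · have : f % (D + 1) = f - (D + 1) := by
        rw [Nat.mod_eq_sub_mod (by omega), Nat.mod_eq_of_lt (by omega)]
      simp [h, this]
  have hC2 := hC1.of_frame F2 rfl
  have erm2 : s2.rmem = s.rmem := by rw [F2.rm rfl, F1.rm rfl]
  refine (HaltsWithin.loop (n * (D + 1)) (T := 21) (fun I s' => s'.wreg 62 = I ∧
    (∀ a, a < P → s'.rmem a = s.rmem a) ∧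
    ∀ I' < I, s'.rmem (P + (D + 1) + I') =
      facetCoord D c inp W R f (I' / (D + 1) + 1) (I' % (D + 1))) ?_ ?_ ?_).mono le_rfl ?_
  · refine ⟨by rw [F2.w 62 rfl, a3], fun a _ => by rw [erm2], by simp⟩
  · rintro I hI s' F' ⟨c1, c2, c3⟩
    have hC' := hC2.of_frame F' rfl
    refine ⟨?_, (fillBody_spec (c := c) (f := f) (NB := P) (inp := inp) (W := W) (R := R) hC' hc
      ?_ ?_ ?_ hW0 hR0 ?_ ?_ ?_ c1 hI ?_ hnP hM).mono le_rfl ?_⟩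
    · simp only [Test.Holds, c1, F'.w 63 rfl, F2.w 63 rfl, a4]
      exact hI
    · rw [F'.w 10 rfl, F2.w 10 rfl, F1.w 10 rfl, h10]
    · rw [F'.r 1 rfl, F2.r 1 rfl, F1.r 1 rfl, hW]
    · rw [F'.r 2 rfl, F2.r 2 rfl, F1.r 2 rfl, hR]
    · rw [F'.w 67 rfl, b1]
    · rw [F'.r 9 rfl, b2]
    · rw [F'.w 8 rfl, F2.w 8 rfl, a1]
    · intro e j he hj
      rw [c2 _ ((row_lt he hj).trans_le hnP)]
      exact hin e j he hj
    · rintro s'' - ⟨d1, d2⟩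
      refine ⟨d1, fun a ha => ?_, fun I' hI' => ?_⟩
      · rw [d2, Function.update_of_ne (by omega), c2 a ha]
      · rw [d2]
        rcases Nat.lt_succ_iff_lt_or_eq.1 hI' with hlt | rfl
        · rw [Function.update_of_ne (by omega), c3 I' hlt]
        · rw [Function.update_self]
  · rintro s' F' ⟨c1, -⟩
    simp [Test.Holds, c1, F'.w 63 rfl, F2.w 63 rfl, a4]
  · rintro s' F' ⟨c1, c2, c3⟩
    have e6 : s'.wreg 6 = P + (n + 1) * (D + 1) := by rw [F'.w 6 rfl, F2.w 6 rfl, a2]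
    refine ⟨by rw [F'.w 8 rfl, F2.w 8 rfl, a1], e6, ?_,
      by rw [F'.wm rfl, F2.wm rfl, F1.wm rfl], c2⟩
    intro t i ht1 ht2 hi
    obtain ⟨e, rfl⟩ : ∃ e, t = e + 1 := ⟨t - 1, by omega⟩
    have h1 : e * (D + 1) + i < n * (D + 1) := row_lt (by omega) (by omega)
    have h2 : P + i + (e + 1) * (D + 1) = P + (D + 1) + (e * (D + 1) + i) := by ring
    rw [h2, e6]
    refine ⟨by omega, ?_⟩
    rw [c3 _ h1]
    congr 1
    · rw [mul_comm, Nat.mul_add_div (by omega), Nat.div_eq_of_lt (Nat.lt_succ_of_le hi), add_zero]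
    · rw [mul_comm, Nat.mul_add_mod, Nat.mod_eq_of_lt (Nat.lt_succ_of_le hi)]

/-- Treat facet `wreg 11`. -/
def facet : Prog :=
  fillTable ;; firstForest ;; stages ;; finalLoop ;; block [wadd 11 11 1]

/-- The running time of `facet`. -/
def facetTime (n D k : ℕ) : ℕ :=
  n * (D + 1) * 22 + 10 + (n * ((D - 1) * (2 * k * 6 + 12 + 1) + (k + 1) * 35 + 19 + 1) + 8 +
    ((D - 1) * (2 ^ k * numTrees k D 0 * ((k + 1) * 51 + 33) + 10 + 1) + 1 +
      (2 ^ (k * D) * ((k + 1) * 16 + 21 + 1) + 2 + 1)))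

/-- The number of memory cells that `facet` uses. -/
def facetSpace (n D k : ℕ) : ℕ := (n + 1) * (D + 1) + D * (numTrees k D 0 * (2 * 2 ^ k))

/-- The state before facet `f` is treated: `c` is the number of the heaviest point, `S` the set of
the points selected for earlier facets. -/
structure FacetReady (n D k c : ℕ) (inp : ℕ → ℕ → ℝ) (W R : ℝ) (f : ℕ) (S : Finset ℕ)
    (s : State) : Prop where
  consts : Consts n D k s
  w10 : s.wreg 10 = c * (D + 1)
  w11 : s.wreg 11 = f
  w12 : s.wreg 12 = 2 * (D + 1)
  w60 : s.wreg 60 = numTrees k D 0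
  r1 : s.rreg 1 = W
  r2 : s.rreg 2 = R
  input : Input n (D + 1) inp s
  input_le : n * (D + 1) ≤ s.wreg 6
  list_lt : 2 * n < s.wreg 6
  fresh : ∀ a, s.wreg 6 ≤ a → s.wmem a = 0
  listed : Listed n S s

theorem facet_spec {M n D k c f : ℕ} {inp : ℕ → ℕ → ℝ} {W R : ℝ} {S : Finset ℕ} {s : State}
    (hn : 1 ≤ n) (hD : 1 ≤ D) (hc : c < n) (hW0 : W ≠ 0) (hR0 : R ≠ 0) (hf : f < 2 * (D + 1))
    (hX : ∀ t i, 1 ≤ t → t ≤ n → i ≤ D → |facetCoord D c inp W R f t i| ≤ 1)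
    (hF : FacetReady n D k c inp W R f S s) (hM : s.wreg 6 + facetSpace n D k + 1 < M)
    (hDM : 2 * (D + 1) < M) (hKM : 4 * 2 ^ k ≤ M) (hEM : 2 ^ (2 * k) < M)
    (hKD : 2 ^ (k * D) < M) :
    HaltsWithin M facet s (facetTime n D k) fun s' =>
      ∃ S', S ⊆ S' ∧ S'.card ≤ S.card + 2 ^ (k * D) ∧
        FacetReady n D k c inp W R (f + 1) S' s' ∧
        Selects n D k (facetCoord D c inp W R f) S' ∧
        s'.wreg 6 ≤ s.wreg 6 + facetSpace n D k := by
  set P := s.wreg 6 with hP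
  have hMe : (n + 1) * (D + 1) = n * (D + 1) + (D + 1) := Nat.succ_mul _ _
  have hnle : n ≤ n * (D + 1) := Nat.le_mul_of_pos_right _ (by omega)
  set S₀ := numTrees k D 0 * (2 * 2 ^ k) with hS₀
  have hDS : D * S₀ = S₀ + (D - 1) * S₀ := by
    obtain ⟨r, rfl⟩ : ∃ r, D = r + 1 := ⟨D - 1, by omega⟩
    rw [Nat.add_sub_cancel]; ring
  have hlist := hF.list_lt
  rw [← hP] at hlist
  have hin := hF.input_le
  rw [← hP] at hin
  unfold facetSpace at *
  rw [← hS₀, hDS] at hM ⊢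
  refine (fillTable_spec (c := c) (inp := inp) hF.consts hc hF.w10 hF.r1 hF.r2 hW0 hR0 hf hF.w11
    hF.input hF.input_le (by omega) hDM.le).seq (fun s1 F1 ⟨a1, a2, a3, a4, a5⟩ => ?_) le_rfl
  have hC1 := hF.consts.of_frame F1 rfl
  rw [← hP] at a1 a2 a3 a5
  refine (firstForest_spec (NB := P) (top := s1.wreg 6) (X := facetCoord D c inp W R f) hD
    (by omega) hC1 hX a1 (by rw [F1.w 60 rfl, hF.w60]) le_rfl ?_ a3 (by omega) hKM hEM
    (by omega)).seq (fun s2 F2 ⟨b1, b2, b3⟩ => ?_) le_rfl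
  · intro a ha
    rw [a4]
    exact hF.fresh a (by omega)
  have hC2 := hC1.of_frame F2 rfl
  refine (stages_spec (X := facetCoord D c inp W R f) hD (by omega) hC2 hX b1 (by omega) hKM hKD
    (by rw [← hS₀]; omega)).seq (fun s3 F3 ⟨c1, c2, hle3, c3⟩ => ?_) le_rfl
  have hC3 := hC2.of_frame F3 rfl
  rw [← hS₀] at c3
  have hL3 : Listed n S s3 := by
    have hL1 : Listed n S s1 := by
      refine ⟨?_, hF.listed.subset, ?_, ?_, ?_⟩
      · rw [F1.w 7 rfl, hF.listed.w7]
      · rw [a4]; exact hF.listed.marks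
      · rw [a4]; exact hF.listed.mem
      · rw [a4]; exact hF.listed.surj
    exact (hL1.of_agree (F2.w 7 rfl) b2 (by omega)).of_agree (F3.w 7 rfl) c2 (by omega)
  refine (finalLoop_spec (X := facetCoord D c inp W R f) hn hD (by omega) hC3 c1 (by omega)
    (by omega) (by omega) hL3).seq (fun s4 F4 ⟨S', d1, d2, d3, d4, d5⟩ => ?_) le_rfl
  have hC4 := hC3.of_frame F4 rfl
  have e11 : s4.wreg 11 = f := by
    rw [F4.w 11 rfl, F3.w 11 rfl, F2.w 11 rfl, F1.w 11 rfl, hF.w11]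
  have e6 : s4.wreg 6 = s3.wreg 6 := F4.w 6 rfl
  refine .of_wp_imp (fun Q hQ => ?_) le_rfl
  simp only [Prog.wp, Instr.wp, block, e11, hC4.w1]
  refine ⟨by omega, hQ _ ⟨S', d1, d2,
    ⟨?_, ?_, by simp, ?_, ?_, ?_, ?_, ?_, ?_, ?_, ?_, ?_⟩, d4, ?_⟩⟩
  · exact ⟨hC4.w0, hC4.w1, hC4.w2, hC4.w3, hC4.w4, hC4.w5, hC4.w17, hC4.w18, hC4.r3, hC4.r4,
      hC4.r5, hC4.r6, hC4.r7, hC4.r8⟩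
  · show s4.wreg 10 = _
    rw [F4.w 10 rfl, F3.w 10 rfl, F2.w 10 rfl, F1.w 10 rfl, hF.w10]
  · show s4.wreg 12 = _
    rw [F4.w 12 rfl, F3.w 12 rfl, F2.w 12 rfl, F1.w 12 rfl, hF.w12]
  · show s4.wreg 60 = _
    rw [F4.w 60 rfl, F3.w 60 rfl, F2.w 60 rfl, F1.w 60 rfl, hF.w60]
  · show s4.rreg 1 = _
    rw [F4.r 1 rfl, F3.r 1 rfl, F2.r 1 rfl, F1.r 1 rfl, hF.r1]
  · show s4.rreg 2 = _
    rw [F4.r 2 rfl, F3.r 2 rfl, F2.r 2 rfl, F1.r 2 rfl, hF.r2]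
  · intro e j he hj
    have h1 := row_lt he hj
    show s4.rmem _ = _
    rw [F4.rm rfl, (c2 _ (by omega)).2, (b2 _ (by omega)).2, a5 _ (by omega)]
    exact hF.input e j he hj
  · show _ ≤ s4.wreg 6
    omega
  · show _ < s4.wreg 6
    omega
  · intro a ha
    have ha : s4.wreg 6 ≤ a := ha
    show s4.wmem a = 0
    rw [d5 a (by omega)]
    exact c1.fresh a (by omega)
  · exact ⟨d3.w7, d3.subset, d3.marks, d3.mem, d3.surj⟩
  · show s4.wreg 6 ≤ _
    omega

/-! ### Preprocessing -/

/-- The row of the heaviest point goes to `wreg 10`, its weight to `rreg 1`. -/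
def findHeaviest (D : ℕ) : Prog :=
  block [wconst 1 1, wconst 2 (D + 1), wconst 17 D, wconst 10 0, rload 1 17, wconst 20 1] ;;
  .loop (.wlt 20 0)
    (block [wmul 21 20 2, wadd 22 21 17, rload 10 22] ;;
      .ite (.rlt 1 10) (block [rmove 1 10, wmove 10 21]) .skip ;; block [wadd 20 20 1])

theorem findHeaviest_spec {M n D : ℕ} {inp : ℕ → ℕ → ℝ} {s : State} (hn : 1 ≤ n)
    (h0 : s.wreg 0 = n) (hin : Input n (D + 1) inp s) (hM : (n + 1) * (D + 1) < M)
    (hDM : D + 1 < M) (hM1 : 1 < M) :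
    HaltsWithin M (findHeaviest D) s (n * 8 + 7) fun s' =>
      s'.wreg 1 = 1 ∧ s'.wreg 2 = D + 1 ∧ s'.wreg 17 = D ∧
      ∃ c < n, s'.wreg 10 = c * (D + 1) ∧ s'.rreg 1 = inp c D ∧
        ∀ e < n, inp e D ≤ inp c D := by
  have hMe : (n + 1) * (D + 1) = n * (D + 1) + (D + 1) := Nat.succ_mul _ _
  have hnle : n ≤ n * (D + 1) := Nat.le_mul_of_pos_right _ (by omega)
  have h00 := hin 0 D (by omega) (by omega)
  rw [zero_mul, zero_add] at h00
  refine HaltsWithin.seq (T₁ := 6) (T₂ := (n - 1) * (7 + 1) + 1)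
    (Q₁ := fun s' => s'.wreg 1 = 1 ∧ s'.wreg 2 = D + 1 ∧ s'.wreg 17 = D ∧ s'.wreg 10 = 0 ∧
      s'.rreg 1 = inp 0 D ∧ s'.wreg 20 = 1)
    (.of_wp_imp (fun Q hQ => ?_) le_rfl) (fun s1 F1 ⟨a1, a2, a3, a4, a5, a6⟩ => ?_) (by omega)
  · simp only [Prog.wp, Instr.wp, block, Function.update_self, Function.update_of_ne, ne_eq,
      Nat.reduceEqDiff, not_false_eq_true, h00]
    exact ⟨by omega, by omega, by omega, by omega, by omega, by omega, hQ _ (by simp)⟩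
  refine (HaltsWithin.loop (n - 1) (T := 7) (fun i s' => s'.wreg 20 = i + 1 ∧
    ∃ c ≤ i, s'.wreg 10 = c * (D + 1) ∧ s'.rreg 1 = inp c D ∧
        ∀ e ≤ i, inp e D ≤ inp c D) ?_ ?_ ?_).mono le_rfl ?_
  · refine ⟨a6, 0, le_rfl, by rw [a4, zero_mul], a5, ?_⟩
    intro e he
    rw [Nat.le_zero.1 he]
  · rintro i hi s' F' ⟨b1, c, hc, b2, b3, b4⟩
    have e0 : s'.wreg 0 = n := by rw [F'.w 0 rfl, F1.w 0 rfl, h0]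
    have e2 : s'.wreg 2 = D + 1 := by rw [F'.w 2 rfl, a2]
    have e1 : s'.wreg 1 = 1 := by rw [F'.w 1 rfl, a1]
    have e17 : s'.wreg 17 = D := by rw [F'.w 17 rfl, a3]
    have erm : s'.rmem = s.rmem := by rw [F'.rm rfl, F1.rm rfl]
    have h1 := hin (i + 1) D (by omega) (by omega)
    have h2 := row_lt (n := n) (d := D + 1) (show i + 1 < n by omega) (show D < D + 1 by omega)
    refine ⟨by simp only [Test.Holds, e0, b1]; omega, ?_⟩
    refine .of_wp_imp (fun Q hQ => ?_) le_rfl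
    simp only [Prog.wp, Instr.wp, block, Test.Holds, Function.update_self, Function.update_of_ne,
      ne_eq, Nat.reduceEqDiff, not_false_eq_true, e1, e2, e17, erm, b1, b3, h1]
    refine ⟨by omega, by omega, by omega,
      fun h => ⟨by omega, by omega, hQ _ ⟨by simp, i + 1, le_rfl, ?_⟩⟩,
      fun h => ⟨by omega, hQ _ ⟨by simp, c, by omega, ?_⟩⟩⟩
    · refine ⟨by simp, by simp, fun e he => ?_⟩
      rcases Nat.lt_succ_iff_lt_or_eq.1 (Nat.lt_succ_of_le he) with hlt | rfl
      · exact (b4 e (by omega)).trans h.le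
      · exact le_rfl
    · refine ⟨by simpa using b2, by simpa using b3, fun e he => ?_⟩
      rcases Nat.lt_succ_iff_lt_or_eq.1 (Nat.lt_succ_of_le he) with hlt | rfl
      · exact b4 e (by omega)
      · exact not_lt.1 h
  · rintro s' F' ⟨b1, -⟩
    simp only [Test.Holds, F'.w 0 rfl, F1.w 0 rfl, h0, b1]
    omega
  · rintro s' F' ⟨-, c, hc, b2, b3, b4⟩
    refine ⟨?_, ?_, ?_, c, by omega, b2, b3, fun e he => b4 e (by omega)⟩
    · rw [F'.w 1 rfl, a1]
    · rw [F'.w 2 rfl, a2]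
    · rw [F'.w 17 rfl, a3]

/-- `rreg 2` becomes at least `rreg 13`. -/
def raise : Prog := .ite (.rlt 2 13) (block [rmove 2 13]) .skip

/-- Take one coordinate into account for the scale. -/
def scaleBody : Prog :=
  block [wdiv 21 20 2, wmul 21 21 2, wsub 22 20 21, wadd 24 21 17, wadd 25 10 22, rload 10 20,
    rload 11 25, rload 12 24, rsub 13 10 11, rmul 13 13 12] ;;
  .ite (.wlt 22 17) (raise ;; block [rsub 13 3 13] ;; raise) .skip ;;
  block [wadd 20 20 1]

/-- The scale of the points goes to `rreg 2`: the largest weighted difference of a coordinate of a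
point and of the heaviest point, or `1` if all points coincide. -/
def findScale : Prog :=
  block [rsub 2 3 3, wmul 23 0 2, wconst 20 0] ;;
  .loop (.wlt 20 23) scaleBody ;; .ite (.rle 2 3) (block [rcast 2 1]) .skip

/-- `R` is an admissible scale for normalised coordinates. -/
def IsScale (n D c : ℕ) (inp : ℕ → ℕ → ℝ) (R : ℝ) : Prop :=
  0 < R ∧ (∀ e < n, ∀ j < D, |(inp e j - inp c j) * inp e D| ≤ R) ∧
    ((∃ e < n, ∃ j < D, R = |(inp e j - inp c j) * inp e D|) ∨
      ∀ e < n, ∀ j < D, (inp e j - inp c j) * inp e D = 0)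

theorem scaleBody_spec {M n D c I : ℕ} {inp : ℕ → ℕ → ℝ} {s : State} (hc : c < n)
    (h1 : s.wreg 1 = 1) (h2 : s.wreg 2 = D + 1) (h17 : s.wreg 17 = D)
    (h10 : s.wreg 10 = c * (D + 1)) (h20 : s.wreg 20 = I) (hI : I < n * (D + 1))
    (hin : Input n (D + 1) inp s) (h3 : s.rreg 3 = 0) (hM : (n + 1) * (D + 1) < M) :
    HaltsWithin M scaleBody s 17 fun s' => s'.wreg 20 = I + 1 ∧
      s'.rreg 2 = if I % (D + 1) < D then
        max (s.rreg 2) |(inp (I / (D + 1)) (I % (D + 1)) - inp c (I % (D + 1))) *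
          inp (I / (D + 1)) D| else s.rreg 2 := by
  set e := I / (D + 1) with he
  set j := I % (D + 1) with hj
  have hMe : (n + 1) * (D + 1) = n * (D + 1) + (D + 1) := Nat.succ_mul _ _
  have hdm : e * (D + 1) + j = I := Nat.div_add_mod' _ _
  have hen : e < n := Nat.div_lt_of_lt_mul (by rwa [mul_comm] at hI)
  have hjd : j < D + 1 := Nat.mod_lt _ (by omega)
  have hsub : I - e * (D + 1) = j := by omega
  have hele : e ≤ I := Nat.div_le_self _ _
  have hr1 := row_lt hen (Nat.lt_succ_self D)
  have hr2 := row_lt hc hjd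
  have hp := hin e j hen hjd
  rw [hdm] at hp
  have hmax : ∀ r y : ℝ, max r |y| = max (max r y) (0 - y) := by
    intro r y; rw [max_assoc, zero_sub]; rfl
  rw [hmax]
  refine HaltsWithin.seq (T₁ := 10) (T₂ := 7)
    (Q₁ := fun s' => s'.wreg 22 = j ∧ s'.rreg 13 = (inp e j - inp c j) * inp e D)
    (.of_wp_imp (fun Q hQ => ?_) le_rfl) (fun s1 F1 ⟨a1, a2⟩ => ?_) le_rfl
  · simp only [Prog.wp, Instr.wp, block, Function.update_self, Function.update_of_ne,
      ne_eq, Nat.reduceEqDiff, not_false_eq_true, h2, h10, h17, h20, ← he, hsub, hp,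
      hin e D hen (Nat.lt_succ_self D), hin c j hc hjd]
    exact ⟨trivial, by omega, by omega, by omega, by omega, by omega, by omega, by omega, by omega,
      hQ _ (by simp)⟩
  have e1 : s1.wreg 1 = 1 := by rw [F1.w 1 rfl, h1]
  have e17 : s1.wreg 17 = D := by rw [F1.w 17 rfl, h17]
  have e20 : s1.wreg 20 = I := by rw [F1.w 20 rfl, h20]
  have r2 : s1.rreg 2 = s.rreg 2 := F1.r 2 rfl
  have r3 : s1.rreg 3 = 0 := by rw [F1.r 3 rfl, h3]
  generalize (inp e j - inp c j) * inp e D = y at *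
  refine .of_wp_imp (fun Q hQ => ?_) (by decide)
  simp only [raise, Prog.wp, Instr.wp, block, Test.Holds, Function.update_self,
    Function.update_of_ne, ne_eq, Nat.reduceEqDiff, not_false_eq_true, e1, e17, e20, r2, r3, a1, a2]
  refine ⟨fun h => ⟨fun h4 => ⟨fun h5 => ⟨by omega, hQ _ ?_⟩, fun h5 => ⟨by omega, hQ _ ?_⟩⟩,
    fun h4 => ⟨fun h5 => ⟨by omega, hQ _ ?_⟩, fun h5 => ⟨by omega, hQ _ ?_⟩⟩⟩,
    fun h => ⟨by omega, hQ _ ?_⟩⟩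
  · refine ⟨by simp, ?_⟩
    rw [if_pos h, max_eq_right h4.le, max_eq_right h5.le]; simp
  · refine ⟨by simp, ?_⟩
    rw [if_pos h, max_eq_right h4.le, max_eq_left (not_lt.1 h5)]; simp
  · refine ⟨by simp, ?_⟩
    rw [if_pos h, max_eq_left (not_lt.1 h4), max_eq_right h5.le]; simp
  · refine ⟨by simp, ?_⟩
    rw [if_pos h, max_eq_left (not_lt.1 h4), max_eq_left (not_lt.1 h5)]; simp [r2]
  · refine ⟨by simp, ?_⟩
    rw [if_neg h]; simp [r2]

theorem findScale_spec {M n D c : ℕ} {inp : ℕ → ℕ → ℝ} {s : State} (hc : c < n)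
    (h0 : s.wreg 0 = n) (h1 : s.wreg 1 = 1) (h2 : s.wreg 2 = D + 1) (h17 : s.wreg 17 = D)
    (h10 : s.wreg 10 = c * (D + 1))
    (hin : Input n (D + 1) inp s) (h3 : s.rreg 3 = 0) (hM : (n + 1) * (D + 1) < M) :
    HaltsWithin M findScale s (n * (D + 1) * 18 + 6) fun s' => IsScale n D c inp (s'.rreg 2) := by
  have hMe : (n + 1) * (D + 1) = n * (D + 1) + (D + 1) := Nat.succ_mul _ _
  refine HaltsWithin.seq (T₁ := 3) (T₂ := n * (D + 1) * (17 + 1) + 1 + 2)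
    (Q₁ := fun s' => s'.rreg 2 = 0 ∧ s'.wreg 23 = n * (D + 1) ∧ s'.wreg 20 = 0)
    (.of_wp_imp (fun Q hQ => ?_) le_rfl) (fun s1 F1 ⟨a1, a2, a3⟩ => ?_) (by omega)
  · simp only [Prog.wp, Instr.wp, block, h0, h2, h3]
    exact ⟨by omega, by omega, hQ _ (by simp)⟩
  refine (HaltsWithin.loop (n * (D + 1)) (T := 17) (fun I s' => s'.wreg 20 = I ∧ 0 ≤ s'.rreg 2 ∧
    (∀ e < n, ∀ j < D, e * (D + 1) + j < I →
      |(inp e j - inp c j) * inp e D| ≤ s'.rreg 2) ∧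
    (s'.rreg 2 = 0 ∨ ∃ e < n, ∃ j < D, s'.rreg 2 = |(inp e j - inp c j) * inp e D|))
    ?_ ?_ ?_).seq (fun s2 F2 ⟨_, b1, b2, b3⟩ => ?_) le_rfl
  · exact ⟨a3, a1.ge, by simp, .inl a1⟩
  · rintro I hI s' F' ⟨b1, b2, b3, b4⟩
    refine ⟨by simpa [Test.Holds, b1, F'.w 23 rfl, a2] using hI, ?_⟩
    refine (scaleBody_spec (c := c) (inp := inp) hc ?_ ?_ ?_ ?_ b1 hI ?_ ?_ hM).mono le_rfl ?_
    · rw [F'.w 1 rfl, F1.w 1 rfl, h1]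
    · rw [F'.w 2 rfl, F1.w 2 rfl, h2]
    · rw [F'.w 17 rfl, F1.w 17 rfl, h17]
    · rw [F'.w 10 rfl, F1.w 10 rfl, h10]
    · unfold Input
      rw [F'.rm rfl, F1.rm rfl]; exact hin
    · rw [F'.r 3 rfl, F1.r 3 rfl, h3]
    rintro s'' - ⟨c1, c2⟩
    have hen : I / (D + 1) < n := Nat.div_lt_of_lt_mul (by rwa [mul_comm] at hI)
    have hsplit : ∀ e j, j < D → e * (D + 1) + j = I → I / (D + 1) = e ∧ I % (D + 1) = j := by
      rintro e j hj rfl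
      rw [mul_comm, Nat.mul_add_div (by omega), Nat.div_eq_of_lt (by omega), Nat.mul_add_mod,
        Nat.mod_eq_of_lt (by omega)]
      exact ⟨rfl, rfl⟩
    split_ifs at c2 with hlt
    · rw [c2]
      refine ⟨c1, b2.trans (le_max_left _ _), fun e he j hj hej => ?_, ?_⟩
      · rcases Nat.lt_succ_iff_lt_or_eq.1 hej with h | h
        · exact (b3 e he j hj h).trans (le_max_left _ _)
        · obtain ⟨rfl, rfl⟩ := hsplit e j hj h
          exact le_max_right _ _
      · rcases max_choice (s'.rreg 2) |(inp (I / (D + 1)) (I % (D + 1)) - inp c (I % (D + 1))) *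
          inp (I / (D + 1)) D| with h | h <;> rw [h]
        · exact b4
        · exact .inr ⟨_, hen, _, hlt, rfl⟩
    · rw [c2]
      refine ⟨c1, b2, fun e he j hj hej => ?_, b4⟩
      rcases Nat.lt_succ_iff_lt_or_eq.1 hej with h | h
      · exact b3 e he j hj h
      · obtain ⟨rfl, rfl⟩ := hsplit e j hj h
        exact absurd hj hlt
  · rintro s' F' ⟨b1, -⟩
    simp [Test.Holds, b1, F'.w 23 rfl, a2]
  · have hall : ∀ e < n, ∀ j < D, |(inp e j - inp c j) * inp e D| ≤ s2.rreg 2 :=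
      fun e he j hj => b2 e he j hj (row_lt he (by omega))
    have e1 : s2.wreg 1 = 1 := by rw [F2.w 1 rfl, F1.w 1 rfl, h1]
    have r3 : s2.rreg 3 = 0 := by rw [F2.r 3 rfl, F1.r 3 rfl, h3]
    refine .of_wp_imp (fun Q hQ => ?_) le_rfl
    simp only [Prog.wp, Instr.wp, block, Test.Holds, r3, e1]
    refine ⟨fun h => hQ _ ?_, fun h => hQ _ ?_⟩
    · have hz : ∀ e < n, ∀ j < D, (inp e j - inp c j) * inp e D = 0 :=
        fun e he j hj => abs_nonpos_iff.1 ((hall e he j hj).trans h)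
      simp only [Function.update_self, Nat.cast_one]
      refine ⟨one_pos, fun e he j hj => ?_, .inr hz⟩
      rw [hz e he j hj, abs_zero]
      exact zero_le_one
    · exact ⟨not_le.1 h, hall, .inl (b3.resolve_left fun h' => h h'.le)⟩

/-- The number `2 ^ k` of sample points per axis goes to `wreg 4`: the least one with
`126 D ≤ 4 ^ k ε`. -/
def findResolution (D : ℕ) : Prog :=
  block [wconst 4 1, wconst 20 (126 * D), rcast 10 20, rmove 11 0] ;;
  .loop (.rlt 11 10) (block [wadd 4 4 4, radd 11 11 11, radd 11 11 11])

theorem findResolution_spec {M D k : ℕ} {ε : ℝ} {s : State} (hε : s.rreg 0 = ε)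
    (hk : (126 * D : ℝ) ≤ 4 ^ k * ε) (hk' : ∀ i < k, 4 ^ i * ε < 126 * D) (hDM : 126 * D < M)
    (hKM : 4 * 2 ^ k ≤ M) :
    HaltsWithin M (findResolution D) s (k * 4 + 5) fun s' => s'.wreg 4 = 2 ^ k := by
  have hkpos := Nat.one_le_two_pow (n := k)
  refine HaltsWithin.seq (T₁ := 4) (T₂ := k * (3 + 1) + 1)
    (Q₁ := fun s' => s'.wreg 4 = 1 ∧ s'.rreg 10 = 126 * D ∧ s'.rreg 11 = ε)
    (.of_wp_imp (fun Q hQ => ?_) le_rfl) (fun s1 F1 ⟨a1, a2, a3⟩ => ?_) (by omega)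
  · simp only [Prog.wp, Instr.wp, block]
    exact ⟨by omega, by omega, hQ _ (by simp [hε])⟩
  refine (HaltsWithin.loop k (T := 3) (fun i s' => s'.wreg 4 = 2 ^ i ∧
    s'.rreg 11 = 4 ^ i * ε) ?_ ?_ ?_).mono le_rfl ?_
  · simp [a1, a3]
  · rintro i hi s' F' ⟨b1, b2⟩
    have h1 : 2 ^ i ≤ 2 ^ k := Nat.pow_le_pow_right (by norm_num) hi.le
    refine ⟨by simpa only [Test.Holds, b2, F'.r 10 rfl, a2] using hk' i hi, ?_⟩
    refine .of_wp_imp (fun Q hQ => ?_) le_rfl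
    simp only [Prog.wp, Instr.wp, block, b1, b2]
    exact ⟨by omega, hQ _ ⟨by simp; ring, by simp; ring⟩⟩
  · rintro s' F' ⟨b1, b2⟩
    simpa only [Test.Holds, b2, F'.r 10 rfl, a2, not_lt] using hk
  · rintro s' - ⟨b1, -⟩
    exact b1

/-- Load the registers of `Consts`, and start the allocation of memory behind the input, the list
and the marks. -/
def loadConsts (D : ℕ) : Prog :=
  block [wmul 5 4 4, wadd 18 4 4, wconst 3 2, wconst 7 0, wadd 12 2 2, wconst 11 0, wadd 6 0 1,
    wadd 20 2 1, wmul 6 6 20, wmove 60 1] ;;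
  block [rcast 4 3, wconst 20 8, rcast 5 20, rcast 6 4, rdiv 5 5 6, wconst 20 12, rcast 6 20,
    rcast 7 5, rdiv 7 7 4, rcast 8 1] ;;
  block [wconst 20 (2 * (D - 1)), wconst 21 0] ;;
  .loop (.wlt 21 20) (block [wmul 60 60 4, wadd 21 21 1])

theorem loadConsts_spec {M n D k : ℕ} {s : State} (hD : 1 ≤ D)
    (h0 : s.wreg 0 = n) (h1 : s.wreg 1 = 1) (h2 : s.wreg 2 = D + 1) (h17 : s.wreg 17 = D)
    (h4 : s.wreg 4 = 2 ^ k) (h3 : s.rreg 3 = 0) (hM : (n + 1) * (D + 2) < M)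
    (hDM : 126 * D < M) (hKM : 4 * 2 ^ k ≤ M) (hEM : 2 ^ (2 * k) < M)
    (hNM : numTrees k D 0 < M) :
    HaltsWithin M (loadConsts D) s (2 * (D - 1) * 3 + 23) fun s' =>
      Consts n D k s' ∧ s'.wreg 7 = 0 ∧ s'.wreg 11 = 0 ∧ s'.wreg 12 = 2 * (D + 1) ∧
      s'.wreg 60 = numTrees k D 0 ∧ s'.wreg 6 = (n + 1) * (D + 2) := by
  have hE : 2 ^ k * 2 ^ k = 2 ^ (2 * k) := by rw [← pow_add, two_mul]
  have hkpos := Nat.one_le_two_pow (n := k)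
  have hMn : (n + 1) * (D + 2) = (n + 1) + (n + 1) * (D + 1) := by ring
  refine HaltsWithin.seq (T₁ := 10) (T₂ := 10 + (2 + (2 * (D - 1) * (2 + 1) + 1)))
    (Q₁ := fun s' => s'.wreg 5 = 2 ^ (2 * k) ∧ s'.wreg 18 = 2 * 2 ^ k ∧ s'.wreg 3 = 2 ∧
      s'.wreg 7 = 0 ∧ s'.wreg 11 = 0 ∧ s'.wreg 12 = 2 * (D + 1) ∧ s'.wreg 60 = 1 ∧
      s'.wreg 6 = (n + 1) * (D + 2))
    (.of_wp_imp (fun Q hQ => ?_) le_rfl) (fun s1 F1 ⟨a1, a2, a3, a4, a5, a6, a7, a8⟩ => ?_)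
    (by omega)
  · simp only [Prog.wp, Instr.wp, block, Function.update_self, Function.update_of_ne,
      ne_eq, Nat.reduceEqDiff, not_false_eq_true, h0, h1, h2, h4, hE]
    refine ⟨by omega, by omega, by omega, by omega, by omega, by omega, by omega, by omega,
      by omega, by omega, hQ _ ?_⟩
    simp
    omega
  have e4 : s1.wreg 4 = 2 ^ k := by rw [F1.w 4 rfl, h4]
  have e1 : s1.wreg 1 = 1 := by rw [F1.w 1 rfl, h1]
  refine HaltsWithin.seq (T₁ := 10) (T₂ := 2 + (2 * (D - 1) * (2 + 1) + 1))
    (Q₁ := fun s' => s'.rreg 4 = 2 ∧ s'.rreg 5 = 8 / 2 ^ k ∧ s'.rreg 6 = 12 ∧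
      s'.rreg 7 = 2 ^ (2 * k) / 2 ∧ s'.rreg 8 = 1)
    (.of_wp_imp (fun Q hQ => ?_) le_rfl) (fun s2 F2 ⟨b1, b2, b3, b4, b5⟩ => ?_) le_rfl
  · simp only [Prog.wp, Instr.wp, block, Function.update_self, Function.update_of_ne,
      ne_eq, Nat.reduceEqDiff, not_false_eq_true, e4, e1, a1, a3]
    exact ⟨by omega, by positivity, by omega, by norm_num, hQ _ (by simp)⟩
  refine HaltsWithin.seq (T₁ := 2) (T₂ := 2 * (D - 1) * (2 + 1) + 1)
    (Q₁ := fun s' => s'.wreg 20 = 2 * (D - 1) ∧ s'.wreg 21 = 0)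
    (.of_wp_imp (fun Q hQ => ?_) le_rfl) (fun s3 F3 ⟨c1, c2⟩ => ?_) le_rfl
  · simp only [Prog.wp, Instr.wp, block]
    exact ⟨by omega, by omega, hQ _ (by simp)⟩
  have hC : Consts n D k s3 := by
    constructor
    · rw [F3.w 0 rfl, F2.w 0 rfl, F1.w 0 rfl, h0]
    · rw [F3.w 1 rfl, F2.w 1 rfl, e1]
    · rw [F3.w 2 rfl, F2.w 2 rfl, F1.w 2 rfl, h2]
    · rw [F3.w 3 rfl, F2.w 3 rfl, a3]
    · rw [F3.w 4 rfl, F2.w 4 rfl, e4]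
    · rw [F3.w 5 rfl, F2.w 5 rfl, a1, hE]
    · rw [F3.w 17 rfl, F2.w 17 rfl, F1.w 17 rfl, h17]
    · rw [F3.w 18 rfl, F2.w 18 rfl, a2]
    · rw [F3.r 3 rfl, F2.r 3 rfl, F1.r 3 rfl, h3]
    · rw [F3.r 4 rfl, b1]
    · rw [F3.r 5 rfl, b2]
    · rw [F3.r 6 rfl, b3]
    · rw [F3.r 7 rfl, b4, ← pow_add, two_mul]
    · rw [F3.r 8 rfl, b5]
  refine (HaltsWithin.loop (2 * (D - 1)) (T := 2) (fun i s' => s'.wreg 21 = i ∧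
    s'.wreg 60 = 2 ^ (k * i)) ?_ ?_ ?_).mono le_rfl ?_
  · simp [c2, F3.w 60 rfl, F2.w 60 rfl, a7]
  · rintro i hi s' F' ⟨b1, b2⟩
    have hC' := hC.of_frame F' rfl
    have h5 : 2 ^ (k * i) * 2 ^ k = 2 ^ (k * (i + 1)) := by rw [← pow_add]; congr 1
    have h6 : 2 ^ (k * (i + 1)) ≤ numTrees k D 0 := by
      rw [numTrees, mul_zero, pow_zero, one_mul]
      refine Nat.pow_le_pow_right (by norm_num) ?_
      calc k * (i + 1) ≤ k * (2 * (D - 1)) := Nat.mul_le_mul_left _ hi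
        _ = 2 * k * (D - (0 + 1)) := by rw [zero_add]; ring
    refine ⟨by simpa only [Test.Holds, b1, F'.w 20 rfl, c1] using hi, ?_⟩
    refine .of_wp_imp (fun Q hQ => ?_) le_rfl
    simp only [Prog.wp, Instr.wp, block, Function.update_of_ne, ne_eq, Nat.reduceEqDiff,
      not_false_eq_true, b1, b2, hC'.w4, hC'.w1, h5]
    exact ⟨by omega, by omega, hQ _ (by simp)⟩
  · rintro s' F' ⟨b1, -⟩
    simp [Test.Holds, b1, F'.w 20 rfl, c1]
  · rintro s' F' ⟨-, b2⟩
    refine ⟨hC.of_frame F' rfl, ?_, ?_, ?_, ?_, ?_⟩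
    · rw [F'.w 7 rfl, F3.w 7 rfl, F2.w 7 rfl, a4]
    · rw [F'.w 11 rfl, F3.w 11 rfl, F2.w 11 rfl, a5]
    · rw [F'.w 12 rfl, F3.w 12 rfl, F2.w 12 rfl, a6]
    · rw [b2, numTrees, mul_zero, pow_zero, one_mul, zero_add]
      congr 1; ring
    · rw [F'.w 6 rfl, F3.w 6 rfl, F2.w 6 rfl, a8]

/-- The preprocessing program for dimension `D ≥ 1`. -/
def preprocess (D : ℕ) : Prog :=
  findHeaviest D ;; findScale ;; findResolution D ;; loadConsts D ;;
  .loop (.wlt 11 12) facet ;; block [wconst 20 0, wstore 20 7]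

/-- The running time of `preprocess`. -/
def preprocessTime (n D k : ℕ) : ℕ :=
  n * 8 + 7 + (n * (D + 1) * 18 + 6 + (k * 4 + 5 + (2 * (D - 1) * 3 + 23 +
    (2 * (D + 1) * (facetTime n D k + 1) + 1 + 2))))

/-- What preprocessing leaves in memory: the input, and the list of the selected points, with its
length at address `0`. -/
theorem preprocess_spec {M n D k : ℕ} {inp : ℕ → ℕ → ℝ} {ε : ℝ} {s : State} (hn : 1 ≤ n)
    (hD : 1 ≤ D) (hw : ∀ e < n, 0 < inp e D)
    (h0 : s.wreg 0 = n) (hε : s.rreg 0 = ε) (h3 : s.rreg 3 = 0) (hmem : ∀ a, s.wmem a = 0)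
    (hin : Input n (D + 1) inp s)
    (hk : (126 * D : ℝ) ≤ 4 ^ k * ε) (hk' : ∀ i < k, 4 ^ i * ε < 126 * D)
    (hM : (n + 1) * (D + 2) + 2 * (D + 1) * facetSpace n D k + 1 < M)
    (hDM : 126 * D < M) (hKM : 4 * 2 ^ k ≤ M) (hEM : 2 ^ (2 * k) < M) (hKD : 2 ^ (k * D) < M) :
    HaltsWithin M (preprocess D) s (preprocessTime n D k) fun s' =>
      ∃ c R S, c < n ∧ (∀ e < n, inp e D ≤ inp c D) ∧ IsScale n D c inp R ∧
        S.card ≤ 2 * (D + 1) * 2 ^ (k * D) ∧ S ⊆ Finset.Icc 1 n ∧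
        (∀ f < 2 * (D + 1), Selects n D k (facetCoord D c inp (inp c D) R f) S) ∧
        s'.wmem 0 = S.card ∧ (∀ i, 1 ≤ i → i ≤ S.card → s'.wmem i ∈ S) ∧
        (∀ t ∈ S, ∃ i, 1 ≤ i ∧ i ≤ S.card ∧ s'.wmem i = t) ∧ Input n (D + 1) inp s' := by
  have hspace : D * (numTrees k D 0 * (2 * 2 ^ k)) ≤ facetSpace n D k := Nat.le_add_left _ _
  have hNT : numTrees k D 0 ≤ D * (numTrees k D 0 * (2 * 2 ^ k)) :=
    (Nat.le_mul_of_pos_right _ (by positivity)).trans (Nat.le_mul_of_pos_left _ hD)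
  have hfs : facetSpace n D k ≤ 2 * (D + 1) * facetSpace n D k :=
    Nat.le_mul_of_pos_left _ (by omega)
  have hMn : (n + 1) * (D + 2) = (n + 1) + (n + 1) * (D + 1) := by ring
  have hMe : (n + 1) * (D + 1) = n * (D + 1) + (D + 1) := Nat.succ_mul _ _
  have hnle : n * 2 ≤ n * (D + 1) := Nat.mul_le_mul_left _ (by omega)
  refine (findHeaviest_spec (inp := inp) hn h0 hin (by omega) (by omega) (by omega)).seq
    (fun s1 F1 ⟨a1, a2, a3, c, hc, a4, a5, a6⟩ => ?_) le_rfl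
  have hin1 : Input n (D + 1) inp s1 := by unfold Input; rw [F1.rm rfl]; exact hin
  have e01 : s1.wreg 0 = n := by rw [F1.w 0 rfl, h0]
  have r31 : s1.rreg 3 = 0 := by rw [F1.r 3 rfl, h3]
  refine (findScale_spec hc e01 a1 a2 a3 a4 hin1 r31 (by omega)).seq
    (fun s2 F2 b1 => ?_) le_rfl
  have e02 : s2.rreg 0 = ε := by rw [F2.r 0 rfl, F1.r 0 rfl, hε]
  refine (findResolution_spec e02 hk hk' hDM hKM).seq (fun s3 F3 c1 => ?_) le_rfl
  have hrm3 : s3.rmem = s.rmem := by rw [F3.rm rfl, F2.rm rfl, F1.rm rfl]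
  have hwm3 : s3.wmem = s.wmem := by rw [F3.wm rfl, F2.wm rfl, F1.wm rfl]
  refine (loadConsts_spec (n := n) (k := k) hD (by rw [F3.w 0 rfl, F2.w 0 rfl, e01])
    (by rw [F3.w 1 rfl, F2.w 1 rfl, a1]) (by rw [F3.w 2 rfl, F2.w 2 rfl, a2])
    (by rw [F3.w 17 rfl, F2.w 17 rfl, a3]) c1 (by rw [F3.r 3 rfl, F2.r 3 rfl, r31])
    (by omega) hDM hKM hEM (by omega)).seq (fun s4 F4 ⟨d0, d1, d2, d3, d4, d5⟩ => ?_) le_rfl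
  have hwm4 : s4.wmem = s.wmem := by rw [F4.wm rfl, hwm3]
  have hrm4 : s4.rmem = s.rmem := by rw [F4.rm rfl, hrm3]
  have hR0 : s2.rreg 2 ≠ 0 := b1.1.ne'
  have hW0 : 0 < inp c D := hw c hc
  have hX : ∀ f t i, 1 ≤ t → t ≤ n → i ≤ D →
      |facetCoord D c inp (inp c D) (s2.rreg 2) f t i| ≤ 1 := by
    intro f t i h1 h2 _
    have hsign : |(if f < D + 1 then 1 else -1 : ℝ)| = 1 := by split_ifs <;> simp
    rw [facetCoord, abs_mul, hsign, mul_one, normCoord]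
    split_ifs with hj
    · rw [abs_div, abs_of_pos b1.1, div_le_one b1.1]
      exact b1.2.1 _ (by omega) _ hj
    · rw [abs_div, abs_of_pos hW0, div_le_one hW0, abs_of_pos (hw _ (by omega))]
      exact a6 _ (by omega)
  refine (HaltsWithin.loop (2 * (D + 1)) (T := facetTime n D k) (fun f s' =>
    ∃ S, FacetReady n D k c inp (inp c D) (s2.rreg 2) f S s' ∧ S.card ≤ f * 2 ^ (k * D) ∧
      (∀ f' < f, Selects n D k (facetCoord D c inp (inp c D) (s2.rreg 2) f') S) ∧
      s'.wreg 6 ≤ (n + 1) * (D + 2) + f * facetSpace n D k) ?_ ?_ ?_).seq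
    (fun s5 F5 ⟨S, hF, e1, e2, e3⟩ => ?_) le_rfl
  · refine ⟨∅, ⟨d0, ?_, d2, d3, d4, ?_, ?_, ?_, ?_, ?_, ?_, ?_⟩, by simp, by simp, by omega⟩
    · rw [F4.w 10 rfl, F3.w 10 rfl, F2.w 10 rfl, a4]
    · rw [F4.r 1 rfl, F3.r 1 rfl, F2.r 1 rfl, a5]
    · rw [F4.r 2 rfl, F3.r 2 rfl]
    · unfold Input; rw [hrm4]; exact hin
    · omega
    · omega
    · intro a _; rw [hwm4, hmem]
    · refine ⟨by simpa using d1, by simp, fun t _ _ => ?_, fun i h1 h2 => ?_, by simp⟩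
      · rw [hwm4, hmem]; simp
      · rw [Finset.card_empty] at h2; omega
  · rintro f hf s' F' ⟨S, hF, e1, e2, e3⟩
    have h1 : (f + 1) * facetSpace n D k ≤ 2 * (D + 1) * facetSpace n D k :=
      Nat.mul_le_mul_right _ hf
    have h2 : (f + 1) * facetSpace n D k = f * facetSpace n D k + facetSpace n D k :=
      Nat.succ_mul _ _
    refine ⟨by simpa only [Test.Holds, hF.w11, hF.w12] using hf, ?_⟩
    refine (facet_spec hn hD hc hW0.ne' hR0 hf (hX f) hF (by omega) (by omega) hKM hEM
      hKD).mono le_rfl ?_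
    rintro s'' - ⟨S', g1, g2, g3, g4, g5⟩
    refine ⟨S', g3, ?_, fun f' hf' => ?_, by omega⟩
    · rw [Nat.succ_mul]; omega
    · rcases Nat.lt_succ_iff_lt_or_eq.1 hf' with hlt | rfl
      · intro A hA
        obtain ⟨e, he, h⟩ := e2 f' hlt A hA
        exact ⟨e, g1 he, h⟩
      · exact g4
  · rintro s' F' ⟨S, hF, -⟩
    simp [Test.Holds, hF.w11, hF.w12]
  · have hL := hF.listed
    have hcard := hL.card_le
    refine .of_wp_imp (fun Q hQ => ?_) le_rfl
    simp only [Prog.wp, Instr.wp, block, Function.update_self, Function.update_of_ne,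
      ne_eq, Nat.reduceEqDiff, not_false_eq_true, hL.w7]
    refine ⟨by omega, by omega, by omega, hQ _ ⟨c, _, S, hc, a6, b1, e1, hL.subset, e2, by simp,
      fun i h1 h2 => ?_, fun t ht => ?_, hF.input⟩⟩
    · have h3 : i ≠ 0 := by omega
      simpa [h3] using hL.mem i h1 h2
    · obtain ⟨i, h1, h2, h3⟩ := hL.surj t ht
      have h4 : i ≠ 0 := by omega
      exact ⟨i, h1, h2, by simpa [h4] using h3⟩

/-! ### The selected points approximate every farthest distance -/

theorem sum_range_add_mod (N : ℕ) (h : ℕ → ℝ) (f : ℕ) :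
    ∑ i ∈ Finset.range N, h ((i + f) % N) = ∑ i ∈ Finset.range N, h i := by
  induction f with
  | zero =>
    refine Finset.sum_congr rfl fun i hi => ?_
    rw [add_zero, Nat.mod_eq_of_lt (Finset.mem_range.1 hi)]
  | succ f ih =>
    rw [← ih]
    have h1 := Finset.sum_range_succ (fun i => h ((i + f) % N)) N
    rw [Finset.sum_range_succ', zero_add, Nat.add_mod_left] at h1
    rw [← add_right_cancel h1]
    exact Finset.sum_congr rfl fun i _ => by rw [add_right_comm, add_assoc]

theorem exists_abscissa_near (k : ℕ) {a : ℝ} (ha : |a| ≤ 4) :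
    ∃ g < 2 ^ k, |abscissa k (2 ^ k + g) - a| ≤ 8 / 2 ^ k := by
  obtain ⟨ha1, ha2⟩ := abs_le.1 ha
  have hK : (0 : ℝ) < 2 ^ k := by positivity
  have hform : ∀ g : ℕ, abscissa k (2 ^ k + g) = g * (8 / 2 ^ k) - 4 := by
    intro g
    rw [abscissa]; push_cast; field_simp; ring
  have hx0 : 0 ≤ (a + 4) / (8 / 2 ^ k) := by
    apply div_nonneg <;> first | linarith | positivity
  have hstep : (0 : ℝ) < 8 / 2 ^ k := by positivity
  have hfl := Nat.floor_le hx0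
  have hlt := Nat.lt_floor_add_one ((a + 4) / (8 / 2 ^ k))
  rw [le_div_iff₀ hstep] at hfl
  rw [div_lt_iff₀ hstep] at hlt
  rcases lt_or_ge ⌊(a + 4) / (8 / 2 ^ k)⌋₊ (2 ^ k) with hg | hg
  · refine ⟨_, hg, ?_⟩
    rw [hform, abs_le]
    constructor <;> linarith
  · refine ⟨2 ^ k - 1, by have := Nat.one_le_two_pow (n := k); omega, ?_⟩
    have h8 : (2 ^ k : ℝ) * (8 / 2 ^ k) = 8 := by field_simp
    have hg' : (2 ^ k : ℝ) * (8 / 2 ^ k) ≤ a + 4 :=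
      (mul_le_mul_of_nonneg_right (by exact_mod_cast hg) hstep.le).trans hfl
    rw [hform, Nat.cast_sub Nat.one_le_two_pow, abs_le]
    push_cast
    constructor <;> linarith

/-- The code of a net point with given digits. -/
theorem exists_netCost_eq (k : ℕ) (X : ℕ → ℕ → ℝ) (g : ℕ → ℕ) (hg : ∀ i, g i < 2 ^ k) (σ : ℕ) :
    ∃ A < 2 ^ (k * σ), ∀ t, netCost k X σ A t = (2 - X t 0) ^ 2 +
      ∑ i ∈ Finset.range σ, (abscissa k (2 ^ k + g i) - X t (i + 1)) ^ 2 := by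
  induction σ with
  | zero => exact ⟨0, by simp, fun t => by simp [netCost]⟩
  | succ σ ih =>
    obtain ⟨A, hA, h⟩ := ih
    refine ⟨2 ^ k * A + g σ, ?_, fun t => ?_⟩
    · have h1 : 2 ^ (k * (σ + 1)) = 2 ^ k * 2 ^ (k * σ) := by rw [← pow_add]; congr 1; ring
      rw [h1]
      calc 2 ^ k * A + g σ < 2 ^ k * (A + 1) := by rw [mul_add, mul_one]; have := hg σ; omega
        _ ≤ _ := Nat.mul_le_mul_left _ hA
    · rw [netCost, Nat.mul_add_div (by positivity), Nat.div_eq_of_lt (hg σ), add_zero,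
        Nat.mul_add_mod, Nat.mod_eq_of_lt (hg σ), h, Finset.sum_range_succ, add_assoc]

/-- A point that is nearly nearest to the net point next to `X t + τ ζ` is nearly as far in
direction `ζ` as `X t`.  If `y = X e - X t`, and the net point is `X t + τ ζ + δ`, then the squared
distances of `X e` and `X t` to it differ by `‖y - δ‖ ^ 2 - ‖δ‖ ^ 2 - 2 τ ⟨ζ, y⟩`, where the
coordinates of `δ` are at most `8 / 2 ^ k`. -/
theorem Selects.exists_inner_le {n D k : ℕ} {X : ℕ → ℕ → ℝ} {S : Finset ℕ} {ζ : ℕ → ℝ} {t : ℕ}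
    (hS : Selects n D k X S) (hD : 1 ≤ D) (hX : ∀ i ≤ D, |X t i| ≤ 1) (ht : 1 ≤ t) (htn : t ≤ n)
    (hζ0 : ζ 0 = 1) (hζ : ∀ i ≤ D, |ζ i| ≤ 1) :
    ∃ e ∈ S, ∑ i ∈ Finset.range (D + 1), ζ i * X t i ≤
      ∑ i ∈ Finset.range (D + 1), ζ i * X e i + 42 * D / 4 ^ k := by
  obtain ⟨h01, h02⟩ := abs_le.1 (hX 0 (Nat.zero_le _))
  -- With this `τ`, the first coordinate of `X t + τ ζ` is `2`, as for all points of the net.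
  set τ := 2 - X t 0 with hτ
  -- `g` lists the digits of a net point next to `X t + τ ζ`.
  have hg : ∀ i, ∃ g < 2 ^ k, i < D →
      |abscissa k (2 ^ k + g) - (X t (i + 1) + τ * ζ (i + 1))| ≤ 8 / 2 ^ k := by
    intro i
    by_cases hi : i < D
    · have h3 : |X t (i + 1) + τ * ζ (i + 1)| ≤ 4 := by
        refine (abs_add_le _ _).trans ?_
        rw [abs_mul, abs_of_pos (by linarith : 0 < τ)]
        have := hX (i + 1) hi
        have := mul_le_mul (by linarith : τ ≤ 3) (hζ (i + 1) hi) (abs_nonneg _) (by norm_num)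
        linarith
      obtain ⟨g, h4, h5⟩ := exists_abscissa_near k h3
      exact ⟨g, h4, fun _ => h5⟩
    · exact ⟨0, by positivity, fun h => absurd h hi⟩
  choose g hgk hgn using hg
  obtain ⟨A, hA, hcost⟩ := exists_netCost_eq k X g hgk D
  obtain ⟨e, he, hle⟩ := hS A hA
  refine ⟨e, he, ?_⟩
  have h6 := hle t ht htn
  rw [hcost, hcost] at h6
  have h4k : (2 : ℝ) ^ (2 * k) = 4 ^ k := by rw [pow_mul]; norm_num
  have h7 : ∑ i ∈ Finset.range D, (abscissa k (2 ^ k + g i) - X t (i + 1)) ^ 2 -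
      ∑ i ∈ Finset.range D, (abscissa k (2 ^ k + g i) - X e (i + 1)) ^ 2 ≤
      ∑ i ∈ Finset.range D, (2 * τ * (ζ (i + 1) * X e (i + 1) - ζ (i + 1) * X t (i + 1)) +
        64 / 4 ^ k) := by
    rw [← Finset.sum_sub_distrib]
    refine Finset.sum_le_sum fun i hi => ?_
    have h8 := hgn i (Finset.mem_range.1 hi)
    have h9 : (abscissa k (2 ^ k + g i) - (X t (i + 1) + τ * ζ (i + 1))) ^ 2 ≤ 64 / 4 ^ k := by
      rw [← sq_abs]
      refine (pow_le_pow_left₀ (abs_nonneg _) h8 2).trans_eq ?_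
      rw [div_pow, ← pow_mul, mul_comm k, h4k]; norm_num
    nlinarith [sq_nonneg (abscissa k (2 ^ k + g i) - (X t (i + 1) + τ * ζ (i + 1)) -
      (X e (i + 1) - X t (i + 1)))]
  rw [Finset.sum_add_distrib, ← Finset.mul_sum, Finset.sum_sub_distrib, Finset.sum_const,
    Finset.card_range, nsmul_eq_mul] at h7
  rw [h4k, Nat.cast_sub hD, Nat.cast_one] at h6
  rw [Finset.sum_range_succ', Finset.sum_range_succ', hζ0]
  generalize ∑ i ∈ Finset.range D, (abscissa k (2 ^ k + g i) - X t (i + 1)) ^ 2 = p1 at *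
  generalize ∑ i ∈ Finset.range D, (abscissa k (2 ^ k + g i) - X e (i + 1)) ^ 2 = p2 at *
  generalize ∑ i ∈ Finset.range D, ζ (i + 1) * X e (i + 1) = z1 at *
  generalize ∑ i ∈ Finset.range D, ζ (i + 1) * X t (i + 1) = z2 at *
  have hu : (0 : ℝ) < 1 / 4 ^ k := by positivity
  have hD' : (1 : ℝ) ≤ D := by exact_mod_cast hD
  have e1 : (D - 1 : ℝ) * (20 / 4 ^ k) = (D - 1) * 20 * (1 / 4 ^ k) := by ring
  have e2 : (D : ℝ) * (64 / 4 ^ k) = D * 64 * (1 / 4 ^ k) := by ring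
  have e3 : (42 * D : ℝ) / 4 ^ k = 42 * D * (1 / 4 ^ k) := by ring
  rw [e1] at h6
  rw [e2] at h7
  rw [e3]
  generalize (1 : ℝ) / 4 ^ k = u at *
  have hXe : X t 0 = 2 - τ := by rw [hτ]; ring
  rw [hXe]
  have hkey : 2 * τ * ((z2 + 1 * (2 - τ)) - (z1 + 1 * X e 0)) ≤ 84 * D * u := by
    nlinarith [sq_nonneg (X e 0 - (2 - τ))]
  have hDu : 0 ≤ D * u := by positivity
  by_contra! hcon
  nlinarith

/-- The selections for all facets of the cube together serve every direction `ξ`. -/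
theorem exists_linear_le {n D k c : ℕ} {inp : ℕ → ℕ → ℝ} {W R L : ℝ} {S : Finset ℕ} {ξ : ℕ → ℝ}
    {t : ℕ} (hD : 1 ≤ D)
    (hS : ∀ f < 2 * (D + 1), Selects n D k (facetCoord D c inp W R f) S)
    (hV : ∀ j ≤ D, |normCoord D c inp W R (t - 1) j| ≤ 1) (ht : 1 ≤ t) (htn : t ≤ n)
    (hξ : ∀ j ≤ D, |ξ j| ≤ L) :
    ∃ e ∈ S, ∑ j ∈ Finset.range (D + 1), ξ j * normCoord D c inp W R (t - 1) j ≤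
      ∑ j ∈ Finset.range (D + 1), ξ j * normCoord D c inp W R (e - 1) j +
        L * (42 * D / 4 ^ k) := by
  have hL : 0 ≤ L := (abs_nonneg _).trans (hξ 0 (Nat.zero_le _))
  obtain ⟨j₀, hj₀, hmax⟩ := Finset.exists_max_image (Finset.range (D + 1)) (fun j => |ξ j|)
    ⟨0, by simp⟩
  rw [Finset.mem_range] at hj₀
  rcases (abs_nonneg (ξ j₀)).eq_or_lt with h0 | h0
  · have hz : ∀ j ∈ Finset.range (D + 1), ξ j = 0 := fun j hj =>
      abs_nonpos_iff.1 ((hmax j hj).trans h0.symm.le)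
    obtain ⟨e, he, -⟩ := hS 0 (by omega) 0 (by positivity)
    refine ⟨e, he, ?_⟩
    rw [Finset.sum_eq_zero fun j hj => by rw [hz j hj, zero_mul],
      Finset.sum_eq_zero fun j hj => by rw [hz j hj, zero_mul], zero_add]
    positivity
  obtain ⟨f, hf, hf0, hsgn⟩ : ∃ f < 2 * (D + 1), f % (D + 1) = j₀ ∧
      (if f < D + 1 then 1 else -1 : ℝ) * ξ j₀ = |ξ j₀| := by
    rcases le_total 0 (ξ j₀) with h | h
    · exact ⟨j₀, by omega, Nat.mod_eq_of_lt hj₀, by rw [if_pos hj₀, one_mul, abs_of_nonneg h]⟩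
    · refine ⟨j₀ + (D + 1), by omega, by rw [Nat.add_mod_right, Nat.mod_eq_of_lt hj₀], ?_⟩
      rw [if_neg (by omega), abs_of_nonpos h]; ring
  set σ : ℝ := if f < D + 1 then 1 else -1 with hσ
  have hσ2 : σ * σ = 1 := by rw [hσ]; split_ifs <;> norm_num
  have hσ1 : |σ| = 1 := by rw [hσ]; split_ifs <;> norm_num
  have hmod : ∀ i, (i + f) % (D + 1) < D + 1 := fun i => Nat.mod_lt _ (Nat.succ_pos _)
  obtain ⟨e, he, hle⟩ := (hS f hf).exists_inner_le (t := t)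
    (ζ := fun i => σ * ξ ((i + f) % (D + 1)) / |ξ j₀|) hD
    (fun i _ => by
      rw [facetCoord, ← hσ, abs_mul, hσ1, mul_one]
      exact hV _ (Nat.lt_succ_iff.1 (hmod i))) ht htn
    (by simp only [zero_add, hf0, hsgn]; exact div_self h0.ne')
    (fun i _ => by
      rw [abs_div, abs_mul, hσ1, one_mul, abs_abs, div_le_one h0]
      exact hmax _ (Finset.mem_range.2 (hmod i)))
  refine ⟨e, he, ?_⟩
  have hsum : ∀ t, ∑ i ∈ Finset.range (D + 1), σ * ξ ((i + f) % (D + 1)) / |ξ j₀| *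
      facetCoord D c inp W R f t i = (∑ j ∈ Finset.range (D + 1),
        ξ j * normCoord D c inp W R (t - 1) j) / |ξ j₀| := by
    intro t
    rw [← sum_range_add_mod (D + 1) (fun j => ξ j * normCoord D c inp W R (t - 1) j) f,
      Finset.sum_div]
    refine Finset.sum_congr rfl fun i _ => ?_
    rw [facetCoord, ← hσ]
    linear_combination (ξ ((i + f) % (D + 1)) * normCoord D c inp W R (t - 1)
      ((i + f) % (D + 1)) / |ξ j₀|) * hσ2
  rw [hsum, hsum, div_add' _ _ _ h0.ne', div_le_div_iff_of_pos_right h0] at hle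
  refine hle.trans (add_le_add_right ?_ _)
  rw [mul_comm]
  exact mul_le_mul_of_nonneg_right (hξ _ (Nat.lt_succ_iff.1 hj₀)) (by positivity)

/-- For each query point, one of the selected points is an approximate weighted farthest
neighbour. -/
theorem exists_selected_far {n D k c : ℕ} {inp : ℕ → ℕ → ℝ} {R ε : ℝ} {S : Finset ℕ}
    {p : Fin n → EuclideanSpace ℝ (Fin D)} {w : Fin n → ℝ} (hD : 1 ≤ D) (hw : ∀ i, 0 < w i)
    (hp : ∀ (i : Fin n) (j : Fin D), inp i j = p i j) (hpw : ∀ i : Fin n, inp i D = w i)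
    (hc : c < n) (hmax : ∀ e < n, inp e D ≤ inp c D) (hR : IsScale n D c inp R)
    (hSn : S ⊆ Finset.Icc 1 n)
    (hS : ∀ f < 2 * (D + 1), Selects n D k (facetCoord D c inp (inp c D) R f) S)
    (hk : (126 * D : ℝ) ≤ 4 ^ k * ε) (q : EuclideanSpace ℝ (Fin D)) :
    ∃ r : Fin n, (r : ℕ) + 1 ∈ S ∧
      ∀ i, (1 - ε) * (w i * dist q (p i)) ≤ w r * dist q (p r) := by
  obtain ⟨hR0, hR1, hR2⟩ := hR
  set m : Fin n := ⟨c, hc⟩ with hm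
  have hW : inp c D = w m := hpw m
  have hwm : ∀ i, w i ≤ w m := fun i => by rw [← hpw, ← hW]; exact hmax i i.2
  have hd : ∀ i, 0 ≤ w i * dist q (p i) := fun i => mul_nonneg (hw i).le dist_nonneg
  obtain ⟨i₀, -, hi₀⟩ := Finset.exists_max_image Finset.univ (fun i => w i * dist q (p i))
    ⟨m, Finset.mem_univ _⟩
  have hi₀' : ∀ i, w i * dist q (p i) ≤ w i₀ * dist q (p i₀) := fun i => hi₀ i (Finset.mem_univ _)
  have hε : 0 < ε := by
    have : (0 : ℝ) < 126 * D := by positivity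
    exact pos_of_mul_pos_right (this.trans_le hk) (by positivity)
  set F := w i₀ * dist q (p i₀) with hF
  have hidx : ∀ e ∈ S, ∃ r : Fin n, (r : ℕ) + 1 = e := fun e he => by
    have := Finset.mem_Icc.1 (hSn he)
    exact ⟨⟨e - 1, by omega⟩, by simp only; omega⟩
  suffices H : ∃ r : Fin n, (r : ℕ) + 1 ∈ S ∧ F - ε * F ≤ w r * dist q (p r) by
    obtain ⟨r, hr, h⟩ := H
    refine ⟨r, hr, fun i => ?_⟩
    rcases le_total ε 1 with h1 | h1
    · nlinarith [hi₀' i, mul_le_mul_of_nonneg_left (hi₀' i) (sub_nonneg.2 h1)]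
    · exact (mul_nonpos_of_nonpos_of_nonneg (sub_nonpos.2 h1) (hd i)).trans (hd r)
  rcases (hd i₀).eq_or_lt with h0 | h0
  · obtain ⟨e, he, -⟩ := hS 0 (by omega) 0 (by positivity)
    obtain ⟨r, rfl⟩ := hidx e he
    refine ⟨r, he, ?_⟩
    rw [← hF] at h0
    rw [← h0]; simpa using hd r
  have hdist : 0 < dist q (p i₀) := pos_of_mul_pos_right h0 (hw i₀).le
  set u := (dist q (p i₀))⁻¹ • (q - p i₀) with hu
  have hu1 : ‖u‖ = 1 := by
    rw [hu, norm_smul, norm_inv, Real.norm_of_nonneg dist_nonneg, ← dist_eq_norm,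
      inv_mul_cancel₀ hdist.ne']
  have huq : inner ℝ u (q - p i₀) = dist q (p i₀) := by
    rw [hu, real_inner_smul_left, real_inner_self_eq_norm_sq, ← dist_eq_norm]
    field_simp
  have huj : ∀ j, |u j| ≤ 1 := fun j => by
    rw [← hu1, ← Real.norm_eq_abs]; exact PiLp.norm_apply_le u j
  -- If `w_e (p_e - c) = 0` for all points, the scale is not bounded in
  -- terms of `F`, but it does not matter.
  obtain ⟨ρ, hρ0, hρF, hρ⟩ : ∃ ρ : ℝ, 0 ≤ ρ ∧ ρ ≤ 2 * F ∧ ∀ e < n, ∀ j < D,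
      ρ * ((inp e j - inp c j) * inp e D / R) = (inp e j - inp c j) * inp e D := by
    rcases hR2 with ⟨e, he, j, hj, hR2⟩ | hR2
    · refine ⟨R, hR0.le, ?_, fun e _ j _ => by field_simp⟩
      have h1 := PiLp.norm_apply_le (p ⟨e, he⟩ - p m) ⟨j, hj⟩
      rw [Real.norm_eq_abs, PiLp.sub_apply, ← hp, ← hp, ← dist_eq_norm] at h1
      have h2 := hi₀' ⟨e, he⟩
      have h3 := hi₀' m
      have h4 := dist_triangle_left (p ⟨e, he⟩) (p m) q
      have h5 := mul_le_mul_of_nonneg_right (hwm ⟨e, he⟩) (dist_nonneg (x := q) (y := p m))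
      have h6 : inp e D = w ⟨e, he⟩ := hpw ⟨e, he⟩
      rw [hR2, h6, abs_mul, abs_of_pos (hw _)]
      have h7 := mul_le_mul_of_nonneg_right (h1.trans h4) (hw ⟨e, he⟩).le
      simp only [hm] at *
      nlinarith
    · exact ⟨0, le_rfl, by linarith, fun e he j hj => by rw [hR2 e he j hj, zero_mul]⟩
  have hlin : ∀ i : Fin n, ∑ j ∈ Finset.range (D + 1),
      (if hj : j < D then -ρ * u ⟨j, hj⟩ else w m * inner ℝ u (q - p m)) *
        normCoord D c inp (inp c D) R i j = w i * inner ℝ u (q - p i) := by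
    intro i
    have hwm0 := (hw m).ne'
    have h1 : q - p i = (q - p m) - (p i - p m) := by abel
    rw [Finset.sum_range_succ, h1, inner_sub_right u (q - p m), PiLp.inner_apply u (p i - p m),
      Finset.sum_range, dif_neg (lt_irrefl _), normCoord, if_neg (lt_irrefl _), hW, hpw, mul_sub,
      Finset.mul_sum, add_comm,
      sub_eq_add_neg (w i * inner ℝ u (q - p m)), ← Finset.sum_neg_distrib]
    congr 1
    · field_simp
    · refine Finset.sum_congr rfl fun j _ => ?_
      have h2 := hρ i i.2 j j.2
      have h3 : inp c j = p m j := hp m j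
      rw [hp, hpw, h3] at h2
      rw [dif_pos j.2, normCoord, if_pos j.2, hp, hpw, h3, PiLp.sub_apply]
      simp only [RCLike.inner_apply, conj_trivial]
      linear_combination (-u j) * h2
  obtain ⟨e, he, hle⟩ := exists_linear_le (t := i₀ + 1) (L := 2 * F) (ξ := fun j =>
    if hj : j < D then -ρ * u ⟨j, hj⟩ else w m * inner ℝ u (q - p m)) hD hS
    (fun j hj => by
      rw [Nat.add_sub_cancel, normCoord]
      split_ifs with h
      · rw [abs_div, abs_of_pos hR0, div_le_one hR0]
        exact hR1 _ i₀.2 _ h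
      · rw [hW, hpw, abs_of_pos (div_pos (hw _) (hw _)), div_le_one (hw _)]
        exact hwm _) (by omega) i₀.2
    (fun j hj => by
      simp only
      split_ifs with h
      · rw [abs_mul, abs_neg, abs_of_nonneg hρ0]
        nlinarith [huj ⟨j, h⟩, abs_nonneg (u ⟨j, h⟩)]
      · have h1 := abs_real_inner_le_norm u (q - p m)
        rw [hu1, one_mul, ← dist_eq_norm] at h1
        rw [abs_mul, abs_of_pos (hw m)]
        have h2 := hi₀' m
        have h3 := mul_le_mul_of_nonneg_left h1 (hw m).le
        linarith)
  obtain ⟨r, rfl⟩ := hidx e he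
  refine ⟨r, he, ?_⟩
  simp only [Nat.add_sub_cancel] at hle
  rw [hlin, hlin, huq, ← hF] at hle
  have h1 := real_inner_le_norm u (q - p r)
  rw [hu1, one_mul, ← dist_eq_norm] at h1
  have h2 := mul_le_mul_of_nonneg_left h1 (hw r).le
  have h3 : (42 * D : ℝ) / 4 ^ k ≤ ε / 3 := by
    rw [div_le_iff₀ (by positivity)]; linarith
  have h4 := mul_le_mul_of_nonneg_left h3 (by linarith : 0 ≤ 2 * F)
  have h5 : 0 ≤ ε * F := by positivity
  linarith

/-! ### Queries -/

/-- Add `∑ i < j, (q i - x i) ^ 2` to `rreg (D + 1)`, where `q i` is in `rreg i` and the `x i` stand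
in the real memory, from the address in `wreg 7` on. -/
def addSquares (D : ℕ) : ℕ → Prog
  | 0 => .skip
  | j + 1 => addSquares D j ;;
      block [rload (D + 2) 7, rsub (D + 2) j (D + 2), rmul (D + 2) (D + 2) (D + 2),
        radd (D + 1) (D + 1) (D + 2), wadd 7 7 1]

theorem addSquares_spec {M D a : ℕ} {s : State} (j : ℕ) (hj : j ≤ D) (h1 : s.wreg 1 = 1)
    (h7 : s.wreg 7 = a) (hM : a + D < M) :
    HaltsWithin M (addSquares D j) s (5 * j) fun s' =>
      s'.wreg = Function.update s.wreg 7 (a + j) ∧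
      s'.rreg (D + 1) = s.rreg (D + 1) +
        ∑ i ∈ Finset.range j, (s.rreg i - s.rmem (a + i)) ^ 2 ∧
      (∀ i ≤ D, s'.rreg i = s.rreg i) ∧ s'.wmem = s.wmem ∧ s'.rmem = s.rmem := by
  induction j with
  | zero => exact .of_wp ⟨by simp [← h7], by simp, fun _ _ => rfl, rfl, rfl⟩ le_rfl
  | succ j ih =>
    refine (ih (by omega)).seq (T₂ := 5) (fun s1 _ ⟨a1, a2, a3, a4, a5⟩ =>
      .of_wp_imp (fun Q hQ => ?_) le_rfl) (by omega)
    have b1 : j ≠ D + 2 := by omega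
    have b2 : D + 1 ≠ D + 2 := by omega
    simp only [Prog.wp, Instr.wp, block, Function.update_self, Function.update_of_ne,
      ne_eq, Nat.reduceEqDiff, not_false_eq_true, a1, a2, a3 j (by omega), a5, h1, b1, b2]
    refine ⟨by omega, by omega, hQ _ ⟨by simp [add_assoc], ?_, fun i hi => ?_, a4, rfl⟩⟩
    · simp only [Function.update_self]
      rw [Finset.sum_range_succ]; ring
    · have b3 : i ≠ D + 1 := by omega
      have b4 : i ≠ D + 2 := by omega
      simp only [Function.update_of_ne, ne_eq, b3, b4, not_false_eq_true, a3 i hi]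

/-- Compare the next point of the list with the best one so far. -/
def queryBody (D : ℕ) : Prog :=
  block [wload 6 5, wsub 6 6 1, wmul 7 6 2, rsub (D + 1) (D + 1) (D + 1)] ;;
  addSquares D D ;;
  block [rload (D + 2) 7, rmul (D + 1) (D + 1) (D + 2), rmul (D + 1) (D + 1) (D + 2)] ;;
  .ite (.rle D (D + 1)) (block [rmove D (D + 1), wmove 0 6]) .skip ;; block [wadd 5 5 1]

/-- The query program for dimension `D ≥ 1`: find the weighted farthest neighbour among the points
of the list, by comparison of the squares of the weighted distances. -/
def query (D : ℕ) : Prog :=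
  block [wconst 1 1, wconst 2 (D + 1), wload 4 0, wconst 5 1] ;;
  .loop (.wle 5 4) (queryBody D)

/-- The square of the weighted distance of `q` from point `e`. -/
noncomputable def sqDist (D : ℕ) (inp : ℕ → ℕ → ℝ) (q : ℕ → ℝ) (e : ℕ) : ℝ :=
  (∑ j ∈ Finset.range D, (q j - inp e j) ^ 2) * inp e D * inp e D

theorem sqDist_nonneg (D : ℕ) (inp : ℕ → ℕ → ℝ) (q : ℕ → ℝ) (e : ℕ) : 0 ≤ sqDist D inp q e := by
  rw [sqDist, mul_assoc]
  exact mul_nonneg (Finset.sum_nonneg fun _ _ => sq_nonneg _) (mul_self_nonneg _)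

theorem queryBody_spec {M n D e i : ℕ} {inp : ℕ → ℕ → ℝ} {q : ℕ → ℝ} {s : State}
    (h1 : s.wreg 1 = 1) (h2 : s.wreg 2 = D + 1) (h5 : s.wreg 5 = i) (he : s.wmem i = e + 1)
    (hen : e < n) (hq : ∀ j < D, s.rreg j = q j) (hin : Input n (D + 1) inp s)
    (hM : n * (D + 1) + 1 < M) (hiM : i + 1 < M) :
    HaltsWithin M (queryBody D) s (5 * D + 11) fun s' =>
      s'.wreg 1 = 1 ∧ s'.wreg 2 = D + 1 ∧ s'.wreg 4 = s.wreg 4 ∧ s'.wreg 5 = i + 1 ∧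
      (∀ j < D, s'.rreg j = q j) ∧ s'.wmem = s.wmem ∧ s'.rmem = s.rmem ∧
      s'.rreg D = max (s.rreg D) (sqDist D inp q e) ∧
      s'.wreg 0 = if s.rreg D ≤ sqDist D inp q e then e else s.wreg 0 := by
  have hrow : e * (D + 1) + D < n * (D + 1) := row_lt hen (Nat.lt_succ_self D)
  have hnD : n ≤ n * (D + 1) := Nat.le_mul_of_pos_right _ (by omega)
  have b1 : D ≠ D + 1 := by omega
  have b2 : D ≠ D + 2 := by omega
  have b3 : D + 1 ≠ D + 2 := by omega
  have b4 : D + 2 ≠ D + 1 := by omega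
  refine HaltsWithin.seq (T₁ := 4) (T₂ := 5 * D + (3 + 4))
    (Q₁ := fun s' => s'.wreg 6 = e ∧ s'.wreg 7 = e * (D + 1) ∧ s'.rreg (D + 1) = 0 ∧
      ∀ j ≤ D, s'.rreg j = s.rreg j)
    (.of_wp_imp (fun Q hQ => ?_) le_rfl) (fun s1 F1 ⟨a1, a2, a3, a4⟩ => ?_) (by omega)
  · simp only [Prog.wp, Instr.wp, block, Function.update_self, Function.update_of_ne,
      ne_eq, Nat.reduceEqDiff, not_false_eq_true, h1, h2, h5, he, Nat.add_sub_cancel]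
    refine ⟨by omega, by omega, by omega, by omega, hQ _ ?_⟩
    refine ⟨by simp, by simp, by simp, fun j hj => ?_⟩
    have : j ≠ D + 1 := by omega
    simp [this]
  have c1 : s1.wreg 1 = 1 := by rw [F1.w 1 rfl, h1]
  have c5 : s1.wreg 5 = i := by rw [F1.w 5 rfl, h5]
  refine (addSquares_spec D le_rfl c1 a2 (by omega)).seq
    (fun s2 F2 ⟨d1, d2, d3, d4, d5⟩ => ?_) le_rfl
  have hsum : s2.rreg (D + 1) = ∑ j ∈ Finset.range D, (q j - inp e j) ^ 2 := by
    rw [d2, a3, zero_add]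
    refine Finset.sum_congr rfl fun j hj => ?_
    have hj' := Finset.mem_range.1 hj
    rw [a4 j hj'.le, hq j hj', F1.rm rfl, hin e j hen (by omega)]
  have hwt : s2.rmem (e * (D + 1) + D) = inp e D := by
    rw [d5, F1.rm rfl, hin e D hen (by omega)]
  have hD : s2.rreg D = s.rreg D := by rw [d3 D le_rfl, a4 D le_rfl]
  have hall : ∀ j < D, s2.rreg j = q j := fun j hj => by rw [d3 j hj.le, a4 j hj.le, hq j hj]
  have hsq : (∑ j ∈ Finset.range D, (q j - inp e j) ^ 2) * inp e D * inp e D =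
    sqDist D inp q e := rfl
  refine .of_wp_imp (fun Q hQ => ?_) le_rfl
  simp only [Prog.wp, Instr.wp, block, Test.Holds, Function.update_self, Function.update_of_ne,
    ne_eq, Nat.reduceEqDiff, not_false_eq_true, d1, hsum, hwt, hD, b1, b2, b3, b4, a1, c1, c5, hsq]
  have hregs : ∀ j < D, j ≠ D ∧ j ≠ D + 1 ∧ j ≠ D + 2 := fun j hj => by omega
  refine ⟨by omega, fun h => ⟨by omega, by omega, hQ _ ?_⟩,
    fun h => ⟨by omega, hQ _ ?_⟩⟩
  · rw [if_pos h, max_eq_right h]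
    refine ⟨by simp [c1], by simp [F1.w 2 rfl, h2], by simp [F1.w 4 rfl], by simp,
      fun j hj => ?_, by rw [d4, F1.wm rfl], by rw [d5, F1.rm rfl], by simp, by simp⟩
    obtain ⟨g1, g2, g3⟩ := hregs j hj
    simp [g1, g2, g3, hall j hj]
  · rw [if_neg h, max_eq_left (not_le.1 h).le]
    refine ⟨by simp [c1], by simp [F1.w 2 rfl, h2], by simp [F1.w 4 rfl], by simp,
      fun j hj => ?_, by rw [d4, F1.wm rfl], by rw [d5, F1.rm rfl], by simp [hD],
      by simp [F1.w 0 rfl]⟩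
    obtain ⟨g1, g2, g3⟩ := hregs j hj
    simp [g2, g3, hall j hj]

theorem query_spec {M n D m : ℕ} {inp : ℕ → ℕ → ℝ} {q : ℕ → ℝ} {s : State}
    (h0 : s.wreg 0 = 0) (hm1 : 1 ≤ m) (hm : s.wmem 0 = m) (hmn : m ≤ n)
    (hlist : ∀ i, 1 ≤ i → i ≤ m → 1 ≤ s.wmem i ∧ s.wmem i ≤ n)
    (hq : ∀ j < D, s.rreg j = q j) (hD : s.rreg D = 0) (hin : Input n (D + 1) inp s)
    (hM : n * (D + 1) + 1 < M) (hDM : D + 1 < M) (hnM : n + 1 < M) :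
    HaltsWithin M (query D) s (m * (5 * D + 12) + 5) fun s' =>
      s'.wmem = s.wmem ∧ s'.rmem = s.rmem ∧
      (∃ i, 1 ≤ i ∧ i ≤ m ∧ s.wmem i = s'.wreg 0 + 1) ∧
      ∀ i, 1 ≤ i → i ≤ m → sqDist D inp q (s.wmem i - 1) ≤ sqDist D inp q (s'.wreg 0) := by
  refine HaltsWithin.seq (T₁ := 4) (T₂ := m * (5 * D + 12) + 1)
    (Q₁ := fun s' => s'.wreg 1 = 1 ∧ s'.wreg 2 = D + 1 ∧ s'.wreg 4 = m ∧ s'.wreg 5 = 1)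
    (.of_wp_imp (fun Q hQ => ?_) le_rfl) (fun s1 F1 ⟨a1, a2, a3, a4⟩ => ?_) (by omega)
  · simp only [Prog.wp, Instr.wp, block, Function.update_of_ne,
      ne_eq, not_false_eq_true, OfNat.zero_ne_ofNat, zero_ne_one, h0, hm]
    exact ⟨by omega, by omega, by omega, by omega, by omega, hQ _ (by simp)⟩
  refine (HaltsWithin.loop m (T := 5 * D + 11) (fun i s' => s'.wreg 1 = 1 ∧
    s'.wreg 2 = D + 1 ∧ s'.wreg 4 = m ∧ s'.wreg 5 = i + 1 ∧ (∀ j < D, s'.rreg j = q j) ∧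
    s'.wmem = s.wmem ∧ s'.rmem = s.rmem ∧
    (i = 0 ∧ s'.rreg D = 0 ∨ s'.rreg D = sqDist D inp q (s'.wreg 0) ∧
      ∃ i', 1 ≤ i' ∧ i' ≤ m ∧ s.wmem i' = s'.wreg 0 + 1) ∧
    ∀ i', 1 ≤ i' → i' ≤ i → sqDist D inp q (s.wmem i' - 1) ≤ s'.rreg D) ?_ ?_ ?_).mono le_rfl ?_
  · refine ⟨a1, a2, a3, a4, fun j hj => by rw [F1.r j rfl, hq j hj], F1.wm rfl, F1.rm rfl,
      .inl ⟨rfl, by rw [F1.r D rfl, hD]⟩, fun i' h1 h2 => by omega⟩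
  · rintro i hi s' - ⟨b1, b2, b3, b4, b5, b6, b7, b8, b9⟩
    refine ⟨by simp only [Test.Holds, b3, b4]; omega, ?_⟩
    obtain ⟨g1, g2⟩ := hlist (i + 1) (by omega) (by omega)
    have he : s.wmem (i + 1) = (s.wmem (i + 1) - 1) + 1 := by omega
    refine (queryBody_spec (n := n) (inp := inp) (e := s.wmem (i + 1) - 1) b1 b2 b4
      (by rw [b6]; exact he) (by omega) b5 (by unfold Input; rw [b7]; exact hin) hM
      (by omega)).mono le_rfl ?_
    rintro s'' - ⟨c1, c2, c3, c4, c5, c6, c7, c8, c9⟩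
    refine ⟨c1, c2, by rw [c3, b3], c4, c5, by rw [c6, b6], by rw [c7, b7], .inr ?_,
      fun i' h1 h2 => ?_⟩
    · split_ifs at c9 with h
      · rw [c8, c9, max_eq_right h]
        exact ⟨rfl, i + 1, by omega, by omega, he⟩
      · rw [c8, c9, max_eq_left (not_le.1 h).le]
        refine b8.resolve_left ?_
        rintro ⟨-, h0⟩
        rw [h0] at h
        exact h (sqDist_nonneg _ _ _ _)
    · rw [c8]
      rcases Nat.lt_succ_iff_lt_or_eq.1 (Nat.lt_succ_of_le h2) with h | rfl
      · exact (b9 i' h1 (by omega)).trans (le_max_left _ _)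
      · exact le_max_right _ _
  · rintro s' - ⟨-, -, b3, b4, -⟩
    simp only [Test.Holds, b3, b4]
    omega
  · rintro s' - ⟨-, -, -, -, -, b6, b7, b8, b9⟩
    obtain ⟨h1, h2⟩ := b8.resolve_left (by omega)
    exact ⟨b6, b7, h2, fun i h3 h4 => (b9 i h3 h4).trans_eq h1⟩

/-! ### Estimates of time and space -/

theorem pow_le_mul_rpow {K G E b : ℝ} {a : ℕ} (hK : 0 ≤ K) (hG : 1 ≤ G) (hE : 1 ≤ E)
    (h : K ^ 2 ≤ G * E) (hab : (a : ℝ) / 2 ≤ b) : K ^ a ≤ G ^ a * E ^ b := by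
  have h1 : K ^ a = (K ^ 2) ^ ((a : ℝ) / 2) := by
    rw [← Real.rpow_natCast K 2, ← Real.rpow_mul hK, ← Real.rpow_natCast K a]
    congr 1; push_cast; ring
  rw [h1]
  refine (Real.rpow_le_rpow (by positivity) h (by positivity)).trans ?_
  rw [Real.mul_rpow (by linarith) (by linarith)]
  refine mul_le_mul ?_ (Real.rpow_le_rpow_of_exponent_le hE hab) (by positivity) (by positivity)
  rw [← Real.rpow_natCast]
  exact Real.rpow_le_rpow_of_exponent_le hG (by linarith [Nat.cast_nonneg (α := ℝ) a])

theorem half_le_log_succ {n : ℕ} (hn : 1 ≤ n) : 1 / 2 ≤ Real.log (n + 1) := by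
  have h1 : Real.log 2 ≤ Real.log (n + 1) :=
    Real.log_le_log (by norm_num) (by have : (1 : ℝ) ≤ n := by exact_mod_cast hn
                                      linarith)
  linarith [Real.log_two_gt_d9]

theorem succ_le_two_pow (k : ℕ) : (k + 1 : ℝ) ≤ 2 ^ k := by
  exact_mod_cast Nat.lt_two_pow_self

theorem two_pow_sq (k : ℕ) : ((2 : ℝ) ^ k) ^ 2 = 4 ^ k := by
  rw [← pow_mul, mul_comm, pow_mul]; norm_num

/-- For `E ≥ 2`, the resolution `k` is at most a multiple of `log E`. -/
theorem succ_le_mul_log {k : ℕ} {G E : ℝ} (hG : 1 ≤ G) (hE : 2 ≤ E) (h : 4 ^ k ≤ G * E) :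
    (k + 1 : ℝ) ≤ (2 * G + 3) * Real.log E := by
  have hL : 1 / 2 ≤ Real.log E := by
    have := Real.log_le_log (by norm_num) hE
    linarith [Real.log_two_gt_d9]
  have h1 := Real.log_le_log (by positivity) h
  rw [Real.log_pow, Real.log_mul (by linarith) (by linarith)] at h1
  have h2 : 1 ≤ Real.log 4 := by
    have : Real.log 4 = 2 * Real.log 2 := by
      rw [show (4 : ℝ) = 2 ^ 2 by norm_num, Real.log_pow]; norm_num
    linarith [Real.log_two_gt_d9]
  have h3 := Real.log_le_self (by linarith : 0 ≤ G)
  have h4 : (k : ℝ) ≤ k * Real.log 4 := le_mul_of_one_le_right (by positivity) h2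
  nlinarith

/-- The main terms of the running time of preprocessing, with `E = 1 / ε`.  If `E ≤ 2`, then the
resolution is bounded; otherwise it is `O(log E)`, and `2 ^ k` is `O(√E)`. -/
theorem exists_preprocess_bound (G : ℝ) (hG : 1 ≤ G) (D : ℕ) (hD : 1 ≤ D) :
    ∃ C : ℝ, 0 ≤ C ∧ ∀ (n k : ℕ) (E : ℝ), 1 ≤ n → 0 < E → (4 : ℝ) ^ k ≤ max 1 (G * E) →
      (k + 1 : ℝ) * (n + (2 ^ k) ^ (2 * D - 1)) ≤
        C * (n * Real.log (n + 1) + E ^ ((D : ℝ) - 1 / 2) * Real.posLog E) := by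
  refine ⟨2 * (2 * G * (1 + (2 * G) ^ (2 * D - 1))) +
    (2 * G + 3) * (2 + G ^ (2 * D - 1)), by positivity, fun n k E hn hE h => ?_⟩
  have hn' : (1 : ℝ) ≤ n := by exact_mod_cast hn
  have hlog := half_le_log_succ hn
  have hpos : 0 ≤ E ^ ((D : ℝ) - 1 / 2) * Real.posLog E :=
    mul_nonneg (Real.rpow_nonneg hE.le _) Real.posLog_nonneg
  have hnl : 0 ≤ n * Real.log (n + 1) := by positivity
  have hK1 : (1 : ℝ) ≤ 2 ^ k := one_le_pow₀ (by norm_num)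
  rcases le_or_gt E 2 with hE2 | hE2
  · have h1 : (4 : ℝ) ^ k ≤ 2 * G := h.trans (max_le (by linarith) (by nlinarith))
    have h2 : (2 : ℝ) ^ k ≤ 2 * G := by
      rw [← two_pow_sq] at h1; nlinarith
    have h3 : (n : ℝ) + (2 ^ k) ^ (2 * D - 1) ≤ n * (1 + (2 * G) ^ (2 * D - 1)) := by
      have := pow_le_pow_left₀ (by positivity) h2 (2 * D - 1)
      have h4 : 0 ≤ (2 * G) ^ (2 * D - 1) := by positivity
      nlinarith
    have h5 := mul_le_mul ((succ_le_two_pow k).trans h2) h3 (by positivity) (by positivity)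
    refine h5.trans ?_
    have h6 : (n : ℝ) ≤ 2 * (n * Real.log (n + 1)) := by nlinarith
    have h7 : 0 ≤ 2 * G * (1 + (2 * G) ^ (2 * D - 1)) := by positivity
    have h8 : 0 ≤ (2 * G + 3) * (2 + G ^ (2 * D - 1)) := by positivity
    have h9 := mul_le_mul_of_nonneg_left h6 h7
    nlinarith [mul_nonneg h8 (add_nonneg hnl hpos), mul_nonneg h7 hpos]
  · have h1 : (4 : ℝ) ^ k ≤ G * E := h.trans (max_le (by nlinarith) le_rfl)
    have h2 := succ_le_mul_log hG hE2.le h1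
    have hL : Real.posLog E = Real.log E :=
      Real.posLog_eq_log (by rw [abs_of_pos hE]; linarith)
    have hL0 : 0 ≤ Real.log E := Real.log_nonneg (by linarith)
    have hD' : (1 : ℝ) ≤ D := by exact_mod_cast hD
    have h3 : ((2 : ℝ) ^ k) ^ (2 * D - 1) ≤ G ^ (2 * D - 1) * E ^ ((D : ℝ) - 1 / 2) := by
      refine pow_le_mul_rpow (by positivity) hG (by linarith) ((two_pow_sq k).trans_le h1) ?_
      rw [Nat.cast_sub (by omega)]; push_cast; linarith
    rw [hL] at hpos ⊢
    set B := E ^ ((D : ℝ) - 1 / 2) with hB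
    have hB0 : 0 ≤ B := Real.rpow_nonneg hE.le _
    -- Either `n` is so large that `log E ≤ 2 log n`, or `n` is below the second term.
    have h4 : n * Real.log E ≤ 2 * (n * Real.log (n + 1)) + B * Real.log E := by
      rcases le_or_gt (E ^ (1 / 2 : ℝ)) n with h5 | h5
      · have h6 := Real.log_le_log (by positivity) (h5.trans (by linarith : (n : ℝ) ≤ n + 1))
        rw [Real.log_rpow hE] at h6
        nlinarith
      · have h6 : E ^ (1 / 2 : ℝ) ≤ B :=
          Real.rpow_le_rpow_of_exponent_le (by linarith) (by linarith)
        have h7 := mul_le_mul_of_nonneg_right (h5.le.trans h6) hL0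
        linarith
    have hG3 : 0 ≤ 2 * G + 3 := by linarith
    calc (k + 1 : ℝ) * (n + (2 ^ k) ^ (2 * D - 1))
        ≤ ((2 * G + 3) * Real.log E) * (n + G ^ (2 * D - 1) * B) :=
          mul_le_mul h2 (by linarith) (by positivity) (by positivity)
      _ = (2 * G + 3) * (n * Real.log E + G ^ (2 * D - 1) * (B * Real.log E)) := by ring
      _ ≤ (2 * G + 3) * ((2 + G ^ (2 * D - 1)) * (n * Real.log (n + 1) + B * Real.log E)) := by
          refine mul_le_mul_of_nonneg_left ?_ hG3
          have h8 : 0 ≤ G ^ (2 * D - 1) := by positivity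
          nlinarith [mul_nonneg h8 hnl]
      _ ≤ _ := by
          rw [← mul_assoc]
          refine mul_le_mul_of_nonneg_right ?_ (add_nonneg hnl hpos)
          have : 0 ≤ 2 * (2 * G * (1 + (2 * G) ^ (2 * D - 1))) := by positivity
          linarith

/-- The number of selected points, up to a constant factor, with `E = 1 / ε`. -/
theorem exists_query_bound (G : ℝ) (hG : 1 ≤ G) (D : ℕ) :
    ∃ C : ℝ, 0 ≤ C ∧ ∀ (n k : ℕ) (E : ℝ), 1 ≤ n → 0 < E → (4 : ℝ) ^ k ≤ max 1 (G * E) →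
      ((2 : ℝ) ^ k) ^ D ≤
        C * (Real.log (n + 1) + E ^ (((D : ℝ) + 1) / 2) * Real.posLog E) := by
  refine ⟨2 * (2 * G) ^ D + 2 * G ^ D, by positivity, fun n k E hn hE h => ?_⟩
  have hlog := half_le_log_succ hn
  have hpos : 0 ≤ E ^ (((D : ℝ) + 1) / 2) * Real.posLog E :=
    mul_nonneg (Real.rpow_nonneg hE.le _) Real.posLog_nonneg
  have hK1 : (1 : ℝ) ≤ 2 ^ k := one_le_pow₀ (by norm_num)
  have hg1 : 0 ≤ (2 * G) ^ D := by positivity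
  have hg2 : 0 ≤ G ^ D := by positivity
  rcases le_or_gt E 2 with hE2 | hE2
  · have h1 : (4 : ℝ) ^ k ≤ 2 * G := h.trans (max_le (by linarith) (by nlinarith))
    have h2 : (2 : ℝ) ^ k ≤ 2 * G := by
      rw [← two_pow_sq] at h1; nlinarith
    have h3 := pow_le_pow_left₀ (by positivity) h2 D
    nlinarith [mul_nonneg hg1 hpos, mul_nonneg hg2 hpos]
  · have h1 : (4 : ℝ) ^ k ≤ G * E := h.trans (max_le (by nlinarith) le_rfl)
    have hL : Real.posLog E = Real.log E :=
      Real.posLog_eq_log (by rw [abs_of_pos hE]; linarith)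
    have hL0 : 1 / 2 ≤ Real.log E := by
      have := Real.log_le_log (by norm_num) hE2.le
      linarith [Real.log_two_gt_d9]
    have h3 : ((2 : ℝ) ^ k) ^ D ≤ G ^ D * E ^ (((D : ℝ) + 1) / 2) :=
      pow_le_mul_rpow (by positivity) hG (by linarith) ((two_pow_sq k).trans_le h1) (by linarith)
    rw [hL] at hpos ⊢
    set B := E ^ (((D : ℝ) + 1) / 2)
    have hB0 : 0 ≤ B := Real.rpow_nonneg hE.le _
    have h4 : B ≤ 2 * (B * Real.log E) := by nlinarith
    have h5 := mul_le_mul_of_nonneg_left h4 hg2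
    nlinarith [mul_nonneg hg1 hpos]

theorem two_pow_mul_numTrees {k D : ℕ} (hD : 1 ≤ D) :
    2 ^ k * numTrees k D 0 = (2 ^ k) ^ (2 * D - 1) := by
  obtain ⟨r, rfl⟩ : ∃ r, D = r + 1 := ⟨D - 1, by omega⟩
  rw [numTrees, ← pow_mul, ← pow_add, ← pow_add]
  congr 1
  simp only [zero_add, Nat.add_sub_cancel, mul_zero]
  rw [show 2 * (r + 1) - 1 = 2 * r + 1 by omega]
  ring

/-- Each of the `O(D)` facets takes `O((n + 2 ^ (k (2 D - 1))) (k + 1))` steps. -/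
theorem preprocessTime_le {n D k : ℕ} (hn : 1 ≤ n) (hD : 1 ≤ D) :
    preprocessTime n D k ≤ 600 * (D + 1) ^ 2 * ((k + 1) * (n + (2 ^ k) ^ (2 * D - 1))) := by
  have hP : 2 ^ k * numTrees k D 0 = (2 ^ k) ^ (2 * D - 1) := two_pow_mul_numTrees hD
  have hKD : 2 ^ (k * D) ≤ (2 ^ k) ^ (2 * D - 1) := by
    rw [pow_mul]; exact Nat.pow_le_pow_right (by positivity) (by omega)
  have hP1 : 1 ≤ (2 ^ k) ^ (2 * D - 1) := Nat.one_le_pow _ _ (by positivity)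
  rw [preprocessTime, facetTime, hP]
  generalize (2 ^ k) ^ (2 * D - 1) = P at *
  generalize 2 ^ (k * D) = Q at *
  obtain ⟨r, rfl⟩ : ∃ r, D = r + 1 := ⟨D - 1, by omega⟩
  obtain ⟨a, rfl⟩ : ∃ a, n = a + 1 := ⟨n - 1, by omega⟩
  obtain ⟨b, rfl⟩ : ∃ b, P = b + 1 := ⟨P - 1, by omega⟩
  have hQ : Q * ((k + 1) * 16 + 21 + 1) ≤ (b + 1) * ((k + 1) * 16 + 21 + 1) :=
    Nat.mul_le_mul_right _ hKD
  simp only [Nat.add_sub_cancel]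
  -- Bounded by a polynomial in `a`, `b`, `k`, `r` with natural coefficients, the running time can
  -- be compared with the bound monomial by monomial.
  have hstep : ∀ x y, x ≤ y → 2 * (r + 1 + 1) * (x + 1) ≤ 2 * (r + 1 + 1) * (y + 1) :=
    fun x y h => Nat.mul_le_mul_left _ (by omega)
  refine le_trans (Nat.add_le_add_left (Nat.add_le_add_left (Nat.add_le_add_left
    (Nat.add_le_add_left (Nat.add_le_add_right (Nat.add_le_add_right
      (hstep _ ((a + 1) * (r + 1 + 1) * 22 + 10 +
        ((a + 1) * (r * (2 * k * 6 + 12 + 1) + (k + 1) * 35 + 19 + 1) + 8 +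
        (r * ((b + 1) * ((k + 1) * 51 + 33) + 10 + 1) + 1 +
        ((b + 1) * ((k + 1) * 16 + 21 + 1) + 2 + 1)))) (by omega)) 1) 2) _) _) _) _) ?_
  ring_nf
  omega

/-- The machine that is admitted for preprocessing, with `N = ⌈1 / ε⌉`, is large enough for
`preprocess_spec`: memory and words are polynomial in `C (n + N)`. -/
theorem machine_large {n N D k C : ℕ} (hn : 1 ≤ n) (hN : 1 ≤ N) (hD : 1 ≤ D)
    (hk : 4 ^ k ≤ 504 * D * N) (hC : 600 * (D + 1) ^ 2 ≤ C) :
    (n + 1) * (D + 2) + 2 * (D + 1) * facetSpace n D k + 1 < (C * (n + N)) ^ C ∧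
      126 * D < (C * (n + N)) ^ C ∧ 4 * 2 ^ k ≤ (C * (n + N)) ^ C ∧
      2 ^ (2 * k) < (C * (n + N)) ^ C ∧ 2 ^ (k * D) < (C * (n + N)) ^ C := by
  have hC1 : 600 * (D + 1) ≤ C := le_trans (by nlinarith) hC
  set Y := C * (n + N) with hY
  have hCY : C ≤ Y := Nat.le_mul_of_pos_right _ (by omega)
  have hCN : C * (n + N) = C * n + C * N := mul_add _ _ _
  have hnY : n + 1 ≤ Y := by
    have : n * 2 ≤ n * C := Nat.mul_le_mul_left _ (by omega)
    rw [hY, hCN, mul_comm C n]; omega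
  have hkY : 4 ^ k ≤ Y := by
    have : 504 * D * N ≤ C * N := Nat.mul_le_mul_right _ (by omega)
    rw [hY, hCN]; omega
  have h2k : 2 ^ (2 * k) = 4 ^ k := by rw [pow_mul]; norm_num
  have hkk : 2 ^ k ≤ 4 ^ k := Nat.pow_le_pow_left (by norm_num) _
  have hYD : Y ≤ Y ^ D := Nat.le_self_pow (by omega) _
  have hYC : Y * Y ^ D ≤ Y ^ C := by
    rw [← pow_succ']; exact Nat.pow_le_pow_right (by omega) (by omega)
  have hCYD : C * Y ^ D ≤ Y * Y ^ D := Nat.mul_le_mul_right _ hCY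
  have hC4 : 600 * Y ^ D ≤ C * Y ^ D := Nat.mul_le_mul_right _ (by omega)
  have hP : numTrees k D 0 * 2 ^ k ≤ Y ^ D := by
    rw [mul_comm, two_pow_mul_numTrees hD]
    calc (2 ^ k) ^ (2 * D - 1) ≤ (2 ^ k) ^ (2 * D) :=
          Nat.pow_le_pow_right (by positivity) (by omega)
      _ = (4 ^ k) ^ D := by rw [← h2k, ← pow_mul, ← pow_mul]; congr 1; ring
      _ ≤ Y ^ D := Nat.pow_le_pow_left hkY _
  have hKD : 2 ^ (k * D) ≤ Y ^ D := by
    rw [pow_mul]; exact Nat.pow_le_pow_left (hkk.trans hkY) _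
  refine ⟨?_, by omega, by omega, by omega, by omega⟩
  have h1 : facetSpace n D k ≤ (D + 1) * Y ^ D + D * (2 * Y ^ D) := by
    rw [facetSpace]
    refine add_le_add ?_ (Nat.mul_le_mul_left _ ?_)
    · rw [mul_comm]; exact Nat.mul_le_mul_left _ (hnY.trans hYD)
    · calc numTrees k D 0 * (2 * 2 ^ k) = 2 * (numTrees k D 0 * 2 ^ k) := by ring
        _ ≤ _ := Nat.mul_le_mul_left _ hP
  calc (n + 1) * (D + 2) + 2 * (D + 1) * facetSpace n D k + 1
      ≤ Y ^ D * (D + 2) + 2 * (D + 1) * ((D + 1) * Y ^ D + D * (2 * Y ^ D)) + 1 * Y ^ D :=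
        add_le_add (add_le_add (Nat.mul_le_mul_right _ (hnY.trans hYD))
          (Nat.mul_le_mul_left _ h1)) (by omega)
    _ < (600 * (D + 1) ^ 2) * Y ^ D := by
        have : 0 < Y ^ D := by omega
        nlinarith [mul_pos this (Nat.succ_pos D), Nat.zero_le (Y ^ D * D ^ 2),
          Nat.zero_le (Y ^ D * D)]
    _ ≤ C * Y ^ D := Nat.mul_le_mul_right _ hC
    _ ≤ Y ^ C := hCYD.trans hYC

end RealRAM

namespace FarthestNeighbor

open RealRAM

theorem inputState_rmem {D n : ℕ} (p : Fin n → EuclideanSpace ℝ (Fin D)) (w : Fin n → ℝ) (ε : ℝ)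
    (i : Fin n) :
    (∀ j : Fin D, (inputState p w ε).rmem (i * (D + 1) + j) = p i j) ∧
      (inputState p w ε).rmem (i * (D + 1) + D) = w i := by
  have hdiv : ∀ j < D + 1, ((i : ℕ) * (D + 1) + j) / (D + 1) = i ∧
      ((i : ℕ) * (D + 1) + j) % (D + 1) = j := by
    intro j hj
    rw [mul_comm, Nat.mul_add_div (by omega), Nat.div_eq_of_lt hj, Nat.mul_add_mod,
      Nat.mod_eq_of_lt hj]
    exact ⟨rfl, rfl⟩
  refine ⟨fun j => ?_, ?_⟩
  · obtain ⟨h1, h2⟩ := hdiv j (by omega)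
    simp [inputState, h1, h2]
  · obtain ⟨h1, h2⟩ := hdiv D (by omega)
    simp [inputState, h1, h2]

theorem sqDist_eq {D n : ℕ} {p : Fin n → EuclideanSpace ℝ (Fin D)} {w : Fin n → ℝ}
    {inp : ℕ → ℕ → ℝ} (hp : ∀ (i : Fin n) (j : Fin D), inp i j = p i j)
    (hpw : ∀ i : Fin n, inp i D = w i) (q : EuclideanSpace ℝ (Fin D)) (i : Fin n) :
    sqDist D inp (fun x => if hx : x < D then q ⟨x, hx⟩ else 0) i = (w i * dist q (p i)) ^ 2 := by
  rw [sqDist, EuclideanSpace.dist_eq, mul_pow, Real.sq_sqrt (by positivity), Finset.sum_range, hpw]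
  simp only [Fin.is_lt, dif_pos, Fin.eta, hp, Real.dist_eq, sq_abs]
  ring

end FarthestNeighbor

open RealRAM FarthestNeighbor in
/-- In dimension `0` all points coincide with the query point. -/
theorem isApproxFarthest_of_dim_zero {n : ℕ} (p : Fin n → EuclideanSpace ℝ (Fin 0))
    (w : Fin n → ℝ) (ε : ℝ) (q : EuclideanSpace ℝ (Fin 0)) (r : Fin n) :
    IsApproxFarthest p w ε q r := fun i => by
  rw [Subsingleton.elim (p i) q, Subsingleton.elim (p r) q, dist_self, mul_zero, mul_zero, mul_zero]

theorem corollary1 (D : ℕ) :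
    ∃ (preprocess query : RealRAM.Prog) (C : ℕ),
      ∀ (n : ℕ) (_hn : 1 ≤ n) (p : Fin n → EuclideanSpace ℝ (Fin D)) (w : Fin n → ℝ)
        (_hw : ∀ i, 0 < w i) (ε : ℝ) (_hε : 0 < ε),
        ∃ (t : ℕ) (s : RealRAM.State),
          -- preprocessing, with words of `O(log (n + 1 / ε))` bits
          RealRAM.Runs ((C * (n + ⌈1 / ε⌉₊)) ^ C) preprocess
            (FarthestNeighbor.inputState p w ε) t s ∧
          (t : ℝ) ≤ C * (n * Real.log (n + 1)
            + ε ^ ((1 : ℝ) / 2 - D) * Real.posLog (1 / ε)) ∧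
          -- queries, in the first `C * n` cells of the memories that preprocessing has left
          ∀ q : EuclideanSpace ℝ (Fin D),
            ∃ (t' : ℕ) (s' : RealRAM.State) (r : Fin n),
              RealRAM.Runs (C * n) query (FarthestNeighbor.queryState s q) t' s' ∧
              (t' : ℝ) ≤ C * (Real.log (n + 1)
                + ε ^ ((-(D : ℝ) - 1) / 2) * Real.posLog (1 / ε)) ∧
              s'.wreg 0 = r ∧
              FarthestNeighbor.IsApproxFarthest p w ε q r ∧
              s'.wmem = s.wmem ∧ s'.rmem = s.rmem := by
  rcases Nat.eq_zero_or_pos D with rfl | hD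
  · refine ⟨.skip, .skip, 0, fun n hn p w hw ε hε => ⟨0, _, .skip _, by simp, fun q =>
      ⟨0, _, ⟨0, hn⟩, .skip _, by simp, rfl, isApproxFarthest_of_dim_zero p w ε q _, rfl, rfl⟩⟩⟩
  have hD1 : (1 : ℝ) ≤ D := by exact_mod_cast hD
  have hG : (1 : ℝ) ≤ 504 * D := by linarith
  obtain ⟨C₁, hC₁, hbound₁⟩ := RealRAM.exists_preprocess_bound (504 * D) hG D hD
  obtain ⟨C₂, hC₂, hbound₂⟩ := RealRAM.exists_query_bound (504 * D) hG D
  obtain ⟨C, hCC₁, hCC₂, hCD⟩ : ∃ C : ℕ, 600 * (D + 1) ^ 2 * C₁ ≤ C ∧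
      (5 * D + 17) * (2 * (D + 1)) * C₂ ≤ C ∧ 600 * (D + 1) ^ 2 ≤ C :=
    ⟨max (max ⌈600 * (D + 1) ^ 2 * C₁⌉₊ ⌈(5 * D + 17) * (2 * (D + 1)) * C₂⌉₊) (600 * (D + 1) ^ 2),
      (Nat.le_ceil _).trans (by exact_mod_cast (le_max_left _ _).trans (le_max_left _ _)),
      (Nat.le_ceil _).trans (by exact_mod_cast (le_max_right _ _).trans (le_max_left _ _)),
      le_max_right _ _⟩
  refine ⟨RealRAM.preprocess D, RealRAM.query D, C, fun n hn p w hw ε hε => ?_⟩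
  -- the resolution that `findResolution` finds
  have hex : ∃ k : ℕ, (126 * D : ℝ) ≤ 4 ^ k * ε := by
    obtain ⟨k, hk⟩ := pow_unbounded_of_one_lt (126 * D / ε : ℝ) (by norm_num : (1 : ℝ) < 4)
    exact ⟨k, by rw [div_lt_iff₀ hε] at hk; exact hk.le⟩
  classical
  obtain ⟨k, hk, hk'⟩ : ∃ k : ℕ, (126 * D : ℝ) ≤ 4 ^ k * ε ∧ ∀ i < k, 4 ^ i * ε < 126 * D :=
    ⟨Nat.find hex, Nat.find_spec hex, fun i hi => not_le.1 (Nat.find_min hex hi)⟩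
  have hkE : (4 : ℝ) ^ k ≤ max 1 (504 * D * (1 / ε)) := by
    rcases k with - | k
    · simp
    · refine le_max_of_le_right ?_
      rw [mul_one_div, le_div_iff₀ hε, pow_succ]
      linarith [hk' k (Nat.lt_succ_self k)]
  have hN : 1 ≤ ⌈1 / ε⌉₊ := Nat.ceil_pos.2 (by positivity)
  have hkN : 4 ^ k ≤ 504 * D * ⌈1 / ε⌉₊ := by
    have h1 : (1 : ℝ) ≤ ⌈1 / ε⌉₊ := by exact_mod_cast hN
    have h2 : (504 * D : ℝ) * (1 / ε) ≤ 504 * D * ⌈1 / ε⌉₊ :=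
      mul_le_mul_of_nonneg_left (Nat.le_ceil _) (by linarith)
    have h3 : (4 : ℝ) ^ k ≤ 504 * D * ⌈1 / ε⌉₊ := hkE.trans (max_le (by nlinarith) h2)
    exact_mod_cast h3
  obtain ⟨hM1, hM2, hM3, hM4, hM5⟩ := RealRAM.machine_large hn hN hD hkN hCD
  set inp : ℕ → ℕ → ℝ := fun e j => (FarthestNeighbor.inputState p w ε).rmem (e * (D + 1) + j)
    with hinp
  have hp : ∀ (i : Fin n) (j : Fin D), inp i j = p i j :=
    fun i j => (FarthestNeighbor.inputState_rmem p w ε i).1 j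
  have hpw : ∀ i : Fin n, inp i D = w i := fun i => (FarthestNeighbor.inputState_rmem p w ε i).2
  obtain ⟨t, s, hrun, ht, c, R, S, hc, hmax, hR, hcard, hSn, hS, hm, hmem, hsurj, hin⟩ :=
    RealRAM.preprocess_spec (n := n) (inp := inp) (s := FarthestNeighbor.inputState p w ε) hn hD
      (fun e he => by rw [hpw ⟨e, he⟩]; exact hw _) rfl rfl rfl (fun _ => rfl)
      (fun _ _ _ _ => rfl) hk hk' hM1 hM2 hM3 hM4 hM5
  refine ⟨t, s, hrun, ?_, fun q => ?_⟩
  · have h1 := hbound₁ n k (1 / ε) hn (by positivity) hkE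
    have h2 : (1 / ε) ^ ((D : ℝ) - 1 / 2) = ε ^ ((1 : ℝ) / 2 - D) := by
      rw [one_div, Real.inv_rpow hε.le, ← Real.rpow_neg hε.le, neg_sub]
    rw [h2] at h1
    have h3 : (t : ℝ) ≤ 600 * (D + 1) ^ 2 * ((k + 1) * (n + (2 ^ k) ^ (2 * D - 1))) := by
      exact_mod_cast ht.trans (RealRAM.preprocessTime_le hn hD)
    have h4 : 0 ≤ n * Real.log (n + 1) + ε ^ ((1 : ℝ) / 2 - D) * Real.posLog (1 / ε) :=
      add_nonneg (mul_nonneg n.cast_nonneg (Real.log_nonneg (by simp)))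
        (mul_nonneg (Real.rpow_nonneg hε.le _) Real.posLog_nonneg)
    calc (t : ℝ) ≤ _ := h3
      _ ≤ _ := mul_le_mul_of_nonneg_left h1 (by positivity)
      _ = 600 * (D + 1) ^ 2 * C₁ * _ := by rw [← mul_assoc]
      _ ≤ _ := mul_le_mul_of_nonneg_right hCC₁ h4
  · have hm1 : 1 ≤ S.card := by
      obtain ⟨e, he, -⟩ := hS 0 (by omega) 0 (by positivity)
      exact Finset.card_pos.2 ⟨e, he⟩
    have hmn : S.card ≤ n := by simpa using Finset.card_le_card hSn
    have hCD1 : 600 * (D + 1) ≤ C :=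
      (Nat.mul_le_mul_left 600 (Nat.le_self_pow two_ne_zero (D + 1))).trans hCD
    have hCn : 600 * (D + 1) * n ≤ C * n := Nat.mul_le_mul_right n hCD1
    have hsplit : 600 * (D + 1) * n = 600 * (n * (D + 1)) := by
      rw [mul_assoc, mul_comm n]
    have hnD : n ≤ n * (D + 1) := Nat.le_mul_of_pos_right _ (by omega)
    have hDn : D + 1 ≤ n * (D + 1) := Nat.le_mul_of_pos_left _ hn
    obtain ⟨t', s', hrun', ht', hw1, hr1, ⟨i, hi1, hi2, hi3⟩, hbest⟩ :=
      RealRAM.query_spec (M := C * n) (n := n) (inp := inp)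
        (q := fun x => if hx : x < D then q ⟨x, hx⟩ else 0)
        (s := FarthestNeighbor.queryState s q) rfl hm1 hm hmn
        (fun i h1 h2 => Finset.mem_Icc.1 (hSn (hmem i h1 h2))) (fun j _ => rfl)
        (by simp [FarthestNeighbor.queryState]) hin (by omega) (by omega) (by omega)
    have hi4 : s'.wreg 0 < n := by
      have h1 : s.wmem i = s'.wreg 0 + 1 := hi3
      have h2 := Finset.mem_Icc.1 (hSn (hmem i hi1 hi2))
      omega
    refine ⟨t', s', ⟨s'.wreg 0, hi4⟩, hrun', ?_, rfl, ?_, hw1, hr1⟩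
    · have h1 := hbound₂ n k (1 / ε) hn (by positivity) hkE
      have h2 : (1 / ε) ^ (((D : ℝ) + 1) / 2) = ε ^ ((-(D : ℝ) - 1) / 2) := by
        rw [one_div, Real.inv_rpow hε.le, ← Real.rpow_neg hε.le]
        congr 1; ring
      rw [h2] at h1
      have h3 : t' ≤ (5 * D + 17) * (2 * (D + 1)) * (2 ^ k) ^ D := by
        calc t' ≤ S.card * (5 * D + 12) + 5 := ht'
          _ ≤ (5 * D + 17) * S.card := by nlinarith
          _ ≤ (5 * D + 17) * (2 * (D + 1) * 2 ^ (k * D)) := Nat.mul_le_mul_left _ hcard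
          _ = _ := by rw [pow_mul]; ring
      have h4 : (t' : ℝ) ≤ (5 * D + 17) * (2 * (D + 1)) * (2 ^ k) ^ D := by exact_mod_cast h3
      have h5 : 0 ≤ Real.log (n + 1) + ε ^ ((-(D : ℝ) - 1) / 2) * Real.posLog (1 / ε) :=
        add_nonneg (Real.log_nonneg (by simp))
          (mul_nonneg (Real.rpow_nonneg hε.le _) Real.posLog_nonneg)
      calc (t' : ℝ) ≤ _ := h4
        _ ≤ _ := mul_le_mul_of_nonneg_left h1 (by positivity)
        _ = (5 * D + 17) * (2 * (D + 1)) * C₂ * _ := by rw [← mul_assoc]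
        _ ≤ _ := mul_le_mul_of_nonneg_right hCC₂ h5
    · obtain ⟨r, hr, hfar⟩ := RealRAM.exists_selected_far hD hw hp hpw hc hmax hR hSn hS hk q
      obtain ⟨j, hj1, hj2, hj3⟩ := hsurj _ hr
      have h1 := hbest j hj1 hj2
      have h2 : (FarthestNeighbor.queryState s q).wmem j - 1 = r := by
        change s.wmem j - 1 = r
        omega
      rw [h2, FarthestNeighbor.sqDist_eq hp hpw,
        FarthestNeighbor.sqDist_eq hp hpw q ⟨s'.wreg 0, hi4⟩] at h1
      exact fun l => (hfar l).trans
        (le_of_sq_le_sq h1 (mul_nonneg (hw _).le dist_nonneg))
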